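/- **Setting.** Let $U$ be a coordinate domain (an open set of $\mathbb R^4$, coordinates positively oriented) of a spacetime with smooth metric $g$ of signature $(-,+,+,+)$. Vectors and covectors are identified by $g$, and $(x,y)=g(x,y)$, $x^2=(x,x)$. Let $u$ be a smooth time-like vector field on $U$ with $u^2=-1$, and write $\dot q=u(q)$. All functions are smooth, and "locally" means on a neighbourhood of every point. Put $$\theta=\nabla\cdot u,\quad a=i(u)du,\quad \omega=*(u\wedge du),\quad v=*(a\wedge da),\quad c=\tfrac1{a^2}i(a)da,\quad \mu=\tfrac{(c,u)}{\theta},\quad \nu=2+\tfrac{1}{\theta a^2}i(a)d\theta .$$ **Classes.** The relations hold at every point of $U$. $C_1$: $\theta=0$. $C_2$: $\theta\ne0$, $a=0$. In $C_3,\dots,C_8$: $\theta\neq0$, $a\ne0$, and moreover $C_3$: $(v,u)\neq0$; $C_4$: $(v,u)=0$, $v\ne0$; $C_5$: $v=0$, $\nu\ne0$, $\dot\mu\neq0$; $C_6$: $v=0$, $\nu\neq0$, $\dot\mu=0$; $C_7$: $v=0$, $\nu=0$, $\omega\ne0$; $C_8$: $v=0$, $\nu=0$, $\omega=0$. **Classical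 ideal gas.** A pair $(\rho,p)$ is a hydrodynamic pair of a classical ideal gas (CIG) with velocity $u$ and adiabatic index $\gamma$ if $$dp+\dot p\,u+(\rho+p)a=0,\qquad \dot\rho+(\rho+p)\theta=0,$$ and there are constants $k,c_v>0$ with $\gamma=1+k/c_v$ and functions $n>0$, $\epsilon$, $s$, $\Theta>0$ with $\rho=n(1+\epsilon)$, $\dot n+n\theta=0$, $\Theta\,ds=d\epsilon+p\,d(1/n)$, $p=kn\Theta$, $\epsilon=c_v\Theta$. The field $u$ is a CIG velocity if such a pair (for some $\gamma$) exists locally. **Functions of the velocity.** Let $x=*(d\theta\wedge u\wedge a)$, $\Delta=(\dot\nu-\theta\mu\nu)^2-4\dot\mu\theta\nu(1-\nu)$, $\tilde\gamma[f]=\frac1f\bigl(1+\frac{\dot f}{\theta}\bigr)$, and $$f_1=-\theta\frac{(\omega,a)}{(v,u)},\quad f_2=\frac{(x,v)}{v^2},\quad f_\pm=\frac{\theta\mu\nu-\dot\nu\pm\sqrt\Delta}{2\dot\mu},\quad f_3=\frac{\theta\nu(1-\nu)}{\theta\mu\nu-\dot\nu},\quad f_4=-\frac{2\theta^2}{\dot\theta},\quad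 f_5=\frac{\theta}{(c,u)} .$$ **Theorem.** Let $u$ be a CIG velocity on $U$ and let $\gamma>1$. In each case below, $(\rho,p)$ is a hydrodynamic pair of a CIG with velocity $u$ and index $\gamma$ if and only if $p>0$, $\rho-\frac{p}{\gamma-1}>0$ (the matter density is positive), and the stated relations hold locally. * $C_1$ with $a=0$ everywhere: $p=p_0$ is constant and $\rho=\rho(\varphi_1,\varphi_2,\varphi_3)$. Here $\varphi_1,\varphi_2,\varphi_3$ are any independent functions with $\dot\varphi_i=0$; such functions exist locally. * $C_1$ with $a\ne0$ everywhere: $p=p(\alpha)$ and $\rho=-p(\alpha)-\beta\,p'(\alpha)$. Here $\alpha,\beta$ are any functions with $d\alpha=\beta a$ and $\beta$ nowhere zero; such functions exist locally. * $C_2$: $p=C\,e^{-\gamma\int\theta(t)dt}$ with $C$ constant, and $\rho=\frac{p}{\gamma-1}+B(\varphi_1,\varphi_2,\varphi_3)\,p^{1/\gamma}$. Here $t$ is any function with $u=-dt$ and $\theta=\theta(t)$, and $\varphi_1,\varphi_2,\varphi_3$ are any independent functions with $\dot\varphi_i=0$; such functions exist locally. * $C_3,C_4,C_5,C_6$: $\gamma=\tilde\gamma[f]+1$,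 $p=C\,e^{\gamma\psi}$ with $C$ constant, and $\rho=p(\gamma f-1)$, where $d\psi=\theta u-fa$. In $C_3$, $f=f_1$. In $C_4$, $f=f_2$. In $C_5$, $\Delta\ge0$ and $f$ is a smooth function taking at each point the value $f_+$ or $f_-$. In $C_6$, $f=f_3$. * $C_7,C_8$: $\gamma=\tilde\gamma[f]+1$, $p=C\,e^{\gamma\psi}$ with $C$ constant, and $\rho=p(\gamma f_\varphi-1)$, where $f_\varphi=f+\beta\,\varphi(\alpha)$ for a real function $\varphi$ and $d\psi=\theta u-f_\varphi a$. In $C_7$, $f=f_4$. In $C_8$, $f=f_5$. Here $\alpha,\beta$ are any functions with $d\alpha=\beta a$ and $\beta$ nowhere zero; such functions exist locally. For every real function $\varphi$ a function $\psi$ with $d\psi=\theta u-f_\varphi a$ exists locally. In $C_6$ (respectively $C_7$) the set where $\dot\nu-\theta\mu\nu\neq0$ (respectively $\dot\theta\ne0$), so that $f_3$ (respectively $f_4$) is defined, is dense in $U$, and the equivalence is asserted when it is all of $U$. In $C_8$, $(c,u)\neq0$ everywhere. -/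

import Mathlib

open scoped ContDiff

noncomputable section

namespace ClassicalIdealGas

/-! ## Tensor calculus on a coordinate domain of a four-dimensional spacetime

Points are coordinate quadruples; fields are given by their components in these coordinates. -/

/-- Coordinate quadruples. -/
abbrev Pt := Fin 4 → ℝ

/-- Components of a vector field or of a covector field (one-form). -/
abbrev Field1 := Pt → Fin 4 → ℝ

/-- Covariant components of a two-form. -/
abbrev Field2 := Pt → Fin 4 → Fin 4 → ℝ

/-- Covariant components of a three-form. -/
abbrev Field3 := Pt → Fin 4 → Fin 4 → Fin 4 → ℝ

/-- Covariant components of a metric tensor. -/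
abbrev MetricField := Pt → Matrix (Fin 4) (Fin 4) ℝ

/-- `f` is a smooth function on `W`. -/
def Smooth (W : Set Pt) (f : Pt → ℝ) : Prop := ContDiffOn ℝ ∞ f W

/-- Partial derivative `∂ᵢ f`. -/
def pd (f : Pt → ℝ) (i : Fin 4) (x : Pt) : ℝ := fderiv ℝ f x (Pi.single i 1)

/-- The differential `df`, as a covector field. -/
def grad (f : Pt → ℝ) : Field1 := fun x i => pd f i x

/-- `g` is a smooth metric of signature `(-,+,+,+)` on `U`. -/
structure IsLorentzMetric (U : Set Pt) (g : MetricField) : Prop where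
  smooth : ∀ i j, Smooth U (fun x => g x i j)
  symm : ∀ x ∈ U, (g x).IsSymm
  signature : ∀ x ∈ U, ∃ P : Matrix (Fin 4) (Fin 4) ℝ, IsUnit P.det ∧
    P.transpose * g x * P = Matrix.diagonal ![-1, 1, 1, 1]

/-- Lowering the index of a vector field. -/
def lower (g : MetricField) (X : Field1) : Field1 := fun x i => ∑ j, g x i j * X x j

/-- Raising the index of a covector field. -/
def raise (g : MetricField) (ξ : Field1) : Field1 := fun x i => ∑ j, (g x)⁻¹ i j * ξ x j

/-- The metric product `(ξ, η)` of two covector fields. -/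
def ip (g : MetricField) (ξ η : Field1) (x : Pt) : ℝ :=
  ∑ i, ∑ j, (g x)⁻¹ i j * ξ x i * η x j

/-- Exterior derivative of a one-form. -/
def extD (ξ : Field1) : Field2 :=
  fun x i j => pd (fun y => ξ y j) i x - pd (fun y => ξ y i) j x

/-- Interior product `i(X)F` of a vector field and a two-form. -/
def interior2 (X : Field1) (F : Field2) : Field1 := fun x j => ∑ i, X x i * F x i j

/-- Exterior product of two one-forms. -/
def wedge11 (ξ η : Field1) : Field2 := fun x i j => ξ x i * η x j - ξ x j * η x i

/-- Exterior product of a one-form and a two-form. -/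
def wedge12 (ξ : Field1) (F : Field2) : Field3 :=
  fun x i j k => ξ x i * F x j k + ξ x j * F x k i + ξ x k * F x i j

/-- The Levi-Civita symbol: the determinant whose rows are the unit vectors
with the given numbers. -/
def leviCivita (i j k l : Fin 4) : ℝ :=
  Matrix.det (Matrix.of fun r c : Fin 4 => if ![i, j, k, l] r = c then (1 : ℝ) else 0)

/-- Hodge dual of a three-form,
`(*T)_l = (1/3!) √|det g| ε_{ijkl} T^{ijk}` (coordinates positively oriented). -/
def hodge3 (g : MetricField) (T : Field3) : Field1 := fun x l =>
  (1 / 6) * Real.sqrt |(g x).det| *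
    ∑ i, ∑ j, ∑ k, leviCivita i j k l *
      ∑ i', ∑ j', ∑ k', (g x)⁻¹ i i' * (g x)⁻¹ j j' * (g x)⁻¹ k k' * T x i' j' k'

/-- Christoffel symbols `Γⁱ_{jk}` of the Levi-Civita connection. -/
def christoffel (g : MetricField) (x : Pt) (i j k : Fin 4) : ℝ :=
  (1 / 2) * ∑ l, (g x)⁻¹ i l *
    (pd (fun y => g y l k) j x + pd (fun y => g y l j) k x - pd (fun y => g y j k) l x)

/-- Covariant divergence `∇·X` of a vector field. -/
def divergence (g : MetricField) (X : Field1) (x : Pt) : ℝ :=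
  ∑ i, (pd (fun y => X y i) i x + ∑ j, christoffel g x i i j * X x j)

/-- `dot u q` is the derivative `u(q)` of a function along `u`. -/
def dot (u : Field1) (q : Pt → ℝ) (x : Pt) : ℝ := ∑ i, u x i * pd q i x

/-- `u` (contravariant components) is a smooth unit time-like vector field on `U`. -/
structure IsUnitTimelike (U : Set Pt) (g : MetricField) (u : Field1) : Prop where
  smooth : ∀ i, Smooth U (fun x => u x i)
  unit : ∀ x ∈ U, ∑ i, lower g u x i * u x i = -1

/-! ## Differential concomitants of the velocity -/

section Concomitants

variable (g : MetricField) (u : Field1)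

/-- Expansion `θ = ∇·u`. -/
def theta : Pt → ℝ := divergence g u

/-- Acceleration one-form `a = i(u)du`. -/
def acc : Field1 := interior2 u (extD (lower g u))

/-- Square `a²` of the acceleration. -/
def accSq : Pt → ℝ := ip g (acc g u) (acc g u)

/-- Vorticity `ω = *(u ∧ du)`. -/
def omega : Field1 := hodge3 g (wedge12 (lower g u) (extD (lower g u)))

/-- Vorticity of the acceleration, `v = *(a ∧ da)`. -/
def vVec : Field1 := hodge3 g (wedge12 (acc g u) (extD (acc g u)))

/-- `(v, u)`. -/
def vu : Pt → ℝ := ip g (vVec g u) (lower g u)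

/-- `c = a⁻² i(a)da`. -/
def cVec : Field1 := fun x j =>
  (1 / accSq g u x) * interior2 (raise g (acc g u)) (extD (acc g u)) x j

/-- `(c, u)`. -/
def cu : Pt → ℝ := ip g (cVec g u) (lower g u)

/-- `μ = (c, u) / θ`. -/
def mu : Pt → ℝ := fun x => cu g u x / theta g u x

/-- `ν = 2 + (θ a²)⁻¹ i(a)dθ`. -/
def nu : Pt → ℝ := fun x =>
  2 + (1 / (theta g u x * accSq g u x)) * ip g (acc g u) (grad (theta g u)) x

/-- `x = *(dθ ∧ u ∧ a)`. -/
def xVec : Field1 :=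
  hodge3 g (wedge12 (grad (theta g u)) (wedge11 (lower g u) (acc g u)))

/-- `ν̇ - θ μ ν`. -/
def linCoeff : Pt → ℝ := fun x =>
  dot u (nu g u) x - theta g u x * mu g u x * nu g u x

/-- `Δ = (ν̇ - θ μ ν)² - 4 μ̇ θ ν (1 - ν)`. -/
def discr : Pt → ℝ := fun x =>
  linCoeff g u x ^ 2 - 4 * dot u (mu g u) x * theta g u x * nu g u x * (1 - nu g u x)

/-- `f₁ = -θ (ω, a) / (v, u)`. -/
def f1 : Pt → ℝ := fun x => -theta g u x * (ip g (omega g u) (acc g u) x / vu g u x)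

/-- `f₂ = (x, v) / v²`. -/
def f2 : Pt → ℝ := fun x => ip g (xVec g u) (vVec g u) x / ip g (vVec g u) (vVec g u) x

/-- `f₊ = (θ μ ν - ν̇ + √Δ) / (2 μ̇)`. -/
def fPlus : Pt → ℝ := fun x =>
  (1 / (2 * dot u (mu g u) x)) * (-linCoeff g u x + Real.sqrt (discr g u x))

/-- `f₋ = (θ μ ν - ν̇ - √Δ) / (2 μ̇)`. -/
def fMinus : Pt → ℝ := fun x =>
  (1 / (2 * dot u (mu g u) x)) * (-linCoeff g u x - Real.sqrt (discr g u x))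

/-- `f₃ = θ ν (1 - ν) / (θ μ ν - ν̇)`: the root of `(ν̇ - θ μ ν) f + θ ν (1 - ν) = 0`. -/
def f3 : Pt → ℝ := fun x =>
  theta g u x * nu g u x * (1 - nu g u x) /
    (theta g u x * mu g u x * nu g u x - dot u (nu g u) x)

/-- `f₄ = -2 θ² / θ̇`. -/
def f4 : Pt → ℝ := fun x => -(2 * theta g u x ^ 2) / dot u (theta g u) x

/-- `f₅ = θ / (c, u)`. -/
def f5 : Pt → ℝ := fun x => theta g u x / cu g u x

/-- `γ̃[f] = (1 + ḟ / θ) / f`. -/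
def gammaTilde (f : Pt → ℝ) : Pt → ℝ := fun x => (1 / f x) * (1 + dot u f x / theta g u x)

end Concomitants

/-! ## The eight classes of unit vectors -/

section Classes

variable (U : Set Pt) (g : MetricField) (u : Field1)

/-- Class `C₁`. -/
def IsC1 : Prop := ∀ x ∈ U, theta g u x = 0

/-- Class `C₂`. -/
def IsC2 : Prop := ∀ x ∈ U, theta g u x ≠ 0 ∧ acc g u x = 0

/-- Class `C₃`. -/
def IsC3 : Prop := ∀ x ∈ U, theta g u x ≠ 0 ∧ acc g u x ≠ 0 ∧ vu g u x ≠ 0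

/-- Class `C₄`. -/
def IsC4 : Prop := ∀ x ∈ U, theta g u x ≠ 0 ∧ acc g u x ≠ 0 ∧ vu g u x = 0 ∧ vVec g u x ≠ 0

/-- Class `C₅`. -/
def IsC5 : Prop := ∀ x ∈ U, theta g u x ≠ 0 ∧ acc g u x ≠ 0 ∧ vVec g u x = 0 ∧
  nu g u x ≠ 0 ∧ dot u (mu g u) x ≠ 0

/-- Class `C₆`. -/
def IsC6 : Prop := ∀ x ∈ U, theta g u x ≠ 0 ∧ acc g u x ≠ 0 ∧ vVec g u x = 0 ∧
  nu g u x ≠ 0 ∧ dot u (mu g u) x = 0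

/-- Class `C₇`. -/
def IsC7 : Prop := ∀ x ∈ U, theta g u x ≠ 0 ∧ acc g u x ≠ 0 ∧ vVec g u x = 0 ∧
  nu g u x = 0 ∧ omega g u x ≠ 0

/-- Class `C₈`. -/
def IsC8 : Prop := ∀ x ∈ U, theta g u x ≠ 0 ∧ acc g u x ≠ 0 ∧ vVec g u x = 0 ∧
  nu g u x = 0 ∧ omega g u x = 0

end Classes

/-! ## Classical ideal gases -/

/-- `P` holds on some open neighbourhood, inside `U`, of every point of `U`. -/
def Locally (U : Set Pt) (P : Set Pt → Prop) : Prop :=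
  ∀ x ∈ U, ∃ W : Set Pt, IsOpen W ∧ x ∈ W ∧ W ⊆ U ∧ P W

/-- `(ρ, p)` is a pair of hydrodynamic quantities which, together with the velocity `u`,
describes on `U` the evolution in local thermal equilibrium of a classical ideal gas of
adiabatic index `γ = 1 + k / c_v`: the energy-momentum conservation equations hold, and there
are a matter density `n`, a specific internal energy `ε`, a specific entropy `s` and a
temperature `Θ` that solve, with `ρ` and `p`, the fundamental system of the classical ideal
gas hydrodynamics. -/
structure IsCIGPair (U : Set Pt) (g : MetricField) (u : Field1) (γ : ℝ)
    (ρ p : Pt → ℝ) : Prop where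
  smooth_rho : Smooth U ρ
  smooth_p : Smooth U p
  /-- `dp + ṗ u + (ρ + p) a = 0` -/
  momentum : ∀ x ∈ U, ∀ i,
    pd p i x + dot u p x * lower g u x i + (ρ x + p x) * acc g u x i = 0
  /-- `ρ̇ + (ρ + p) θ = 0` -/
  energy : ∀ x ∈ U, dot u ρ x + (ρ x + p x) * theta g u x = 0
  /-- `ρ = n (1 + ε)`, `ṅ + n θ = 0`, `Θ ds = dε + p d(1/n)`, `p = k n Θ`, `ε = c_v Θ` -/
  thermodynamics : ∃ k cv : ℝ, 0 < k ∧ 0 < cv ∧ γ = 1 + k / cv ∧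
    ∃ n ε s Θ : Pt → ℝ, Smooth U n ∧ Smooth U ε ∧ Smooth U s ∧ Smooth U Θ ∧
      ∀ x ∈ U, 0 < n x ∧ 0 < Θ x ∧
        ρ x = n x * (1 + ε x) ∧
        dot u n x + n x * theta g u x = 0 ∧
        (∀ i, Θ x * pd s i x = pd ε i x + p x * pd (fun y => 1 / n y) i x) ∧
        p x = k * n x * Θ x ∧
        ε x = cv * Θ x

/-- `u` is the velocity of a classical ideal gas on `U`: around every point some hydrodynamic
pair completes it. -/
def IsCIGVelocity (U : Set Pt) (g : MetricField) (u : Field1) : Prop :=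
  Locally U fun W => ∃ (γ : ℝ) (ρ p : Pt → ℝ), IsCIGPair W g u γ ρ p

/-- Positive pressure and positive matter density `n = ρ - p / (γ - 1)`. -/
def IsAdmissible (U : Set Pt) (γ : ℝ) (ρ p : Pt → ℝ) : Prop :=
  ∀ x ∈ U, 0 < p x ∧ 0 < ρ x - p x / (γ - 1)

/-! ## Auxiliary functions determined by the velocity -/

/-- `φ = (φ₁, φ₂, φ₃)` are independent `u`-invariant functions on `U`. -/
structure IsInvariants (U : Set Pt) (u : Field1) (φ : Pt → Fin 3 → ℝ) : Prop where
  smooth : ∀ m, Smooth U (fun x => φ x m)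
  invariant : ∀ x ∈ U, ∀ m, dot u (fun y => φ y m) x = 0
  independent : ∀ x ∈ U, LinearIndependent ℝ fun m : Fin 3 => grad (fun y => φ y m) x

/-- `β` is an integrant factor, and `α` a potential, of the acceleration: `dα = β a`. -/
structure IsAccPotential (U : Set Pt) (g : MetricField) (u : Field1)
    (α β : Pt → ℝ) : Prop where
  smooth_alpha : Smooth U α
  smooth_beta : Smooth U β
  ne_zero : ∀ x ∈ U, β x ≠ 0
  potential : ∀ x ∈ U, ∀ i, pd α i x = β x * acc g u x i

/-- `u = -dt`, and `I` is a primitive `∫ θ(t) dt` of the expansion `θ = θ(t)`. -/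
structure IsTimePotential (U : Set Pt) (g : MetricField) (u : Field1)
    (t : Pt → ℝ) (I : ℝ → ℝ) : Prop where
  smooth_t : Smooth U t
  potential : ∀ x ∈ U, ∀ i, lower g u x i = -pd t i x
  smooth_I : ∀ x ∈ U, ContDiffAt ℝ ∞ I (t x)
  primitive : ∀ x ∈ U, deriv I (t x) = theta g u x

/-- `dψ = θ u - f a`. -/
structure IsPsi (W : Set Pt) (g : MetricField) (u : Field1) (f ψ : Pt → ℝ) : Prop where
  smooth : Smooth W ψ
  potential : ∀ x ∈ W, ∀ i, pd ψ i x = theta g u x * lower g u x i - f x * acc g u x i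

/-! ## The relations of the inverse problem -/

section Relations

variable (W : Set Pt) (g : MetricField) (u : Field1) (γ : ℝ) (ρ p : Pt → ℝ)

/-- `H₁`, geodesic case: `p = p₀`, `ρ = R(φᵢ)`. -/
def H1Geodesic (φ : Pt → Fin 3 → ℝ) : Prop :=
  ∃ (p₀ : ℝ) (R : (Fin 3 → ℝ) → ℝ), ∀ x ∈ W,
    ContDiffAt ℝ ∞ R (φ x) ∧ p x = p₀ ∧ ρ x = R (φ x)

/-- `H₁`, non-geodesic case: `p = P(α)`, `ρ = -P(α) - β P'(α)`. -/
def H1NonGeodesic (α β : Pt → ℝ) : Prop :=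
  ∃ P : ℝ → ℝ, ∀ x ∈ W,
    ContDiffAt ℝ ∞ P (α x) ∧ p x = P (α x) ∧ ρ x = -P (α x) - β x * deriv P (α x)

/-- `H₂`: `p = C exp(-γ ∫ θ(t) dt)`, `ρ = p / (γ - 1) + B(φᵢ) p^{1/γ}`. -/
def H2 (t : Pt → ℝ) (I : ℝ → ℝ) (φ : Pt → Fin 3 → ℝ) : Prop :=
  ∃ (C : ℝ) (B : (Fin 3 → ℝ) → ℝ), ∀ x ∈ W,
    ContDiffAt ℝ ∞ B (φ x) ∧
    p x = C * Real.exp (-γ * I (t x)) ∧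
    ρ x = p x / (γ - 1) + B (φ x) * p x ^ (1 / γ)

/-- `H₃`, ..., `H₆` for the function `f`: `p = C exp(γ ψ)`, `ρ = p (γ f - 1)`,
`dψ = θ u - f a`, the adiabatic index being `γ = γ̃[f] + 1`. -/
def H3456 (f : Pt → ℝ) : Prop :=
  ∃ (C : ℝ) (ψ : Pt → ℝ), IsPsi W g u f ψ ∧ ∀ x ∈ W,
    γ = gammaTilde g u f x + 1 ∧
    p x = C * Real.exp (γ * ψ x) ∧
    ρ x = p x * (γ * f x - 1)

/-- `H₅`: the above for a smooth function `f` with values `f₊` or `f₋`. -/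
def H5 : Prop :=
  ∃ f : Pt → ℝ, Smooth W f ∧
    (∀ x ∈ W, 0 ≤ discr g u x ∧ (f x = fPlus g u x ∨ f x = fMinus g u x)) ∧
    H3456 W g u γ ρ p f

/-- `H₇`, `H₈` for the function `f`: `p = C exp(γ ψ)`, `ρ = p (γ f_φ - 1)`,
`f_φ = f + β φ(α)`, `dψ = θ u - f_φ a`, the adiabatic index being `γ = γ̃[f] + 1`. -/
def H78 (α β : Pt → ℝ) (f : Pt → ℝ) : Prop :=
  ∃ (C : ℝ) (φ : ℝ → ℝ) (ψ : Pt → ℝ),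
    IsPsi W g u (fun y => f y + β y * φ (α y)) ψ ∧ ∀ x ∈ W,
      ContDiffAt ℝ ∞ φ (α x) ∧
      γ = gammaTilde g u f x + 1 ∧
      p x = C * Real.exp (γ * ψ x) ∧
      ρ x = p x * (γ * (f x + β x * φ (α x)) - 1)

end Relations

end ClassicalIdealGas

end

open ClassicalIdealGas

/-! The thermodynamic scheme can be eliminated. Since ρ = n + p/(γ-1), matter conservation and
energy conservation together amount to ṗ = -γpθ (`isCIGPair_iff`). Put ψ = (log p)/γ and f =
(ρ+p)/(γp). Dividing the conservation equations by γp gives dψ = θu - fa and ḟ = θ((γ-1)f - 1),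
which is `IsGasPotential`; positivity of the matter density is (γ-1)f > 1. Conversely p = C exp(γψ)
and ρ = p(γf-1) recover an admissible pair (`isCIGPair_of_isGasPotential`). For given u the question
is therefore which f are possible.

The answer lies in the closedness of θu - fa, that is dθ∧u + θdu = df∧a + f da. Its product with u∧a
removes both gradients and gives f(v,u) = -θ(ω,a), hence `eq_f1`. If (v,u) = 0 and v ≠ 0, its
product with a, paired with v, gives `eq_f2`. If v = 0 then da = a∧c, and contraction with u places
dθ in the plane of u and a; reading off its a-component gives ν = (γ-1-μ)f (`IsGasPotential.nu_eq`).
Differentiating this along u and eliminating γ leaves a quadratic equation for f whose coefficients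
depend on u alone (`IsGasPotential.quadratic`). Its roots are f₊ and f₋, and it degenerates to f₃
when μ̇ = 0. In these classes f is determined up to the choice of a root, and the converse is the
general construction above.

If v = 0 and ν = 0 then μ = γ-1 and no condition on f is left from that contraction. Two solutions F
and f have (F-f)a closed, so with dα = βa the quotient (F-f)/β is a function of α. Conversely βφ(α)a
= φ(α)dα is closed, and β̇ = (c,u)β shows that βφ(α) solves the homogeneous evolution equation. One
particular solution is thus enough (`IsBaseSolution.isCIGPair_iff`). It comes from dθ = -θ̇u - 2θa:
with vorticity, repeated closedness makes dθ̇ proportional to dθ, and θu - f₄a = -(θ/θ̇)dθ is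
closed; without vorticity f₅ is the constant 1/(γ-1).

For θ = 0 the equations become dp = -(ρ+p)a and ρ̇ = 0. For θ ≠ 0 and a = 0, closedness forces du =
0 and θ = θ(t), and both log p + γ∫θdt and n p^{-1/γ} are preserved in the required sense.

The auxiliary functions come from classical theorems. Smooth dependence of ordinary differential
equations on data (`exists_smooth_exponential`) is obtained from the inverse function theorem on a
space of curves; it gives invariants of u (`exists_isInvariants`) and Frobenius integrating factors
(`exists_integrating_factor`). The Poincaré lemma (`exists_potential`) and functional dependence
(`exists_eq_comp_of_fderiv_eq_zero`) do the rest. Hodge duals enter only through `ip_hodge3`, which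
turns each of them into an identity between alternating forms. -/

namespace ClassicalIdealGas

open Set Metric Topology

/-! ## Inverse functions on open sets -/

section InverseFunction

variable {E F : Type*} [NormedAddCommGroup E] [NormedSpace ℝ E] [CompleteSpace E]
  [NormedAddCommGroup F] [NormedSpace ℝ F]

/-- The inverse function theorem for smooth maps, with an inverse smooth on an open set. -/
theorem exists_smooth_openPartialHomeomorph {f : E → F} {U : Set E} (hU : IsOpen U)
    (hf : ContDiffOn ℝ ∞ f U) {a : E} (ha : a ∈ U) (f' : E ≃L[ℝ] F)
    (hf' : HasFDerivAt f (f' : E →L[ℝ] F) a) :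
    ∃ e : OpenPartialHomeomorph E F, a ∈ e.source ∧ e.source ⊆ U ∧ (∀ x, e x = f x) ∧
      ContDiffOn ℝ ∞ e.symm e.target := by
  have hfa : ContDiffAt ℝ ∞ f a := hf.contDiffAt (hU.mem_nhds ha)
  let e₀ := hfa.toOpenPartialHomeomorph f hf' (by simp)
  -- Keeping only points where the derivative is invertible makes the inverse smooth on its whole
  -- domain, not merely near the image of `a`.
  let S : Set E := U ∩ fderiv ℝ f ⁻¹' range ((↑) : (E ≃L[ℝ] F) → E →L[ℝ] F)
  have hS : IsOpen S :=
    (hf.continuousOn_fderiv_of_isOpen hU (by simp)).isOpen_inter_preimage hU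
      ContinuousLinearEquiv.isOpen
  refine ⟨e₀.restrOpen S hS, ?_, ?_, fun x => rfl, ?_⟩
  · exact ⟨hfa.mem_toOpenPartialHomeomorph_source hf' (by simp), ha, f', hf'.fderiv.symm⟩
  · exact fun x hx => hx.2.1
  · intro y hy
    have hx := (e₀.restrOpen S hS).map_target hy
    obtain ⟨-, hxU, L, hL⟩ := hx
    have hcd := hf.contDiffAt (hU.mem_nhds hxU)
    refine ((e₀.restrOpen S hS).contDiffAt_symm (f₀' := L) hy ?_ hcd).contDiffWithinAt
    rw [hL]
    exact (hcd.differentiableAt (by simp)).hasFDerivAt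

end InverseFunction

/-! ## Composition operators on spaces of continuous curves -/

section Postcomp

variable {K : Type*} [TopologicalSpace K] [CompactSpace K]

/-- Pointwise evaluation of a continuous family of linear maps on a continuous map. -/
noncomputable def pointwiseEval (K : Type*) [TopologicalSpace K] [CompactSpace K]
    (E F : Type*) [NormedAddCommGroup E] [NormedSpace ℝ E]
    [NormedAddCommGroup F] [NormedSpace ℝ F] :
    C(K, E →L[ℝ] F) →L[ℝ] C(K, E) →L[ℝ] C(K, F) :=
  LinearMap.mkContinuous₂
    (LinearMap.mk₂ ℝ (fun (A : C(K, E →L[ℝ] F)) (γ : C(K, E)) =>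
        (⟨fun t => A t (γ t), A.continuous.clm_apply γ.continuous⟩ : C(K, F)))
      (fun A B γ => by ext; simp) (fun c A γ => by ext; simp)
      (fun A γ δ => by ext; simp) (fun c A γ => by ext; simp)) 1
    (fun A γ => by
      rw [one_mul, ContinuousMap.norm_le _ (by positivity)]
      intro t
      exact (A t).le_opNorm_of_le (γ.norm_coe_le_norm t) |>.trans
        (by gcongr; exact A.norm_coe_le_norm t))

@[simp]
theorem pointwiseEval_apply {E F : Type*} [NormedAddCommGroup E] [NormedSpace ℝ E]
    [NormedAddCommGroup F] [NormedSpace ℝ F] (A : C(K, E →L[ℝ] F)) (γ : C(K, E)) (t : K) :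
    pointwiseEval K E F A γ t = A t (γ t) := rfl

/-- The operator `γ ↦ V ∘ γ`. -/
def postcomp {E F : Type*} [TopologicalSpace E] [TopologicalSpace F] (V : C(E, F)) :
    C(K, E) → C(K, F) := fun γ => V.comp γ

/-- Postcomposition with V' is continuous for the uniform norm, so V' varies by at most ε along
every segment from γ t to γ' t once γ' is close to γ. The mean value inequality then bounds the
remainder uniformly in t. -/
theorem hasFDerivAt_postcomp {E F : Type*} [NormedAddCommGroup E] [NormedSpace ℝ E]
    [NormedAddCommGroup F] [NormedSpace ℝ F] (V : C(E, F)) (V' : C(E, E →L[ℝ] F))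
    (hV : ∀ x, HasFDerivAt V (V' x) x) (γ : C(K, E)) :
    HasFDerivAt (postcomp V : C(K, E) → C(K, F)) (pointwiseEval K E F (V'.comp γ)) γ := by
  rw [hasFDerivAt_iff_isLittleO, Asymptotics.isLittleO_iff]
  intro ε hε
  have hc := (ContinuousMap.continuous_postcomp (X := K) V').continuousAt (x := γ)
  have hN : Metric.ball (V'.comp γ) ε ∈ 𝓝 (V'.comp γ) :=
    Metric.ball_mem_nhds (V'.comp γ) hε
  obtain ⟨δ, hδ, hball⟩ := Metric.mem_nhds_iff.1 (hc hN)
  filter_upwards [Metric.ball_mem_nhds γ hδ] with γ' hγ'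
  rw [ContinuousMap.norm_le _ (by positivity)]
  intro t
  have hseg : ∀ y ∈ segment ℝ (γ t) (γ' t), ‖V' y - V' (γ t)‖ ≤ ε := by
    intro y hy
    rw [segment_eq_image'] at hy
    obtain ⟨s, hs, rfl⟩ := hy
    have hmem : γ + s • (γ' - γ) ∈ Metric.ball γ δ := by
      rw [Metric.mem_ball, dist_eq_norm] at hγ' ⊢
      rw [add_sub_cancel_left, norm_smul, Real.norm_of_nonneg hs.1]
      exact (mul_le_of_le_one_left (norm_nonneg _) hs.2).trans_lt hγ'
    have h1 := hball hmem
    rw [mem_preimage, Metric.mem_ball] at h1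
    have h2 := (ContinuousMap.dist_apply_le_dist (f := V'.comp (γ + s • (γ' - γ)))
      (g := V'.comp γ) t).trans h1.le
    rwa [dist_eq_norm] at h2
  have := (convex_segment (γ t) (γ' t)).norm_image_sub_le_of_norm_hasFDerivWithin_le'
    (fun y _ => (hV y).hasFDerivWithinAt) hseg (left_mem_segment ℝ _ _) (right_mem_segment ℝ _ _)
  refine this.trans ?_
  gcongr
  exact (γ' - γ).norm_coe_le_norm t

/-- The derivative of postcomposition with V is built linearly from postcomposition with V', which
has one degree of smoothness less. The target space changes to E →L F at each stage, hence the
quantification over F inside the induction. -/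
theorem contDiff_postcomp_nat {E : Type} [NormedAddCommGroup E] [NormedSpace ℝ E] (n : ℕ) :
    ∀ (F : Type) [NormedAddCommGroup F] [NormedSpace ℝ F] (V : C(E, F)), ContDiff ℝ n V →
      ContDiff ℝ n (postcomp V : C(K, E) → C(K, F)) := by
  induction n with
  | zero =>
    intro F _ _ V _
    exact contDiff_zero.2 (ContinuousMap.continuous_postcomp V)
  | succ n ih =>
    intro F _ _ V hV
    push_cast at hV ⊢
    obtain ⟨V', hV', hd⟩ := contDiff_succ_iff_hasFDerivAt.1 hV
    let W : C(E, E →L[ℝ] F) := ⟨V', hV'.continuous⟩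
    exact contDiff_succ_iff_hasFDerivAt.2 ⟨pointwiseEval K E F ∘ postcomp W,
      (pointwiseEval K E F).contDiff.comp (ih _ W hV'), hasFDerivAt_postcomp V W hd⟩

theorem contDiff_postcomp {E F : Type} [NormedAddCommGroup E] [NormedSpace ℝ E]
    [NormedAddCommGroup F] [NormedSpace ℝ F] (V : C(E, F)) (hV : ContDiff ℝ ∞ V) :
    ContDiff ℝ ∞ (postcomp V : C(K, E) → C(K, F)) :=
  contDiff_infty.2 fun n => contDiff_postcomp_nat n F V (contDiff_infty.1 hV n)

/-- Constant maps, as a continuous linear map. -/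
noncomputable def constCurve (K : Type*) [TopologicalSpace K] [CompactSpace K]
    (E : Type*) [NormedAddCommGroup E] [NormedSpace ℝ E] : E →L[ℝ] C(K, E) :=
  LinearMap.mkContinuous ⟨⟨ContinuousMap.const K, fun _ _ => rfl⟩, fun _ _ => rfl⟩ 1
    (fun x => by
      rw [one_mul, ContinuousMap.norm_le _ (by positivity)]
      exact fun _ => le_rfl)

@[simp]
theorem constCurve_apply {E : Type*} [NormedAddCommGroup E] [NormedSpace ℝ E] (x : E) (t : K) :
    constCurve K E x t = x := rfl

end Postcomp

/-! ## Integration of curves on `[-1, 1]` -/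

section Primitive

/-- The parameter interval of curves. -/
abbrev TimeInterval := Icc (-1 : ℝ) 1

/-- Retraction of the line onto the parameter interval. -/
noncomputable def clampTime : ℝ → TimeInterval := projIcc (-1) 1 (by norm_num)

theorem continuous_clampTime : Continuous clampTime := continuous_projIcc

theorem continuous_comp_clampTime {E : Type*} [TopologicalSpace E] (γ : C(TimeInterval, E)) :
    Continuous fun τ => γ (clampTime τ) := γ.continuous.comp continuous_clampTime

/-- The primitive, vanishing at `0`, of a curve. -/
noncomputable def primitiveCurve (E : Type*) [NormedAddCommGroup E] [NormedSpace ℝ E]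
    [CompleteSpace E] : C(TimeInterval, E) →L[ℝ] C(TimeInterval, E) :=
  LinearMap.mkContinuous
    ⟨⟨fun γ => ⟨fun s => ∫ τ in (0 : ℝ)..s, γ (clampTime τ),
        (intervalIntegral.continuous_primitive
          (fun a b => (continuous_comp_clampTime γ).intervalIntegrable a b) 0).comp
          continuous_subtype_val⟩,
      fun γ δ => by
        ext s
        exact intervalIntegral.integral_add ((continuous_comp_clampTime γ).intervalIntegrable _ _)
          ((continuous_comp_clampTime δ).intervalIntegrable _ _)⟩,
      fun c γ => by
        ext s
        exact intervalIntegral.integral_smul c _⟩ 1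
    (fun γ => by
      rw [one_mul, ContinuousMap.norm_le _ (by positivity)]
      intro s
      have h := intervalIntegral.norm_integral_le_of_norm_le_const (a := (0 : ℝ)) (b := s)
        (f := fun τ => γ (clampTime τ)) (C := ‖γ‖) (fun τ _ => γ.norm_coe_le_norm _)
      refine h.trans (mul_le_of_le_one_right (norm_nonneg _) ?_)
      rw [sub_zero]
      exact abs_le.2 s.2)

theorem primitiveCurve_apply {E : Type*} [NormedAddCommGroup E] [NormedSpace ℝ E]
    [CompleteSpace E] (γ : C(TimeInterval, E)) (s : TimeInterval) :
    primitiveCurve E γ s = ∫ τ in (0 : ℝ)..s, γ (clampTime τ) := rfl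

end Primitive

/-! ## Smooth exponential maps of families of vector fields -/

section Exponential

variable {F Q : Type} [NormedAddCommGroup F] [NormedSpace ℝ F] [CompleteSpace F]
  [NormedAddCommGroup Q] [NormedSpace ℝ Q]

/-- The integral operator whose zeros are the integral curves of `x ↦ B x q` issuing from `z`. -/
noncomputable def curveOperator (B : C(F, Q →L[ℝ] F)) (w : (F × Q) × C(TimeInterval, F)) :
    (F × Q) × C(TimeInterval, F) :=
  (w.1, w.2 - constCurve TimeInterval F w.1.1 -
    primitiveCurve F (pointwiseEval TimeInterval Q F (postcomp B w.2)
      (constCurve TimeInterval Q w.1.2)))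

theorem contDiff_curveOperator (B : C(F, Q →L[ℝ] F)) (hB : ContDiff ℝ ∞ B) :
    ContDiff ℝ ∞ (curveOperator B) := by
  have h1 : ContDiff ℝ ∞ fun w : (F × Q) × C(TimeInterval, F) =>
      pointwiseEval TimeInterval Q F (postcomp B w.2) :=
    ContDiff.comp (g := pointwiseEval TimeInterval Q F) (ContinuousLinearMap.contDiff _)
      ((contDiff_postcomp B hB).comp contDiff_snd)
  have h2 : ContDiff ℝ ∞ fun w : (F × Q) × C(TimeInterval, F) =>
      constCurve TimeInterval Q w.1.2 :=
    (constCurve TimeInterval Q).contDiff.comp (contDiff_snd.comp contDiff_fst)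
  have h3 : ContDiff ℝ ∞ fun w : (F × Q) × C(TimeInterval, F) =>
      constCurve TimeInterval F w.1.1 :=
    (constCurve TimeInterval F).contDiff.comp (contDiff_fst.comp contDiff_fst)
  exact contDiff_fst.prodMk ((contDiff_snd.sub h3).sub
    ((primitiveCurve F).contDiff.comp (h1.clm_apply h2)))

/-- The shear `(p, k) ↦ (p, k - L p)`. -/
def shearEquiv {P C : Type*} [NormedAddCommGroup P] [NormedSpace ℝ P] [NormedAddCommGroup C]
    [NormedSpace ℝ C] (L : P →L[ℝ] C) : (P × C) ≃L[ℝ] (P × C) :=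
  ContinuousLinearEquiv.equivOfInverse
    ((ContinuousLinearMap.fst ℝ P C).prod
      (ContinuousLinearMap.snd ℝ P C - L.comp (ContinuousLinearMap.fst ℝ P C)))
    ((ContinuousLinearMap.fst ℝ P C).prod
      (ContinuousLinearMap.snd ℝ P C + L.comp (ContinuousLinearMap.fst ℝ P C)))
    (fun x => by simp) (fun x => by simp)

/-- The integral term is linear in q, so at q = 0 its derivative in the direction of the curve
vanishes. What remains is a shear, invertible without any smallness assumption on the vector field.
-/
theorem exists_hasFDerivAt_curveOperator (B : C(F, Q →L[ℝ] F)) (hB : ContDiff ℝ ∞ B) (z₀ : F) :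
    ∃ e : ((F × Q) × C(TimeInterval, F)) ≃L[ℝ] ((F × Q) × C(TimeInterval, F)),
      HasFDerivAt (curveOperator B) (e : _ →L[ℝ] _)
        ((z₀, 0), constCurve TimeInterval F z₀) := by
  set w₀ : (F × Q) × C(TimeInterval, F) := ((z₀, 0), constCurve TimeInterval F z₀)
  let L : (F × Q) →L[ℝ] C(TimeInterval, F) :=
    (constCurve TimeInterval F).comp (ContinuousLinearMap.fst ℝ F Q) +
    (primitiveCurve F).comp ((pointwiseEval TimeInterval Q F (postcomp B w₀.2)).comp
      ((constCurve TimeInterval Q).comp (ContinuousLinearMap.snd ℝ F Q)))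
  refine ⟨shearEquiv L, ?_⟩
  have h1 : ContDiff ℝ ∞ fun w : (F × Q) × C(TimeInterval, F) =>
      pointwiseEval TimeInterval Q F (postcomp B w.2) :=
    ContDiff.comp (g := pointwiseEval TimeInterval Q F) (ContinuousLinearMap.contDiff _)
      ((contDiff_postcomp B hB).comp contDiff_snd)
  have h1' := (h1.differentiable (by simp) w₀).hasFDerivAt
  have h2 : HasFDerivAt (fun w : (F × Q) × C(TimeInterval, F) =>
      constCurve TimeInterval Q w.1.2) ((constCurve TimeInterval Q).comp
        ((ContinuousLinearMap.snd ℝ F Q).comp (ContinuousLinearMap.fst ℝ _ _))) w₀ :=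
    ((constCurve TimeInterval Q).comp ((ContinuousLinearMap.snd ℝ F Q).comp
      (ContinuousLinearMap.fst ℝ (F × Q) C(TimeInterval, F)))).hasFDerivAt (x := w₀)
  have h3 : HasFDerivAt (fun w : (F × Q) × C(TimeInterval, F) =>
      constCurve TimeInterval F w.1.1) ((constCurve TimeInterval F).comp
        ((ContinuousLinearMap.fst ℝ F Q).comp (ContinuousLinearMap.fst ℝ _ _))) w₀ :=
    ((constCurve TimeInterval F).comp ((ContinuousLinearMap.fst ℝ F Q).comp
      (ContinuousLinearMap.fst ℝ (F × Q) C(TimeInterval, F)))).hasFDerivAt (x := w₀)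
  have h4 := (primitiveCurve F).hasFDerivAt.comp w₀ (h1'.clm_apply h2)
  refine (hasFDerivAt_fst.prodMk ((hasFDerivAt_snd.sub h3).sub h4)).congr_fderiv ?_
  ext x <;> simp [shearEquiv, L, w₀, sub_sub]

/-- This is the substitution τ ↦ tτ in the integral. It shows that slowing an integral curve down by
t gives an integral curve for the parameter tq. -/
theorem primitiveCurve_rescale (γ : C(TimeInterval, F)) (t : TimeInterval)
    (s : TimeInterval) (δ : C(TimeInterval, F))
    (hδ : ∀ s : TimeInterval, δ s = (t : ℝ) • γ (clampTime (t * s))) :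
    primitiveCurve F δ s = primitiveCurve F γ (clampTime (t * s)) := by
  have hts : ∀ s : TimeInterval, ((clampTime (t * s) : TimeInterval) : ℝ) = t * s := by
    intro s
    have : (t * s : ℝ) ∈ Icc (-1 : ℝ) 1 := by
      refine abs_le.1 ?_
      rw [abs_mul]
      exact mul_le_one₀ (abs_le.2 t.2) (abs_nonneg _) (abs_le.2 s.2)
    rw [clampTime, projIcc_of_mem _ this]
  rw [primitiveCurve_apply, primitiveCurve_apply, hts]
  have h := intervalIntegral.smul_integral_comp_mul_left (a := 0) (b := (s : ℝ))
    (fun τ => γ (clampTime τ)) (t : ℝ)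
  rw [mul_zero] at h
  rw [← h, ← intervalIntegral.integral_smul]
  refine intervalIntegral.integral_congr fun τ hτ => ?_
  have hτ' : τ ∈ Icc (-1 : ℝ) 1 := by
    have hs := s.2
    rcases le_total 0 (s : ℝ) with h0 | h0
    · rw [uIcc_of_le h0] at hτ
      exact ⟨by linarith [hτ.1], hτ.2.trans hs.2⟩
    · rw [uIcc_of_ge h0] at hτ
      exact ⟨hs.1.trans hτ.1, by linarith [hτ.2]⟩
  have hc : ((clampTime τ : TimeInterval) : ℝ) = τ := by
    rw [clampTime, projIcc_of_mem _ hτ']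
  simp only [hδ, hc]

/-- **Smooth dependence for ordinary differential equations.** If `B x` is linear in the
parameter `q`, the time-one map `Ψ (z, q)` of the vector field `x ↦ B x q` is
defined and smooth for small `q`, and `t ↦ Ψ (z, t q)` is the integral curve issuing from `z`. -/
theorem exists_smooth_exponential [CompleteSpace Q] (B : F → Q →L[ℝ] F) (hB : ContDiff ℝ ∞ B)
    (z₀ : F) :
    ∃ (r : ℝ) (Ψ : F × Q → F), 0 < r ∧ ContDiffOn ℝ ∞ Ψ (ball (z₀, 0) r) ∧
      ∀ z q, (z, q) ∈ ball ((z₀, 0) : F × Q) r → Ψ (z, 0) = z ∧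
        ∀ t ∈ Ioo (-1 : ℝ) 1, HasDerivAt (fun s : ℝ => Ψ (z, s • q)) (B (Ψ (z, t • q)) q) t := by
  let B' : C(F, Q →L[ℝ] F) := ⟨B, hB.continuous⟩
  set w₀ : (F × Q) × C(TimeInterval, F) := ((z₀, 0), constCurve TimeInterval F z₀) with hw₀
  obtain ⟨f', hf'⟩ := exists_hasFDerivAt_curveOperator B' hB z₀
  obtain ⟨e, he₀, -, hcoe, hsm⟩ := exists_smooth_openPartialHomeomorph isOpen_univ
    (contDiff_curveOperator B' hB).contDiffOn (mem_univ w₀) f' hf'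
  have hew₀ : e w₀ = ((z₀, 0), 0) := by
    rw [hcoe]
    simp [curveOperator, hw₀]
  -- The operator is injective on this ball, which will serve as uniqueness for the differential
  -- equation.
  obtain ⟨R, hR, hRs⟩ := Metric.isOpen_iff.1 e.open_source w₀ he₀
  have hemb : Continuous fun p : F × Q => (p, (0 : C(TimeInterval, F))) := by fun_prop
  let O : Set (F × Q) := (fun p => (p, 0)) ⁻¹' (e.target ∩ e.symm ⁻¹' ball w₀ R)
  have hO : IsOpen O := (e.symm.isOpen_inter_preimage isOpen_ball).preimage hemb
  have hO₀ : (z₀, (0 : Q)) ∈ O := by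
    change ((z₀, (0 : Q)), (0 : C(TimeInterval, F))) ∈ e.target ∩ e.symm ⁻¹' ball w₀ R
    rw [← hew₀]
    refine ⟨e.map_source he₀, ?_⟩
    rw [mem_preimage, e.left_inv he₀]
    exact mem_ball_self hR
  obtain ⟨r₀, hr₀, hr₀O⟩ := Metric.isOpen_iff.1 hO _ hO₀
  let r := min r₀ R
  have hrO : ball (z₀, (0 : Q)) r ⊆ O := (ball_subset_ball (min_le_left _ _)).trans hr₀O
  let Γ : F × Q → C(TimeInterval, F) := fun p => (e.symm (p, 0)).2
  have one_mem : (1 : ℝ) ∈ Icc (-1 : ℝ) 1 := by norm_num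
  let one : TimeInterval := ⟨1, one_mem⟩
  have hΓ : ContDiffOn ℝ ∞ Γ (ball (z₀, 0) r) := by
    refine contDiff_snd.comp_contDiffOn (hsm.comp (t := e.target) ?_ fun p hp => (hrO hp).1)
    exact (contDiff_id.prodMk contDiff_const).contDiffOn
  have hEq : ∀ p ∈ ball (z₀, (0 : Q)) r, e.symm (p, 0) = (p, Γ p) ∧
      Γ p = constCurve TimeInterval F p.1 + primitiveCurve F
        (pointwiseEval TimeInterval Q F (postcomp B' (Γ p)) (constCurve TimeInterval Q p.2)) := by
    intro p hp
    have h1 := e.right_inv (hrO hp).1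
    rw [hcoe] at h1
    have h2 : (e.symm (p, 0)).1 = p := congrArg Prod.fst h1
    have h3 : e.symm (p, 0) = (p, Γ p) := Prod.ext h2 rfl
    rw [h3] at h1
    have h4 := congrArg Prod.snd h1
    refine ⟨h3, ?_⟩
    simp only [curveOperator] at h4
    rw [sub_sub, sub_eq_zero] at h4
    exact h4
  -- The rescaled curve takes only values of Γ(z, q), so it stays in the ball of radius R, and the
  -- operator sends it to the same point as Γ(z, tq). Injectivity identifies the two.
  have hscale : ∀ z q, (z, q) ∈ ball (z₀, (0 : Q)) r → ∀ t : TimeInterval, ∀ s : TimeInterval,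
      Γ (z, (t : ℝ) • q) s = Γ (z, q) (clampTime (t * s)) := by
    intro z q hzq t s
    have ht : |(t : ℝ)| ≤ 1 := abs_le.2 t.2
    have hq : ‖q‖ < r := by
      have := (mem_ball.1 hzq)
      rw [Prod.dist_eq, max_lt_iff] at this
      simpa using this.2
    have hz : dist z z₀ < r := by
      have := (mem_ball.1 hzq)
      rw [Prod.dist_eq, max_lt_iff] at this
      exact this.1
    have htq : ‖(t : ℝ) • q‖ < r := by
      rw [norm_smul]
      exact (mul_le_of_le_one_left (norm_nonneg _) ht).trans_lt hq
    have hmem : (z, (t : ℝ) • q) ∈ ball (z₀, (0 : Q)) r := by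
      rw [mem_ball, Prod.dist_eq, max_lt_iff]
      exact ⟨hz, by simpa using htq⟩
    let δ : C(TimeInterval, F) := ⟨fun s => Γ (z, q) (clampTime (t * s)),
      (Γ (z, q)).continuous.comp (continuous_clampTime.comp (by fun_prop))⟩
    have hball : e.symm ((z, q), 0) ∈ ball w₀ R := (hrO hzq).2
    rw [(hEq _ hzq).1, mem_ball, Prod.dist_eq, max_lt_iff] at hball
    have hδmem : ((z, (t : ℝ) • q), δ) ∈ ball w₀ R := by
      rw [mem_ball, Prod.dist_eq, max_lt_iff]
      refine ⟨(mem_ball.1 hmem).trans_le (min_le_right _ _), lt_of_le_of_lt ?_ hball.2⟩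
      rw [ContinuousMap.dist_le dist_nonneg]
      intro s
      exact ContinuousMap.dist_apply_le_dist (f := Γ (z, q))
        (g := constCurve TimeInterval F z₀) (clampTime (t * s))
    have himg : e ((z, (t : ℝ) • q), δ) = ((z, (t : ℝ) • q), 0) := by
      rw [hcoe]
      refine Prod.ext rfl ?_
      simp only [curveOperator]
      rw [sub_sub, sub_eq_zero]
      ext s
      change Γ (z, q) (clampTime (t * s)) = _
      conv_lhs => rw [(hEq _ hzq).2]
      rw [ContinuousMap.add_apply, ContinuousMap.add_apply]
      refine congrArg₂ _ rfl ?_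
      symm
      apply primitiveCurve_rescale
      intro s
      simp [postcomp, δ]
    have hinj : ((z, (t : ℝ) • q), δ) = e.symm ((z, (t : ℝ) • q), 0) := by
      rw [← himg, e.left_inv (hRs hδmem)]
    have : δ = Γ (z, (t : ℝ) • q) := congrArg Prod.snd hinj
    rw [← this]
    rfl
  have hone : ∀ z q, (z, q) ∈ ball (z₀, (0 : Q)) r → ∀ t (ht : t ∈ Icc (-1 : ℝ) 1),
      Γ (z, t • q) one = Γ (z, q) ⟨t, ht⟩ := by
    intro z q hzq t ht
    have := hscale z q hzq ⟨t, ht⟩ one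
    rw [this]
    congr 1
    simp only [one, mul_one]
    rw [clampTime, projIcc_of_mem _ ht]
  refine ⟨r, fun p => Γ p one, lt_min hr₀ hR, ?_, ?_⟩
  · exact (ContinuousMap.evalCLM ℝ one).contDiff.comp_contDiffOn hΓ
  · intro z q hzq
    have hval : ∀ t (ht : t ∈ Icc (-1 : ℝ) 1), Γ (z, t • q) one = z +
        ∫ τ in (0 : ℝ)..t, B (Γ (z, q) (clampTime τ)) q := by
      intro t ht
      rw [hone z q hzq t ht]
      conv_lhs => rw [(hEq _ hzq).2]
      rfl
    refine ⟨?_, ?_⟩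
    · have := hval 0 (by norm_num)
      simpa using this
    · intro t ht
      have hcont : Continuous fun τ => B (Γ (z, q) (clampTime τ)) q :=
        ((hB.continuous.comp (continuous_comp_clampTime (Γ (z, q)))).clm_apply continuous_const)
      have hd := (hcont.integral_hasStrictDerivAt 0 t).hasDerivAt.const_add z
      have ht' : t ∈ Icc (-1 : ℝ) 1 := Ioo_subset_Icc_self ht
      have hB' : B (Γ (z, q) (clampTime t)) q = B (Γ (z, t • q) one) q := by
        rw [hone z q hzq t ht', clampTime, projIcc_of_mem _ ht']
      rw [hB'] at hd
      refine hd.congr_of_eventuallyEq ?_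
      filter_upwards [Ioo_mem_nhds ht.1 ht.2] with s hs
      exact hval s (Ioo_subset_Icc_self hs)

end Exponential

/-! ### Localization of the exponential and its first-order behaviour -/

section LocalExponential

/-- A map smooth near a point agrees near this point with a globally smooth map. -/
theorem exists_contDiff_eqOn_ball {E G : Type*} [NormedAddCommGroup E] [NormedSpace ℝ E]
    [FiniteDimensional ℝ E] [NormedAddCommGroup G] [NormedSpace ℝ G] {B : E → G} {U : Set E}
    (hU : IsOpen U) (hB : ContDiffOn ℝ ∞ B U) {x₀ : E} (hx₀ : x₀ ∈ U) :
    ∃ (B' : E → G) (ρ : ℝ), 0 < ρ ∧ ContDiff ℝ ∞ B' ∧ ball x₀ ρ ⊆ U ∧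
      ∀ x ∈ ball x₀ ρ, B' x = B x := by
  obtain ⟨R, hR, hRU⟩ := Metric.isOpen_iff.1 hU x₀ hx₀
  let χ : ContDiffBump x₀ := ⟨R / 4, R / 2, by positivity, by linarith⟩
  refine ⟨fun x => χ x • B x, R / 4, by positivity, ?_, ?_, ?_⟩
  · rw [contDiff_iff_contDiffAt]
    intro x
    by_cases hx : x ∈ U
    · exact χ.contDiff.contDiffAt.smul (hB.contDiffAt (hU.mem_nhds hx))
    · have hx' : x ∉ tsupport χ := fun h => by
        rw [χ.tsupport_eq] at h
        refine hx (hRU (closedBall_subset_ball ?_ h))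
        change R / 2 < R
        linarith
      have h0 : (fun x => χ x • B x) =ᶠ[𝓝 x] fun _ => 0 := by
        filter_upwards [notMem_tsupport_iff_eventuallyEq.1 hx'] with y hy
        rw [hy, Pi.zero_apply, zero_smul]
      exact contDiffAt_const.congr_of_eventuallyEq h0
  · exact (ball_subset_ball (by linarith)).trans hRU
  · intro x hx
    have : χ x = 1 := χ.one_of_mem_closedBall (ball_subset_closedBall hx)
    simp only [this, one_smul]

variable {F Q : Type} [NormedAddCommGroup F] [NormedSpace ℝ F] [FiniteDimensional ℝ F]
  [NormedAddCommGroup Q] [NormedSpace ℝ Q] [FiniteDimensional ℝ Q]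

/-- Local form of the smooth exponential of the family of vector fields `x ↦ B x q`. -/
theorem exists_smooth_exponential_of_contDiffOn {B : F → Q →L[ℝ] F} {U : Set F} (hU : IsOpen U)
    (hB : ContDiffOn ℝ ∞ B U) {z₀ : F} (hz₀ : z₀ ∈ U) :
    ∃ (r : ℝ) (Ψ : F × Q → F), 0 < r ∧ ContDiffOn ℝ ∞ Ψ (ball (z₀, 0) r) ∧
      MapsTo Ψ (ball (z₀, 0) r) U ∧
      ∀ z q, (z, q) ∈ ball ((z₀, 0) : F × Q) r →
        fderiv ℝ Ψ (z, q) (0, q) = B (Ψ (z, q)) q ∧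
        Ψ (z, 0) = z ∧ ∀ h k, fderiv ℝ Ψ (z, 0) (h, k) = h + B z k := by
  have : CompleteSpace F := FiniteDimensional.complete ℝ F
  have : CompleteSpace Q := FiniteDimensional.complete ℝ Q
  obtain ⟨B', ρ, hρ, hB', hρU, hBB'⟩ := exists_contDiff_eqOn_ball hU hB hz₀
  obtain ⟨r₁, Ψ, hr₁, hΨ, hprop⟩ := exists_smooth_exponential B' hB' z₀
  have hc : ContinuousAt Ψ (z₀, 0) :=
    (hΨ.contDiffAt (ball_mem_nhds _ hr₁)).continuousAt
  have hΨ₀ : Ψ (z₀, 0) = z₀ := (hprop z₀ 0 (mem_ball_self hr₁)).1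
  have hpre : Ψ ⁻¹' ball z₀ ρ ∈ 𝓝 ((z₀, 0) : F × Q) :=
    hc (by rw [hΨ₀]; exact ball_mem_nhds _ hρ)
  obtain ⟨r₂, hr₂, hr₂Ψ⟩ := Metric.mem_nhds_iff.1 hpre
  -- Derivatives along the curve are known only for times inside (-1, 1). Halving the radius leaves
  -- room for the parameter 2q, whose curve at time 1/2 passes through Ψ(z, q).
  let r := min (r₁ / 2) r₂
  have hr : 0 < r := lt_min (by positivity) hr₂
  have hsub₁ : ball ((z₀, 0) : F × Q) r ⊆ ball (z₀, 0) r₁ :=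
    ball_subset_ball ((min_le_left _ _).trans (by linarith))
  have hmaps : ∀ p ∈ ball ((z₀, 0) : F × Q) r, Ψ p ∈ ball z₀ ρ :=
    fun p hp => hr₂Ψ (ball_subset_ball (min_le_right _ _) hp)
  have hdiff : ∀ p ∈ ball ((z₀, 0) : F × Q) r₁, HasFDerivAt Ψ (fderiv ℝ Ψ p) p := fun p hp =>
    ((hΨ.contDiffAt (isOpen_ball.mem_nhds hp)).differentiableAt (by simp)).hasFDerivAt
  have hcurve : ∀ z q, ∀ t : ℝ, (z, t • q) ∈ ball ((z₀, 0) : F × Q) r₁ →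
      HasDerivAt (fun s : ℝ => Ψ (z, s • q)) (fderiv ℝ Ψ (z, t • q) (0, q)) t := by
    intro z q t hmem
    have h1 : HasDerivAt (fun s : ℝ => (z, s • q)) ((0 : F), q) t := by
      refine (hasDerivAt_const t z).prodMk ?_
      simpa using (hasDerivAt_id t).smul_const q
    exact (hdiff _ hmem).comp_hasDerivAt t h1
  refine ⟨r, Ψ, hr, hΨ.mono hsub₁, fun p hp => hρU (hmaps p hp), ?_⟩
  intro z q hzq
  have hzq' := mem_ball.1 hzq
  rw [Prod.dist_eq, max_lt_iff, dist_zero_right] at hzq'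
  have hΨz : Ψ (z, 0) = z := (hprop z q (hsub₁ hzq)).1
  have hz0 : (z, (0 : Q)) ∈ ball ((z₀, 0) : F × Q) r := by
    rw [mem_ball, Prod.dist_eq, max_lt_iff]
    exact ⟨hzq'.1, by simpa using hr⟩
  refine ⟨?_, hΨz, ?_⟩
  · have h2q : (z, (2 : ℝ) • q) ∈ ball ((z₀, 0) : F × Q) r₁ := by
      rw [mem_ball, Prod.dist_eq, max_lt_iff, dist_zero_right, norm_smul]
      have h3 : r ≤ r₁ / 2 := min_le_left _ _
      refine ⟨by linarith [hzq'.1], ?_⟩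
      rw [Real.norm_of_nonneg (by norm_num)]
      linarith [hzq'.2]
    have hhalf : ((1 : ℝ) / 2) • (2 : ℝ) • q = q := by
      rw [smul_smul]
      norm_num
    have h1 := (hprop z _ h2q).2 (1 / 2) (by norm_num)
    have h2 := hcurve z ((2 : ℝ) • q) (1 / 2) (by rw [hhalf]; exact hsub₁ hzq)
    have h3 := h2.unique h1
    rw [hhalf, hBB' _ (hmaps _ hzq)] at h3
    have h4 : ((0 : F), (2 : ℝ) • q) = (2 : ℝ) • ((0 : F), q) := by simp
    rw [h4, map_smul, map_smul] at h3
    exact smul_right_injective F (two_ne_zero (α := ℝ)) h3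
  · intro h k
    have hfst : fderiv ℝ Ψ (z, 0) (h, 0) = h := by
      have h1 : HasFDerivAt (fun y : F => Ψ (y, (0 : Q)))
          ((fderiv ℝ Ψ (z, 0)).comp (ContinuousLinearMap.inl ℝ F Q)) z :=
        (hdiff _ (hsub₁ hz0)).comp z (hasFDerivAt_prodMk_left z (0 : Q))
      have h2 : (fun y : F => Ψ (y, (0 : Q))) =ᶠ[𝓝 z] id := by
        filter_upwards [isOpen_ball.mem_nhds (mem_ball.2 hzq'.1)] with y hy
        refine (hprop y 0 ?_).1
        refine hsub₁ ?_
        rw [mem_ball, Prod.dist_eq, max_lt_iff]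
        exact ⟨hy, by simpa using hr⟩
      have h3 := (h1.congr_of_eventuallyEq h2.symm).unique (hasFDerivAt_id z)
      have h4 := congrArg (fun L => L h) h3
      simpa using h4
    have hsnd_small : ∀ k : Q, ‖k‖ < r → fderiv ℝ Ψ (z, 0) (0, k) = B z k := by
      intro k hk
      have hzk : (z, k) ∈ ball ((z₀, 0) : F × Q) r := by
        rw [mem_ball, Prod.dist_eq, max_lt_iff, dist_zero_right]
        exact ⟨hzq'.1, hk⟩
      have h1 := (hprop z k (hsub₁ hzk)).2 0 (by norm_num)
      have h2 := hcurve z k 0 (by rw [zero_smul]; exact hsub₁ hz0)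
      have h3 := h2.unique h1
      rw [zero_smul, hΨz, hBB' z (by rw [← hΨz]; exact hmaps _ hz0)] at h3
      exact h3
    have hsnd : fderiv ℝ Ψ (z, 0) (0, k) = B z k := by
      obtain ⟨c, hc0, hc⟩ : ∃ c : ℝ, 0 < c ∧ ‖c • k‖ < r := by
        refine ⟨r / (2 * (‖k‖ + 1)), by positivity, ?_⟩
        rw [norm_smul, Real.norm_of_nonneg (by positivity), div_mul_eq_mul_div,
          div_lt_iff₀ (by positivity)]
        nlinarith [norm_nonneg k]
      have h1 := hsnd_small _ hc
      have h4 : ((0 : F), c • k) = c • ((0 : F), k) := by simp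
      rw [h4, map_smul, map_smul] at h1
      exact smul_right_injective F hc0.ne' h1
    have : (h, k) = (h, 0) + ((0 : F), k) := by simp
    rw [this, map_add, hfst, hsnd]

end LocalExponential

/-! ### Derivatives of a local diffeomorphism and of its inverse -/

section Inverse

variable {E F : Type*} [NormedAddCommGroup E] [NormedSpace ℝ E]
  [NormedAddCommGroup F] [NormedSpace ℝ F]

theorem fderiv_symm_fderiv {f : E → F} (e : OpenPartialHomeomorph E F) (he : ∀ x, e x = f x)
    (hf : ContDiffOn ℝ ∞ f e.source) (hs : ContDiffOn ℝ ∞ e.symm e.target) {x : E}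
    (hx : x ∈ e.source) (h : E) : fderiv ℝ e.symm (f x) (fderiv ℝ f x h) = h := by
  have hfx : f x ∈ e.target := he x ▸ e.map_source hx
  have h1 := ((hf.contDiffAt (e.open_source.mem_nhds hx)).differentiableAt (by simp)).hasFDerivAt
  have h2 :=
    ((hs.contDiffAt (e.open_target.mem_nhds hfx)).differentiableAt (by simp)).hasFDerivAt
  have h3 : e.symm ∘ f =ᶠ[𝓝 x] id := by
    filter_upwards [e.open_source.mem_nhds hx] with y hy
    change e.symm (f y) = y
    rw [← he y, e.left_inv hy]
  have h4 := ((h2.comp x h1).congr_of_eventuallyEq h3.symm).unique (hasFDerivAt_id x)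
  simpa using congrArg (fun L => L h) h4

theorem fderiv_fderiv_symm {f : E → F} (e : OpenPartialHomeomorph E F) (he : ∀ x, e x = f x)
    (hf : ContDiffOn ℝ ∞ f e.source) (hs : ContDiffOn ℝ ∞ e.symm e.target) {y : F}
    (hy : y ∈ e.target) (h : F) : fderiv ℝ f (e.symm y) (fderiv ℝ e.symm y h) = h := by
  have h1 := ((hf.contDiffAt (e.open_source.mem_nhds (e.map_target hy))).differentiableAt
    (by simp)).hasFDerivAt
  have h2 :=
    ((hs.contDiffAt (e.open_target.mem_nhds hy)).differentiableAt (by simp)).hasFDerivAt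
  have h3 : f ∘ e.symm =ᶠ[𝓝 y] id := by
    filter_upwards [e.open_target.mem_nhds hy] with z hz
    change f (e.symm z) = z
    rw [← he, e.right_inv hz]
  have h4 := ((h1.comp y h2).congr_of_eventuallyEq h3.symm).unique (hasFDerivAt_id y)
  simpa using congrArg (fun L => L h) h4

end Inverse

/-! ## Functional dependence -/

/-- If the differential of `h` vanishes on the kernel of the differential of a submersion `φ`,
then `h` is locally a smooth function of `φ`. -/
theorem exists_eq_comp_of_fderiv_eq_zero {E G : Type*} [NormedAddCommGroup E] [NormedSpace ℝ E]
    [FiniteDimensional ℝ E] [NormedAddCommGroup G] [NormedSpace ℝ G] [FiniteDimensional ℝ G]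
    {φ : E → G} {h : E → ℝ} {W : Set E} (hW : IsOpen W) (hφ : ContDiffOn ℝ ∞ φ W)
    (hh : ContDiffOn ℝ ∞ h W) {x₀ : E} (hx₀ : x₀ ∈ W)
    (hsurj : Function.Surjective (fderiv ℝ φ x₀))
    (hker : ∀ x ∈ W, ∀ v, fderiv ℝ φ x v = 0 → fderiv ℝ h x v = 0) :
    ∃ (W' : Set E) (ρ : ℝ) (H : G → ℝ), IsOpen W' ∧ x₀ ∈ W' ∧ W' ⊆ W ∧
      ContDiffOn ℝ ∞ H (ball (φ x₀) ρ) ∧ ∀ x ∈ W', φ x ∈ ball (φ x₀) ρ ∧ h x = H (φ x) := by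
  have : CompleteSpace E := FiniteDimensional.complete ℝ E
  have : CompleteSpace G := FiniteDimensional.complete ℝ G
  obtain ⟨P, hP⟩ := (fderiv ℝ φ x₀).ker_closedComplemented_of_finiteDimensional_range
  have hrange : (fderiv ℝ φ x₀).range = ⊤ := LinearMap.range_eq_top.2 hsurj
  let f' := (fderiv ℝ φ x₀).equivProdOfSurjectiveOfIsCompl P hrange
    (LinearMap.range_eq_of_proj hP) (LinearMap.isCompl_of_proj hP)
  -- A projection onto the kernel of the differential at x₀ completes φ to a local chart.
  let Θ : E → G × (fderiv ℝ φ x₀).ker := fun x => (φ x, P x)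
  have hΘ : ContDiffOn ℝ ∞ Θ W := hφ.prodMk P.contDiff.contDiffOn
  have hdφ : ∀ x ∈ W, HasFDerivAt φ (fderiv ℝ φ x) x := fun x hx =>
    ((hφ.contDiffAt (hW.mem_nhds hx)).differentiableAt (by simp)).hasFDerivAt
  have hΘ' : ∀ x ∈ W, HasFDerivAt Θ ((fderiv ℝ φ x).prod P) x := fun x hx =>
    (hdφ x hx).prodMk P.hasFDerivAt
  obtain ⟨e, he₀, heW, hcoe, hsm⟩ := exists_smooth_openPartialHomeomorph hW hΘ hx₀ f'
    (hΘ' x₀ hx₀)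
  have hmem : Θ x₀ ∈ e.target := hcoe x₀ ▸ e.map_source he₀
  obtain ⟨ρ, hρ, hρt⟩ := Metric.isOpen_iff.1 e.open_target _ hmem
  have hprod : ∀ y k, y ∈ ball (φ x₀) ρ → k ∈ ball (P x₀) ρ → (y, k) ∈ e.target := by
    intro y k hy hk
    apply hρt
    rw [mem_ball, Prod.dist_eq, max_lt_iff]
    exact ⟨hy, hk⟩
  have hP₀ : P x₀ ∈ ball (P x₀) ρ := mem_ball_self hρ
  have hhsym : ContDiffOn ℝ ∞ (h ∘ e.symm) e.target :=
    hh.comp hsm fun y hy => heW (e.map_target hy)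
  refine ⟨e.source ∩ e ⁻¹' ball (Θ x₀) ρ, ρ, fun y => h (e.symm (y, P x₀)),
    e.isOpen_inter_preimage isOpen_ball, ⟨he₀, ?_⟩, fun x hx => heW hx.1, ?_, ?_⟩
  · rw [mem_preimage, hcoe]
    exact mem_ball_self hρ
  · exact hhsym.comp (contDiff_id.prodMk contDiff_const).contDiffOn
      fun y hy => hprod y _ hy hP₀
  · rintro x ⟨hxs, hxb⟩
    rw [mem_preimage, hcoe, mem_ball, Prod.dist_eq, max_lt_iff] at hxb
    refine ⟨hxb.1, ?_⟩
    -- In this chart, directions along the second factor are annihilated by dφ, hence by dh; so h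
    -- does not depend on the second coordinate.
    have hconst : ∀ k ∈ ball (P x₀) ρ, HasFDerivWithinAt (fun k => (h ∘ e.symm) (φ x, k))
        (0 : (fderiv ℝ φ x₀).ker →L[ℝ] ℝ) (ball (P x₀) ρ) k := by
      intro k hk
      have hyk := hprod _ _ hxb.1 hk
      have hxW := heW (e.map_target hyk)
      have hd1 := ((hsm.contDiffAt (e.open_target.mem_nhds hyk)).differentiableAt
        (by simp)).hasFDerivAt
      have hd2 := ((hh.contDiffAt (hW.mem_nhds hxW)).differentiableAt (by simp)).hasFDerivAt
      have hd3 := (hd2.comp _ hd1).comp k (hasFDerivAt_prodMk_right (φ x) k)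
      refine (hd3.congr_fderiv ?_).hasFDerivWithinAt
      ext v
      simp only [ContinuousLinearMap.comp_apply, zero_apply]
      refine hker _ hxW _ ?_
      have h5 := fderiv_fderiv_symm e hcoe (hΘ.mono heW) hsm hyk
        (ContinuousLinearMap.inr ℝ G _ v)
      rw [(hΘ' _ hxW).fderiv] at h5
      exact congrArg Prod.fst h5
    have h6 := (convex_ball (P x₀) ρ).is_const_of_fderivWithin_eq_zero
      (fun k hk => (hconst k hk).differentiableWithinAt)
      (fun k hk => (hconst k hk).fderivWithin (isOpen_ball.uniqueDiffWithinAt hk))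
      hxb.2 hP₀
    have h7 : e.symm (φ x, P x) = x := by
      have := e.left_inv hxs
      rwa [hcoe] at this
    change h (e.symm (φ x, P x)) = h (e.symm (φ x, P x₀)) at h6
    rwa [h7] at h6

/-! ## The Frobenius theorem for one-forms -/

section Frobenius

variable {E : Type} [NormedAddCommGroup E] [NormedSpace ℝ E] [FiniteDimensional ℝ E]

/-- **Frobenius theorem** for a nowhere vanishing one-form `A` with `A ∧ dA = 0`. -/
theorem exists_integrating_factor {A : E → E →L[ℝ] ℝ} {U : Set E} (hU : IsOpen U)
    (hA : ContDiffOn ℝ ∞ A U) {x₀ : E} (hx₀ : x₀ ∈ U) (hne : A x₀ ≠ 0)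
    (hint : ∀ x ∈ U, ∀ h₁ h₂ h₃, A x h₁ * (fderiv ℝ A x h₂ h₃ - fderiv ℝ A x h₃ h₂) +
      A x h₂ * (fderiv ℝ A x h₃ h₁ - fderiv ℝ A x h₁ h₃) +
      A x h₃ * (fderiv ℝ A x h₁ h₂ - fderiv ℝ A x h₂ h₁) = 0) :
    ∃ (W : Set E) (α β : E → ℝ), IsOpen W ∧ x₀ ∈ W ∧ W ⊆ U ∧ ContDiffOn ℝ ∞ α W ∧
      ContDiffOn ℝ ∞ β W ∧ ∀ x ∈ W, β x ≠ 0 ∧ fderiv ℝ α x = β x • A x := by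
  have : CompleteSpace E := FiniteDimensional.complete ℝ E
  obtain ⟨e, he⟩ : ∃ e, A x₀ e ≠ 0 := by
    by_contra! h
    exact hne (ContinuousLinearMap.ext h)
  let U' : Set E := U ∩ (fun x => A x e) ⁻¹' {0}ᶜ
  have hAe : ContDiffOn ℝ ∞ (fun x => A x e) U := hA.clm_apply contDiffOn_const
  have hU' : IsOpen U' := hAe.continuousOn.isOpen_inter_preimage hU isOpen_compl_singleton
  have hx₀' : x₀ ∈ U' := ⟨hx₀, he⟩
  have hAU' : ContDiffOn ℝ ∞ A U' := hA.mono inter_subset_left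
  -- B x is the projection onto the kernel of A x along e, so the curves generated by B are tangent
  -- to the distribution.
  let B : E → E →L[ℝ] E := fun x =>
    ContinuousLinearMap.id ℝ E - ((A x e)⁻¹ • A x).smulRight e
  have hB : ContDiffOn ℝ ∞ B U' := by
    refine contDiffOn_const.sub (ContDiffOn.smulRight ?_ contDiffOn_const)
    exact ((hAe.mono inter_subset_left).inv fun x hx => hx.2).smul hAU'
  have hAB : ∀ x ∈ U', ∀ v, A x (B x v) = 0 := by
    intro x hx v
    have : A x e ≠ 0 := hx.2
    simp [B]
    field_simp
    ring
  obtain ⟨r, Ψ, hr, hΨ, hΨU, hprop⟩ := exists_smooth_exponential_of_contDiffOn hU' hB hx₀'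
  let lam : E →L[ℝ] ℝ := (A x₀ e)⁻¹ • A x₀
  have hlam : lam e = 1 := inv_mul_cancel₀ he
  let P : E →L[ℝ] E := ContinuousLinearMap.id ℝ E - lam.smulRight e
  have hP : ∀ w, P w = w - lam w • e := fun w => rfl
  have hlamP : ∀ w, lam (P w) = 0 := fun w => by rw [hP]; simp [hlam]
  have hPker : ∀ w, lam w = 0 → P w = w := fun w hw => by rw [hP, hw, zero_smul, sub_zero]
  have hPe : P e = 0 := by rw [hP, hlam, one_smul, sub_self]
  -- The chart K starts on the transversal line x₀ + λ(w)e and follows the horizontal curve with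
  -- parameter Pw. If the distribution is integrable, the leaves should become the level sets of λ.
  let ι : E → E × E := fun w => (x₀ + lam w • e, P w)
  let ι' : E →L[ℝ] E × E := (lam.smulRight e).prod P
  have hι' : ∀ w, HasFDerivAt ι ι' w := fun w =>
    ((lam.smulRight e).hasFDerivAt.const_add x₀).prodMk P.hasFDerivAt
  have hι : ContDiff ℝ ∞ ι :=
    (contDiff_const.add (lam.smulRight e).contDiff).prodMk P.contDiff
  let D₀ : Set E := ι ⁻¹' ball (x₀, 0) r
  have hD₀ : IsOpen D₀ := isOpen_ball.preimage hι.continuous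
  let K : E → E := fun w => Ψ (ι w)
  have hK : ContDiffOn ℝ ∞ K D₀ := hΨ.comp hι.contDiffOn fun w hw => hw
  have hKU : ∀ w ∈ D₀, K w ∈ U' := fun w hw => hΨU hw
  have hΨd : ∀ w ∈ D₀, HasFDerivAt K ((fderiv ℝ Ψ (ι w)).comp ι') w := fun w hw =>
    (((hΨ.contDiffAt (isOpen_ball.mem_nhds hw)).differentiableAt
      (by simp)).hasFDerivAt).comp w (hι' w)
  have hKd : ∀ w ∈ D₀, ∀ h, fderiv ℝ K w h = fderiv ℝ Ψ (ι w) (lam h • e, P h) :=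
    fun w hw h => by rw [(hΨd w hw).fderiv]; rfl
  -- the pulled back form
  let Ã : E → E →L[ℝ] ℝ := fun w => (A (K w)).comp (fderiv ℝ K w)
  have hdK : ContDiffOn ℝ ∞ (fderiv ℝ K) D₀ := hK.fderiv_of_isOpen hD₀ (by simp)
  have hAK : ContDiffOn ℝ ∞ (fun w => A (K w)) D₀ := hAU'.comp hK hKU
  have hÃ : ContDiffOn ℝ ∞ Ã D₀ := hAK.clm_comp hdK
  have hÃd : ∀ w ∈ D₀, HasFDerivAt Ã (fderiv ℝ Ã w) w := fun w hw =>
    ((hÃ.contDiffAt (hD₀.mem_nhds hw)).differentiableAt (by simp)).hasFDerivAt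
  -- Exterior differentiation commutes with pull-back: the second derivatives of K cancel by
  -- symmetry.
  have hdÃ : ∀ w ∈ D₀, ∀ h₁ h₂, fderiv ℝ Ã w h₁ h₂ - fderiv ℝ Ã w h₂ h₁ =
      fderiv ℝ A (K w) (fderiv ℝ K w h₁) (fderiv ℝ K w h₂) -
      fderiv ℝ A (K w) (fderiv ℝ K w h₂) (fderiv ℝ K w h₁) := by
    intro w hw h₁ h₂
    have h1 : HasFDerivAt (fderiv ℝ K) (fderiv ℝ (fderiv ℝ K) w) w :=
      ((hdK.contDiffAt (hD₀.mem_nhds hw)).differentiableAt (by simp)).hasFDerivAt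
    have h2 : HasFDerivAt K (fderiv ℝ K w) w :=
      ((hK.contDiffAt (hD₀.mem_nhds hw)).differentiableAt (by simp)).hasFDerivAt
    have h3 : HasFDerivAt A (fderiv ℝ A (K w)) (K w) :=
      ((hAU'.contDiffAt (hU'.mem_nhds (hKU w hw))).differentiableAt (by simp)).hasFDerivAt
    have h4 := ((h3.comp w h2).clm_comp h1).fderiv
    have hsymm : fderiv ℝ (fderiv ℝ K) w h₁ h₂ = fderiv ℝ (fderiv ℝ K) w h₂ h₁ :=
      (hK.contDiffAt (hD₀.mem_nhds hw)).isSymmSndFDerivAt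
        (by rw [minSmoothness_of_isRCLikeNormedField]; exact ENat.LEInfty.out) h₁ h₂
    have h5 : ∀ k₁ k₂, fderiv ℝ Ã w k₁ k₂ = A (K w) (fderiv ℝ (fderiv ℝ K) w k₁ k₂) +
        fderiv ℝ A (K w) (fderiv ℝ K w k₁) (fderiv ℝ K w k₂) := by
      intro k₁ k₂
      have h6 : fderiv ℝ Ã w = _ := h4
      rw [h6]
      simp
    rw [h5, h5, hsymm]
    ring
  have hÃP : ∀ w ∈ D₀, Ã w (P w) = 0 := by
    intro w hw
    change A (K w) (fderiv ℝ K w (P w)) = 0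
    rw [hKd w hw, hlamP, hPker _ (hlamP w), zero_smul, (hprop _ _ hw).1]
    exact hAB _ (hKU w hw) _
  have hÃP' : ∀ w ∈ D₀, ∀ h, fderiv ℝ Ã w h (P w) + Ã w (P h) = 0 := by
    intro w hw h
    have h1 := (hÃd w hw).clm_apply (P.hasFDerivAt (x := w))
    have h2 : (fun w => Ã w (P w)) =ᶠ[𝓝 w] fun _ => 0 := by
      filter_upwards [hD₀.mem_nhds hw] with y hy using hÃP y hy
    have h3 := (h1.congr_of_eventuallyEq h2.symm).unique (hasFDerivAt_const (0 : ℝ) w)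
    have h4 := congrArg (fun L => L h) h3
    simp only [add_apply, ContinuousLinearMap.comp_apply,
      ContinuousLinearMap.flip_apply, zero_apply] at h4
    linarith
  -- This is A ∧ dA = 0, pulled back and evaluated on (Pw, v, e). The pulled back form vanishes on
  -- the radial vector Pw, and the derivative of that relation replaces the derivatives in the
  -- directions v and e.
  have hradial : ∀ w ∈ D₀, ∀ v, lam v = 0 →
      Ã w e * (fderiv ℝ Ã w (P w) v + Ã w v) = Ã w v * fderiv ℝ Ã w (P w) e := by
    intro w hw v hv
    have h1 := hint (K w) (hKU w hw).1 (fderiv ℝ K w (P w)) (fderiv ℝ K w v) (fderiv ℝ K w e)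
    rw [← hdÃ w hw, ← hdÃ w hw, ← hdÃ w hw] at h1
    change Ã w (P w) * _ + Ã w v * _ + Ã w e * _ = 0 at h1
    have h2 := hÃP' w hw v
    have h3 := hÃP' w hw e
    rw [hPker v hv] at h2
    rw [hPe, map_zero, add_zero] at h3
    rw [hÃP w hw] at h1
    linear_combination h1 - (Ã w v) * h3 + (Ã w e) * h2
  -- the domain
  have h0D₀ : (0 : E) ∈ D₀ := by
    change ι 0 ∈ ball _ _
    simp [ι, hr]
  have hK0 : K 0 = x₀ := by
    have := (hprop x₀ 0 (mem_ball_self hr)).2.1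
    simpa [K, ι] using this
  have hdK0 : fderiv ℝ K 0 = ContinuousLinearMap.id ℝ E := by
    ext h
    rw [hKd 0 h0D₀]
    have h1 := (hprop x₀ 0 (mem_ball_self hr)).2.2 (lam h • e) (P h)
    have h2 : ι 0 = (x₀, 0) := by simp [ι]
    rw [h2, h1]
    have h3 : A x₀ (P h) = 0 := by
      have h4 := hlamP h
      change (A x₀ e)⁻¹ * A x₀ (P h) = 0 at h4
      exact (mul_eq_zero.1 h4).resolve_left (inv_ne_zero he)
    change lam h • e + (P h - ((A x₀ e)⁻¹ * A x₀ (P h)) • e) = h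
    rw [h3, hP, mul_zero, zero_smul, sub_zero, add_sub_cancel]
  have hÃe : ContDiffOn ℝ ∞ (fun w => Ã w e) D₀ := hÃ.clm_apply contDiffOn_const
  have hopen : IsOpen (D₀ ∩ (fun w => Ã w e) ⁻¹' {0}ᶜ) :=
    hÃe.continuousOn.isOpen_inter_preimage hD₀ isOpen_compl_singleton
  have h0mem : (0 : E) ∈ D₀ ∩ (fun w => Ã w e) ⁻¹' {0}ᶜ := by
    refine ⟨h0D₀, ?_⟩
    change A (K 0) (fderiv ℝ K 0 e) ≠ 0
    rw [hK0, hdK0]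
    exact he
  obtain ⟨ρ, hρ, hρD⟩ := Metric.isOpen_iff.1 hopen _ h0mem
  -- Both ends λ(w)e and w of the radial segment are kept in the ball, hence so is the segment.
  let D : Set E := ball 0 ρ ∩ (fun w => lam w • e) ⁻¹' ball 0 ρ
  have hD : IsOpen D :=
    isOpen_ball.inter (isOpen_ball.preimage (lam.smulRight e).continuous)
  have hDD₀ : D ⊆ D₀ := fun w hw => (hρD hw.1).1
  have hvanish : ∀ w ∈ D, ∀ v, lam v = 0 → Ã w v = 0 := by
    intro w hw v hv
    let c : ℝ → E := fun s => lam w • e + s • P w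
    have hcD : ∀ s ∈ Icc (0 : ℝ) 1, c s ∈ ball (0 : E) ρ := by
      intro s hs
      have h1 := (convex_ball (0 : E) ρ).add_smul_sub_mem hw.2 hw.1 hs
      simpa only [c, hP] using h1
    have hPc : ∀ s, P (c s) = s • P w := by
      intro s
      simp only [c, map_add, map_smul, hPe, smul_zero, zero_add, hPker _ (hlamP w)]
    have hcd : ∀ s, HasDerivAt c (P w) s := by
      intro s
      simpa [c] using ((hasDerivAt_id s).smul_const (P w)).const_add (lam w • e)
    have hNd : ∀ s ∈ Icc (0 : ℝ) 1, ∀ y,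
        HasDerivAt (fun s => Ã (c s) y) (fderiv ℝ Ã (c s) (P w) y) s := by
      intro s hs y
      have h1 := (hÃd _ (hρD (hcD s hs)).1).comp_hasDerivAt s (hcd s)
      have h2 := h1.clm_apply (hasDerivAt_const s y)
      simpa using h2
    -- By the radial equation s·Ã(v)/Ã(e) is constant along the segment. The factor s makes it zero
    -- at s = 0, so Ã(v) = 0 at s = 1.
    have hq : ∀ s ∈ Icc (0 : ℝ) 1,
        HasDerivAt (fun s => s * Ã (c s) v / Ã (c s) e) 0 s := by
      intro s hs
      have hMne : Ã (c s) e ≠ 0 := (hρD (hcD s hs)).2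
      refine (((hasDerivAt_id s).mul (hNd s hs v)).div (hNd s hs e) hMne).congr_deriv ?_
      have h1 := hradial _ (hρD (hcD s hs)).1 v hv
      rw [hPc, map_smul, smul_apply, smul_apply] at h1
      simp only [smul_eq_mul] at h1
      rw [div_eq_zero_iff]
      left
      simp only [id, Pi.mul_apply]
      linear_combination h1
    have h1 := constant_of_has_deriv_right_zero
      (fun s hs => (hq s hs).continuousAt.continuousWithinAt)
      (fun s hs => (hq s (Ico_subset_Icc_self hs)).hasDerivWithinAt) 1 (by norm_num)
    have h2 : c 1 = w := by simp [c, hP]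
    have hMne : Ã w e ≠ 0 := (hρD hw.1).2
    simp only [h2, one_mul, zero_mul, zero_div, div_eq_zero_iff] at h1
    exact h1.resolve_right hMne
  -- inversion
  have h0D : (0 : E) ∈ D := ⟨mem_ball_self hρ, by simp [hρ]⟩
  have hKD : ContDiffOn ℝ ∞ K D := hK.mono hDD₀
  obtain ⟨E', h0, hE'D, hcoe, hsm⟩ := exists_smooth_openPartialHomeomorph hD hKD h0D
    (ContinuousLinearEquiv.refl ℝ E) (by
      have := ((hK.contDiffAt (hD₀.mem_nhds h0D₀)).differentiableAt (by simp)).hasFDerivAt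
      rw [hdK0] at this
      exact this)
  have hback : ∀ x ∈ E'.target, E'.symm x ∈ D ∧ K (E'.symm x) = x := fun x hx =>
    ⟨hE'D (E'.map_target hx), by rw [← hcoe, E'.right_inv hx]⟩
  refine ⟨E'.target, fun x => lam (E'.symm x), fun x => (Ã (E'.symm x) e)⁻¹, E'.open_target,
    ?_, ?_, lam.contDiff.comp_contDiffOn hsm, ?_, ?_⟩
  · have := E'.map_source h0
    rwa [hcoe, hK0] at this
  · intro x hx
    have := hKU _ (hDD₀ (hback x hx).1)
    rw [(hback x hx).2] at this
    exact this.1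
  · exact (hÃe.comp hsm fun x hx => hDD₀ (hback x hx).1).inv
      fun x hx => (hρD (hback x hx).1.1).2
  · intro x hx
    have hMne : Ã (E'.symm x) e ≠ 0 := (hρD (hback x hx).1.1).2
    refine ⟨inv_ne_zero hMne, ?_⟩
    have hd := lam.hasFDerivAt.comp x
      ((hsm.contDiffAt (E'.open_target.mem_nhds hx)).differentiableAt (by simp)).hasFDerivAt
    have hd' : fderiv ℝ (fun x => lam (E'.symm x)) x = lam.comp (fderiv ℝ E'.symm x) := hd.fderiv
    rw [hd']
    ext h
    have h1 := fderiv_fderiv_symm E' hcoe (hKD.mono hE'D) hsm hx h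
    set h' := fderiv ℝ E'.symm x h
    have h2 : A x h = Ã (E'.symm x) h' := by
      change _ = A (K (E'.symm x)) (fderiv ℝ K (E'.symm x) h')
      rw [h1, (hback x hx).2]
    have h3 : h' = lam h' • e + P h' := by rw [hP]; abel
    have h4 : Ã (E'.symm x) h' = lam h' * Ã (E'.symm x) e := by
      conv_lhs => rw [h3]
      rw [map_add, map_smul, hvanish _ (hback x hx).1 _ (hlamP h'), add_zero, smul_eq_mul]
    change lam h' = (Ã (E'.symm x) e)⁻¹ * A x h
    rw [h2, h4]
    field_simp

end Frobenius

/-! ## Partial derivatives -/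

section PartialDerivatives

theorem fderiv_eq_sum_pd (f : Pt → ℝ) (x v : Pt) :
    fderiv ℝ f x v = ∑ i, v i * pd f i x := by
  have := (fderiv ℝ f x : Pt →ₗ[ℝ] ℝ).pi_apply_eq_sum_univ v
  simp only [smul_eq_mul] at this
  refine this.trans (Finset.sum_congr rfl fun i _ => ?_)
  have h : (fun j => if i = j then (1 : ℝ) else 0) = Pi.single i 1 := by
    funext j
    simp [Pi.single_apply, eq_comm]
  rw [h]
  rfl

theorem dot_eq_fderiv (u : Field1) (f : Pt → ℝ) (x : Pt) : dot u f x = fderiv ℝ f x (u x) :=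
  (fderiv_eq_sum_pd f x (u x)).symm

variable {W : Set Pt} {f h : Pt → ℝ} {x : Pt} {i : Fin 4}

theorem Smooth.contDiffAt (hf : Smooth W f) (hW : IsOpen W) (hx : x ∈ W) : ContDiffAt ℝ ∞ f x :=
  ContDiffOn.contDiffAt hf (hW.mem_nhds hx)

theorem Smooth.diffAt (hf : Smooth W f) (hW : IsOpen W) (hx : x ∈ W) : DifferentiableAt ℝ f x :=
  (hf.contDiffAt hW hx).differentiableAt (by simp)

theorem smooth_of_locally (hf : ∀ x ∈ W, ContDiffAt ℝ ∞ f x) : Smooth W f :=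
  fun x hx => (hf x hx).contDiffWithinAt

theorem Smooth.mono {W' : Set Pt} (hf : Smooth W f) (h : W' ⊆ W) : Smooth W' f :=
  ContDiffOn.mono hf h

theorem Smooth.pd (hf : Smooth W f) (hW : IsOpen W) (i : Fin 4) : Smooth W (pd f i) :=
  (hf.fderiv_of_isOpen (m := ∞) hW (by simp)).clm_apply contDiffOn_const

theorem Smooth.add (hf : Smooth W f) (hh : Smooth W h) : Smooth W fun x => f x + h x :=
  ContDiffOn.add hf hh

theorem Smooth.sub (hf : Smooth W f) (hh : Smooth W h) : Smooth W fun x => f x - h x :=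
  ContDiffOn.sub hf hh

theorem Smooth.mul (hf : Smooth W f) (hh : Smooth W h) : Smooth W fun x => f x * h x :=
  ContDiffOn.mul hf hh

theorem Smooth.neg (hf : Smooth W f) : Smooth W fun x => -f x := ContDiffOn.neg hf

theorem Smooth.div (hf : Smooth W f) (hh : Smooth W h) (h0 : ∀ x ∈ W, h x ≠ 0) :
    Smooth W fun x => f x / h x := ContDiffOn.div hf hh h0

theorem Smooth.sum {ι : Type*} [Fintype ι] {F : ι → Pt → ℝ} (hF : ∀ i, Smooth W (F i)) :
    Smooth W fun x => ∑ i, F i x := ContDiffOn.sum fun i _ => hF i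

theorem smooth_const (c : ℝ) : Smooth W fun _ => c := contDiffOn_const

theorem Smooth.dot {u : Field1} (hu : ∀ i, Smooth W fun x => u x i) (hf : Smooth W f)
    (hW : IsOpen W) : Smooth W (dot u f) :=
  Smooth.sum fun i => (hu i).mul (hf.pd hW i)

theorem pd_congr (hW : IsOpen W) (hx : x ∈ W) (hfh : ∀ y ∈ W, f y = h y) :
    pd f i x = pd h i x := by
  have : f =ᶠ[𝓝 x] h := by
    filter_upwards [hW.mem_nhds hx] with y hy using hfh y hy
  rw [pd, pd, this.fderiv_eq]

theorem dot_congr {u : Field1} (hW : IsOpen W) (hx : x ∈ W) (hfh : ∀ y ∈ W, f y = h y) :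
    dot u f x = dot u h x :=
  Finset.sum_congr rfl fun _ _ => by rw [pd_congr hW hx hfh]

theorem pd_add (hf : DifferentiableAt ℝ f x) (hh : DifferentiableAt ℝ h x) :
    pd (fun y => f y + h y) i x = pd f i x + pd h i x := by
  have := (hf.hasFDerivAt.add hh.hasFDerivAt).fderiv
  exact congrArg (fun L => L (Pi.single i 1)) this

theorem pd_sub (hf : DifferentiableAt ℝ f x) (hh : DifferentiableAt ℝ h x) :
    pd (fun y => f y - h y) i x = pd f i x - pd h i x := by
  have := (hf.hasFDerivAt.sub hh.hasFDerivAt).fderiv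
  exact congrArg (fun L => L (Pi.single i 1)) this

theorem pd_mul (hf : DifferentiableAt ℝ f x) (hh : DifferentiableAt ℝ h x) :
    pd (fun y => f y * h y) i x = pd f i x * h x + f x * pd h i x := by
  have := (hf.hasFDerivAt.mul hh.hasFDerivAt).fderiv
  have h2 := congrArg (fun L => L (Pi.single i 1)) this
  simp only [add_apply, smul_apply, smul_eq_mul] at h2
  rw [pd, pd, pd]
  refine h2.trans ?_
  ring

theorem pd_const (c : ℝ) : pd (fun _ => c) i x = 0 := by
  rw [pd, fderiv_const_apply]
  rfl

theorem pd_const_mul (c : ℝ) (hf : DifferentiableAt ℝ f x) :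
    pd (fun y => c * f y) i x = c * pd f i x := by
  rw [pd_mul (differentiableAt_const c) hf, pd_const]
  ring

theorem pd_neg : pd (fun y => -f y) i x = -pd f i x := by
  have : fderiv ℝ (fun y => -f y) x = -fderiv ℝ f x := fderiv_neg
  rw [pd, this]
  rfl

/-- The chain rule for a function of a function. -/
theorem pd_comp {F : ℝ → ℝ} (hF : DifferentiableAt ℝ F (f x)) (hf : DifferentiableAt ℝ f x) :
    pd (fun y => F (f y)) i x = deriv F (f x) * pd f i x := by
  have := (hF.hasDerivAt.comp_hasFDerivAt x hf.hasFDerivAt).fderiv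
  exact congrArg (fun L => L (Pi.single i 1)) this

theorem pd_div (hf : DifferentiableAt ℝ f x) (hh : DifferentiableAt ℝ h x) (h0 : h x ≠ 0) :
    pd (fun y => f y / h y) i x = (pd f i x * h x - f x * pd h i x) / h x ^ 2 := by
  have hq : DifferentiableAt ℝ (fun y => f y / h y) x := by
    simp only [div_eq_mul_inv]
    exact hf.mul (hh.inv h0)
  have h1 : pd (fun y => f y / h y * h y) i x = pd f i x := by
    have : (fun y => f y / h y * h y) =ᶠ[𝓝 x] f := by
      filter_upwards [hh.continuousAt.eventually_ne h0] with y hy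
      exact div_mul_cancel₀ _ hy
    rw [pd, this.fderiv_eq, pd]
  rw [pd_mul hq hh] at h1
  field_simp at h1 ⊢
  linear_combination h1

theorem pd_comm (hf : Smooth W f) (hW : IsOpen W) (hx : x ∈ W) (i j : Fin 4) :
    pd (pd f j) i x = pd (pd f i) j x := by
  have hd : DifferentiableAt ℝ (fderiv ℝ f) x :=
    (ContDiffOn.contDiffAt (hf.fderiv_of_isOpen (m := ∞) hW (by simp))
      (hW.mem_nhds hx)).differentiableAt (by simp)
  have h1 : ∀ i j, pd (pd f j) i x =
      fderiv ℝ (fderiv ℝ f) x (Pi.single i 1) (Pi.single j 1) := by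
    intro i j
    have h2 := (hd.hasFDerivAt.clm_apply (hasFDerivAt_const (Pi.single j 1) x)).fderiv
    have h3 := congrArg (fun L => L (Pi.single i 1)) h2
    refine Eq.trans ?_ (h3.trans (by simp))
    rfl
  rw [h1, h1]
  exact (hf.contDiffAt hW hx).isSymmSndFDerivAt
    (by rw [minSmoothness_of_isRCLikeNormedField]; exact ENat.LEInfty.out) _ _

variable {u : Field1}

theorem dot_add (hf : DifferentiableAt ℝ f x) (hh : DifferentiableAt ℝ h x) :
    dot u (fun y => f y + h y) x = dot u f x + dot u h x := by
  simp only [dot, pd_add hf hh, mul_add, Finset.sum_add_distrib]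

theorem dot_sub (hf : DifferentiableAt ℝ f x) (hh : DifferentiableAt ℝ h x) :
    dot u (fun y => f y - h y) x = dot u f x - dot u h x := by
  simp only [dot, pd_sub hf hh, mul_sub, Finset.sum_sub_distrib]

theorem dot_mul (hf : DifferentiableAt ℝ f x) (hh : DifferentiableAt ℝ h x) :
    dot u (fun y => f y * h y) x = dot u f x * h x + f x * dot u h x := by
  simp only [dot, pd_mul hf hh, mul_add, Finset.sum_add_distrib, Finset.mul_sum, Finset.sum_mul]
  congr 1 <;> exact Finset.sum_congr rfl fun _ _ => by ring

theorem dot_const (c : ℝ) : dot u (fun _ => c) x = 0 := by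
  simp [dot, pd_const]

theorem dot_const_mul (c : ℝ) (hf : DifferentiableAt ℝ f x) :
    dot u (fun y => c * f y) x = c * dot u f x := by
  rw [dot_mul (differentiableAt_const c) hf, dot_const]
  ring

theorem dot_comp {F : ℝ → ℝ} (hF : DifferentiableAt ℝ F (f x)) (hf : DifferentiableAt ℝ f x) :
    dot u (fun y => F (f y)) x = deriv F (f x) * dot u f x := by
  simp only [dot, pd_comp hF hf, Finset.mul_sum]
  exact Finset.sum_congr rfl fun _ _ => by ring

theorem dot_div (hf : DifferentiableAt ℝ f x) (hh : DifferentiableAt ℝ h x) (h0 : h x ≠ 0) :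
    dot u (fun y => f y / h y) x = (dot u f x * h x - f x * dot u h x) / h x ^ 2 := by
  simp only [dot, pd_div hf hh h0]
  rw [Finset.sum_mul, Finset.mul_sum, ← Finset.sum_sub_distrib, Finset.sum_div]
  exact Finset.sum_congr rfl fun _ _ => by ring

/-- A function with vanishing partial derivatives is locally constant. -/
theorem exists_eq_const (hW : IsOpen W) (hf : Smooth W f) (h0 : ∀ x ∈ W, ∀ i, pd f i x = 0)
    (hx : x ∈ W) : ∃ W', IsOpen W' ∧ x ∈ W' ∧ W' ⊆ W ∧ ∀ y ∈ W', f y = f x := by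
  obtain ⟨r, hr, hrW⟩ := Metric.isOpen_iff.1 hW x hx
  refine ⟨ball x r, isOpen_ball, mem_ball_self hr, hrW, fun y hy => ?_⟩
  have hd : ∀ z ∈ ball x r, fderiv ℝ f z = 0 := fun z hz => by
    ext v
    rw [fderiv_eq_sum_pd]
    simp [h0 z (hrW hz)]
  refine (convex_ball x r).is_const_of_fderivWithin_eq_zero (𝕜 := ℝ)
    (fun z hz => (hf.diffAt hW (hrW hz)).differentiableWithinAt)
    (fun z hz => ?_) hy (mem_ball_self hr)
  rw [fderivWithin_of_isOpen isOpen_ball hz, hd z hz]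

end PartialDerivatives

/-! ## Forms and potentials -/

section Potentials

/-- The one-form with given components as a field of linear forms. -/
noncomputable def toForm (ξ : Field1) : Pt → Pt →L[ℝ] ℝ := fun x =>
  ∑ i, ξ x i • ContinuousLinearMap.proj (R := ℝ) (φ := fun _ : Fin 4 => ℝ) i

theorem toForm_apply (ξ : Field1) (x v : Pt) : toForm ξ x v = ∑ i, ξ x i * v i := by
  simp [toForm]

theorem contDiffOn_toForm {ξ : Field1} {U : Set Pt} (hξ : ∀ i, Smooth U fun x => ξ x i) :
    ContDiffOn ℝ ∞ (toForm ξ) U :=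
  ContDiffOn.sum fun i _ => ContDiffOn.smul (hξ i) contDiffOn_const

theorem fderiv_toForm {ξ : Field1} {U : Set Pt} (hU : IsOpen U)
    (hξ : ∀ i, Smooth U fun x => ξ x i) {x : Pt} (hx : x ∈ U) (h k : Pt) :
    fderiv ℝ (toForm ξ) x h k = ∑ i, ∑ j, h i * k j * pd (fun y => ξ y j) i x := by
  have hd : DifferentiableAt ℝ (toForm ξ) x :=
    ((contDiffOn_toForm hξ).contDiffAt (hU.mem_nhds hx)).differentiableAt (by simp)
  have h1 := (hd.hasFDerivAt.clm_apply (hasFDerivAt_const k x)).fderiv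
  have h2 := congrArg (fun L => L h) h1
  have h3 : fderiv ℝ (fun y => toForm ξ y k) x h = fderiv ℝ (toForm ξ) x h k := by
    simpa using h2
  rw [← h3]
  have h4 : (fun y => toForm ξ y k) = fun y => ∑ j, ξ y j * k j := by
    ext y
    rw [toForm_apply]
  rw [h4]
  have h5 : HasFDerivAt (fun y => ∑ j, ξ y j * k j)
      (∑ j, k j • fderiv ℝ (fun y => ξ y j) x) x :=
    HasFDerivAt.fun_sum fun j _ => ((hξ j).diffAt hU hx).hasFDerivAt.mul_const (k j)
  rw [h5.fderiv]
  simp only [sum_apply, smul_apply, smul_eq_mul, fderiv_eq_sum_pd, Finset.mul_sum]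
  rw [Finset.sum_comm]
  exact Finset.sum_congr rfl fun i _ => Finset.sum_congr rfl fun j _ => by ring

theorem fderiv_toForm_sub {ξ : Field1} {U : Set Pt} (hU : IsOpen U)
    (hξ : ∀ i, Smooth U fun x => ξ x i) {x : Pt} (hx : x ∈ U) (h k : Pt) :
    fderiv ℝ (toForm ξ) x h k - fderiv ℝ (toForm ξ) x k h =
      ∑ i, ∑ j, h i * k j * extD ξ x i j := by
  rw [fderiv_toForm hU hξ hx, fderiv_toForm hU hξ hx]
  conv_lhs => rw [sub_eq_add_neg]; arg 2; rw [Finset.sum_comm]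
  rw [← sub_eq_add_neg, ← Finset.sum_sub_distrib]
  refine Finset.sum_congr rfl fun i _ => ?_
  rw [← Finset.sum_sub_distrib]
  refine Finset.sum_congr rfl fun j _ => ?_
  simp only [extD]
  ring

/-- **Poincaré lemma**: a closed one-form is locally exact. -/
theorem exists_potential {ξ : Field1} {U : Set Pt} (hU : IsOpen U)
    (hξ : ∀ i, Smooth U fun x => ξ x i) (hcl : ∀ x ∈ U, ∀ i j, extD ξ x i j = 0) {x₀ : Pt}
    (hx₀ : x₀ ∈ U) :
    ∃ (W : Set Pt) (ψ : Pt → ℝ), IsOpen W ∧ x₀ ∈ W ∧ W ⊆ U ∧ Smooth W ψ ∧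
      ∀ x ∈ W, ∀ i, pd ψ i x = ξ x i := by
  obtain ⟨r, hr, hrU⟩ := Metric.isOpen_iff.1 hU x₀ hx₀
  have hcd := (contDiffOn_toForm hξ).mono hrU
  obtain ⟨ψ, hψ⟩ := (convex_ball x₀ r).exists_forall_hasFDerivAt_of_fderiv_symmetric isOpen_ball
    (hcd.differentiableOn (by simp)) (by
      intro x hx h k
      have := fderiv_toForm_sub hU hξ (hrU hx) h k
      simp only [hcl x (hrU hx), mul_zero, Finset.sum_const_zero] at this
      linarith)
  refine ⟨ball x₀ r, ψ, isOpen_ball, mem_ball_self hr, hrU, ?_, ?_⟩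
  · rw [Smooth, contDiffOn_infty_iff_fderiv_of_isOpen isOpen_ball]
    exact ⟨fun x hx => (hψ x hx).differentiableAt.differentiableWithinAt,
      hcd.congr fun x hx => (hψ x hx).fderiv⟩
  · intro x hx i
    rw [pd, (hψ x hx).fderiv, toForm_apply]
    simp [Pi.single_apply]

/-- **Frobenius theorem** in components. -/
theorem exists_integrating_factor_components {ξ : Field1} {U : Set Pt} (hU : IsOpen U)
    (hξ : ∀ i, Smooth U fun x => ξ x i) (hint : ∀ x ∈ U, ∀ i j k, wedge12 ξ (extD ξ) x i j k = 0)
    {x₀ : Pt} (hx₀ : x₀ ∈ U) (hne : ξ x₀ ≠ 0) :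
    ∃ (W : Set Pt) (α β : Pt → ℝ), IsOpen W ∧ x₀ ∈ W ∧ W ⊆ U ∧ Smooth W α ∧ Smooth W β ∧
      ∀ x ∈ W, β x ≠ 0 ∧ ∀ i, pd α i x = β x * ξ x i := by
  have hsingle : ∀ x i, toForm ξ x (Pi.single i 1) = ξ x i := by
    intro x i
    rw [toForm_apply]
    simp [Pi.single_apply]
  obtain ⟨W, α, β, hW, hxW, hWU, hα, hβ, h⟩ := exists_integrating_factor hU
    (contDiffOn_toForm hξ) hx₀ (by
      intro h0
      refine hne (funext fun i => ?_)
      rw [← hsingle, h0]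
      rfl) (by
      intro x hx h₁ h₂ h₃
      rw [fderiv_toForm_sub hU hξ hx, fderiv_toForm_sub hU hξ hx, fderiv_toForm_sub hU hξ hx]
      have e : ∑ i, ∑ j, ∑ k, h₁ i * h₂ j * h₃ k * wedge12 ξ (extD ξ) x i j k = 0 := by
        simp [hint x hx]
      rw [← e]
      simp only [toForm_apply, wedge12, Fin.sum_univ_four]
      ring)
  refine ⟨W, α, β, hW, hxW, hWU, hα, hβ, fun x hx => ⟨(h x hx).1, fun i => ?_⟩⟩
  rw [pd, (h x hx).2, smul_apply, hsingle, smul_eq_mul]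

end Potentials

/-! ## Invariant functions of a vector field -/

section Invariants

theorem exists_continuousLinearEquiv_of_injective (L : Pt →L[ℝ] Pt) (hL : Function.Injective L) :
    ∃ e : Pt ≃L[ℝ] Pt, (e : Pt →L[ℝ] Pt) = L :=
  ⟨(LinearEquiv.ofInjectiveEndo (L : Pt →ₗ[ℝ] Pt) hL).toContinuousLinearEquiv, by
    ext x
    rfl⟩

/-- Three independent invariant functions exist near a point where the field does not vanish. -/
theorem exists_isInvariants {u : Field1} {U : Set Pt} (hU : IsOpen U)
    (hu : ∀ i, Smooth U fun x => u x i) {x₀ : Pt} (hx₀ : x₀ ∈ U) (hne : u x₀ ≠ 0) :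
    ∃ (W : Set Pt) (φ : Pt → Fin 3 → ℝ), IsOpen W ∧ x₀ ∈ W ∧ W ⊆ U ∧ IsInvariants W u φ := by
  obtain ⟨k, hk⟩ := Function.ne_iff.1 hne
  have hcu : ContDiffOn ℝ ∞ u U := contDiffOn_pi.2 hu
  let B : Pt → ℝ →L[ℝ] Pt := fun x => (ContinuousLinearMap.id ℝ ℝ).smulRight (u x)
  have hB : ContDiffOn ℝ ∞ B U := contDiffOn_const.smulRight hcu
  have hB1 : ∀ x t, B x t = t • u x := fun x t => rfl
  obtain ⟨r, Ψ, hr, hΨ, hΨU, hprop⟩ := exists_smooth_exponential_of_contDiffOn hU hB hx₀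
  -- For t ≠ 0 the radial derivative is divided by t; at t = 0 the first-order expansion of Ψ is
  -- used.
  have hflow : ∀ z t, (z, t) ∈ ball ((x₀, 0) : Pt × ℝ) r →
      fderiv ℝ Ψ (z, t) (0, 1) = u (Ψ (z, t)) := by
    intro z t h
    rcases eq_or_ne t 0 with rfl | ht
    · rw [(hprop z 0 h).2.2, (hprop z 0 h).2.1, zero_add, hB1, one_smul]
    · have h1 := (hprop z t h).1
      have h2 : ((0 : Pt), t) = t • ((0 : Pt), (1 : ℝ)) := by simp
      rw [h2, map_smul, hB1] at h1
      exact smul_right_injective Pt ht h1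
  let coord : Pt →L[ℝ] ℝ := ContinuousLinearMap.proj k
  let P : Pt →L[ℝ] Pt := ContinuousLinearMap.id ℝ Pt - coord.smulRight (Pi.single k 1)
  have hP : ∀ w, P w = w - w k • Pi.single k 1 := fun w => rfl
  -- This is a flow box: the k-th coordinate is the time along u, and the others label points of a
  -- hyperplane transverse to u. In the inverse chart the other three coordinates are the
  -- invariants.
  let ι : Pt → Pt × ℝ := fun w => (x₀ + P w, coord w)
  let ι' : Pt →L[ℝ] Pt × ℝ := P.prod coord
  have hι' : ∀ w, HasFDerivAt ι ι' w := fun w =>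
    (P.hasFDerivAt.const_add x₀).prodMk coord.hasFDerivAt
  have hι : ContDiff ℝ ∞ ι := (contDiff_const.add P.contDiff).prodMk coord.contDiff
  let D : Set Pt := ι ⁻¹' ball (x₀, 0) r
  have hD : IsOpen D := isOpen_ball.preimage hι.continuous
  let K : Pt → Pt := fun w => Ψ (ι w)
  have hK : ContDiffOn ℝ ∞ K D := hΨ.comp hι.contDiffOn fun w hw => hw
  have hKd : ∀ w ∈ D, HasFDerivAt K ((fderiv ℝ Ψ (ι w)).comp ι') w := fun w hw =>
    (((hΨ.contDiffAt (isOpen_ball.mem_nhds hw)).differentiableAt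
      (by simp)).hasFDerivAt).comp w (hι' w)
  have hι0 : ι 0 = (x₀, 0) := by simp [ι]
  have h0D : (0 : Pt) ∈ D := by
    change ι 0 ∈ ball _ _
    rw [hι0]
    exact mem_ball_self hr
  have hK0 : K 0 = x₀ := by
    change Ψ (ι 0) = x₀
    rw [hι0]
    exact (hprop x₀ 0 (mem_ball_self hr)).2.1
  have hcomp : ∀ h, (fderiv ℝ Ψ (ι 0)).comp ι' h = P h + h k • u x₀ := by
    intro h
    rw [hι0]
    change fderiv ℝ Ψ (x₀, 0) (P h, h k) = _
    rw [(hprop x₀ 0 (mem_ball_self hr)).2.2, hB1]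
  -- P produces no k-th component while u has a nonzero one, so the time component is recovered from
  -- the k-th entry.
  have hinj : Function.Injective ((fderiv ℝ Ψ (ι 0)).comp ι') := by
    rw [injective_iff_map_eq_zero]
    intro h hh
    rw [hcomp, hP] at hh
    have h1 : h k = 0 := by
      have := congrFun hh k
      simp only [Pi.add_apply, Pi.sub_apply, Pi.smul_apply, Pi.single_eq_same, smul_eq_mul,
        mul_one, sub_self, zero_add, Pi.zero_apply] at this
      exact (mul_eq_zero.1 this).resolve_right hk
    rwa [h1, zero_smul, zero_smul, sub_zero, add_zero] at hh
  obtain ⟨f', hf'⟩ := exists_continuousLinearEquiv_of_injective _ hinj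
  obtain ⟨e, h0, heD, hcoe, hsm⟩ := exists_smooth_openPartialHomeomorph hD hK h0D f' (by
    rw [hf']
    exact hKd 0 h0D)
  have hback : ∀ x ∈ e.target, e.symm x ∈ D ∧ K (e.symm x) = x := fun x hx =>
    ⟨heD (e.map_target hx), by rw [← hcoe, e.right_inv hx]⟩
  have hfd : ∀ x ∈ e.target, ∀ m : Fin 3, ∀ h, fderiv ℝ (fun y => e.symm y (k.succAbove m)) x
      (fderiv ℝ K (e.symm x) h) = h (k.succAbove m) := by
    intro x hx m h
    have h1 := fderiv_symm_fderiv e hcoe (hK.mono heD) hsm (e.map_target hx) h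
    rw [(hback x hx).2] at h1
    have h2 : HasFDerivAt (fun y => e.symm y (k.succAbove m))
        ((ContinuousLinearMap.proj (R := ℝ) (φ := fun _ : Fin 4 => ℝ) (k.succAbove m)).comp
          (fderiv ℝ e.symm x)) x :=
      (ContinuousLinearMap.proj (R := ℝ) (φ := fun _ : Fin 4 => ℝ)
        (k.succAbove m)).hasFDerivAt.comp x ((hsm.contDiffAt
          (e.open_target.mem_nhds hx)).differentiableAt (by simp)).hasFDerivAt
    rw [h2.fderiv]
    exact congrFun h1 _
  refine ⟨e.target, fun x m => e.symm x (k.succAbove m), e.open_target, ?_, ?_, ?_, ?_, ?_⟩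
  · have := e.map_source h0
    rwa [hcoe, hK0] at this
  · intro x hx
    rw [← (hback x hx).2]
    exact hΨU (hback x hx).1
  · exact fun m => contDiffOn_pi.1 hsm _
  · intro x hx m
    rw [dot_eq_fderiv]
    have h1 : fderiv ℝ K (e.symm x) (Pi.single k 1) = u x := by
      rw [(hKd _ (hback x hx).1).fderiv]
      have h2 : ι' (Pi.single k 1) = (0, 1) := by
        refine Prod.ext ?_ ?_
        · change P _ = 0
          rw [hP]
          simp
        · exact Pi.single_eq_same k _
      rw [ContinuousLinearMap.comp_apply, h2]
      have h3 := hflow _ _ (hback x hx).1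
      rw [show Ψ ((ι (e.symm x)).1, (ι (e.symm x)).2) = x from (hback x hx).2] at h3
      exact h3
    rw [← h1, hfd x hx]
    exact Pi.single_eq_of_ne (Fin.succAbove_ne k m) _
  · intro x hx
    rw [Fintype.linearIndependent_iff]
    intro c hc m
    have h1 : ∀ v : Pt, ∑ m, c m * fderiv ℝ (fun y => e.symm y (k.succAbove m)) x v = 0 := by
      intro v
      simp only [fderiv_eq_sum_pd, Finset.mul_sum]
      rw [Finset.sum_comm]
      refine Finset.sum_eq_zero fun i _ => ?_
      have h2 := congrFun hc i
      rw [Finset.sum_apply] at h2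
      simp only [Pi.smul_apply, smul_eq_mul, grad, Pi.zero_apply] at h2
      rw [← mul_zero (v i), ← h2, Finset.mul_sum]
      exact Finset.sum_congr rfl fun _ _ => by ring
    have h3 := h1 (fderiv ℝ K (e.symm x) (Pi.single (k.succAbove m) 1))
    simp only [hfd x hx] at h3
    rw [Finset.sum_eq_single m] at h3
    · simpa using h3
    · intro m' _ hm'
      rw [Pi.single_eq_of_ne (fun h => hm' (Fin.succAbove_right_injective h)), mul_zero]
    · simp

/-- An invariant function is locally a function of three independent invariants. -/
theorem exists_eq_comp_invariants {u : Field1} {W : Set Pt} (hW : IsOpen W)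
    {φ : Pt → Fin 3 → ℝ} (hφ : IsInvariants W u φ) (hne : ∀ x ∈ W, u x ≠ 0) {h : Pt → ℝ}
    (hh : Smooth W h) (hdot : ∀ x ∈ W, dot u h x = 0) {x₀ : Pt} (hx₀ : x₀ ∈ W) :
    ∃ (W' : Set Pt) (R : (Fin 3 → ℝ) → ℝ), IsOpen W' ∧ x₀ ∈ W' ∧ W' ⊆ W ∧
      ∀ x ∈ W', ContDiffAt ℝ ∞ R (φ x) ∧ h x = R (φ x) := by
  have hcφ : ContDiffOn ℝ ∞ φ W := contDiffOn_pi.2 hφ.smooth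
  have hfd : ∀ x ∈ W, ∀ v m, fderiv ℝ φ x v m = fderiv ℝ (fun y => φ y m) x v := by
    intro x hx v m
    have h1 : HasFDerivAt φ (fderiv ℝ φ x) x :=
      ((hcφ.contDiffAt (hW.mem_nhds hx)).differentiableAt (by simp)).hasFDerivAt
    rw [(hasFDerivAt_pi'.1 h1 m).fderiv]
    rfl
  -- A nonzero functional vanishing on the range would be a linear relation between the gradients of
  -- the invariants.
  have hsurj : ∀ x ∈ W, Function.Surjective (fderiv ℝ φ x) := by
    intro x hx
    have h1 : (fderiv ℝ φ x : Pt →ₗ[ℝ] (Fin 3 → ℝ)).range = ⊤ := by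
      by_contra hlt
      obtain ⟨ℓ, hℓ, hle⟩ := Submodule.exists_le_ker_of_lt_top _ (lt_top_iff_ne_top.2 hlt)
      refine hℓ ?_
      have h2 : ∀ m, ℓ (Pi.single m 1) = 0 := by
        refine Fintype.linearIndependent_iff.1 (hφ.independent x hx) _ ?_
        ext i
        have h3 : ℓ (fderiv ℝ φ x (Pi.single i 1)) = 0 :=
          hle ⟨Pi.single i 1, rfl⟩
        rw [LinearMap.pi_apply_eq_sum_univ ℓ] at h3
        rw [Finset.sum_apply, Pi.zero_apply, ← h3]
        refine Finset.sum_congr rfl fun m _ => ?_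
        have h4 : (fun j => if m = j then (1 : ℝ) else 0) = Pi.single m 1 := by
          funext j
          simp [Pi.single_apply, eq_comm]
        rw [h4, hfd x hx, Pi.smul_apply, smul_eq_mul, smul_eq_mul, mul_comm]
        rfl
      refine LinearMap.pi_ext' fun m => LinearMap.ext_ring ?_
      simpa using h2 m
    exact LinearMap.range_eq_top.1 h1
  have hu0 : ∀ x ∈ W, fderiv ℝ φ x (u x) = 0 := by
    intro x hx
    ext m
    rw [hfd x hx, ← dot_eq_fderiv, hφ.invariant x hx m]
    rfl
  obtain ⟨W', ρ, H, hW', hxW', hWW', hH, hval⟩ := exists_eq_comp_of_fderiv_eq_zero hW hcφ hh hx₀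
    (hsurj x₀ hx₀) (by
      intro x hx v hv
      -- The kernel has dimension 4 - 3 = 1 and contains u ≠ 0, so it is the line of u, on which dh
      -- vanishes.
      have h1 := LinearMap.finrank_range_add_finrank_ker
        (fderiv ℝ φ x : Pt →ₗ[ℝ] (Fin 3 → ℝ))
      rw [LinearMap.range_eq_top.2 (hsurj x hx), finrank_top] at h1
      simp only [Module.finrank_fintype_fun_eq_card, Fintype.card_fin] at h1
      have h2 : Module.finrank ℝ (fderiv ℝ φ x : Pt →ₗ[ℝ] (Fin 3 → ℝ)).ker = 1 := by omega
      obtain ⟨c, hc⟩ := (finrank_eq_one_iff_of_nonzero'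
        (⟨u x, hu0 x hx⟩ : (fderiv ℝ φ x : Pt →ₗ[ℝ] (Fin 3 → ℝ)).ker) (by
          intro h
          exact hne x hx (congrArg Subtype.val h))).1 h2 ⟨v, hv⟩
      have h3 : c • u x = v := congrArg Subtype.val hc
      rw [← h3, map_smul, ← dot_eq_fderiv, hdot x hx, smul_zero])
  exact ⟨W', H, hW', hxW', hWW', fun x hx =>
    ⟨hH.contDiffAt (isOpen_ball.mem_nhds (hval x hx).1), (hval x hx).2⟩⟩

/-- A function whose differential is proportional to `dα ≠ 0` is locally a function of `α`. -/
theorem exists_eq_comp_scalar {W : Set Pt} (hW : IsOpen W) {α h k : Pt → ℝ} (hα : Smooth W α)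
    (hh : Smooth W h) (hprop : ∀ x ∈ W, ∀ i, pd h i x = k x * pd α i x) {x₀ : Pt} (hx₀ : x₀ ∈ W)
    {i₀ : Fin 4} (hne : pd α i₀ x₀ ≠ 0) :
    ∃ (W' : Set Pt) (ρ : ℝ) (H : ℝ → ℝ), IsOpen W' ∧ x₀ ∈ W' ∧ W' ⊆ W ∧
      ContDiffOn ℝ ∞ H (ball (α x₀) ρ) ∧ ∀ x ∈ W', α x ∈ ball (α x₀) ρ ∧ h x = H (α x) := by
  refine exists_eq_comp_of_fderiv_eq_zero hW hα hh hx₀ ?_ ?_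
  · intro c
    refine ⟨(c / pd α i₀ x₀) • Pi.single i₀ 1, ?_⟩
    rw [map_smul, smul_eq_mul]
    exact div_mul_cancel₀ _ hne
  · intro x hx v hv
    rw [fderiv_eq_sum_pd] at hv ⊢
    rw [← mul_zero (k x), ← hv, Finset.mul_sum]
    exact Finset.sum_congr rfl fun i _ => by rw [hprop x hx i]; ring

end Invariants

/-! ## Alternating forms and the Hodge dual at a point -/

section Hodge

theorem det_four (M : Matrix (Fin 4) (Fin 4) ℝ) : M.det =
    M 0 0 * M 1 1 * M 2 2 * M 3 3 - M 0 0 * M 1 1 * M 2 3 * M 3 2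
  - M 0 0 * M 1 2 * M 2 1 * M 3 3 + M 0 0 * M 1 2 * M 2 3 * M 3 1
  + M 0 0 * M 1 3 * M 2 1 * M 3 2 - M 0 0 * M 1 3 * M 2 2 * M 3 1
  - M 0 1 * M 1 0 * M 2 2 * M 3 3 + M 0 1 * M 1 0 * M 2 3 * M 3 2
  + M 0 1 * M 1 2 * M 2 0 * M 3 3 - M 0 1 * M 1 2 * M 2 3 * M 3 0
  - M 0 1 * M 1 3 * M 2 0 * M 3 2 + M 0 1 * M 1 3 * M 2 2 * M 3 0
  + M 0 2 * M 1 0 * M 2 1 * M 3 3 - M 0 2 * M 1 0 * M 2 3 * M 3 1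
  - M 0 2 * M 1 1 * M 2 0 * M 3 3 + M 0 2 * M 1 1 * M 2 3 * M 3 0
  + M 0 2 * M 1 3 * M 2 0 * M 3 1 - M 0 2 * M 1 3 * M 2 1 * M 3 0
  - M 0 3 * M 1 0 * M 2 1 * M 3 2 + M 0 3 * M 1 0 * M 2 2 * M 3 1
  + M 0 3 * M 1 1 * M 2 0 * M 3 2 - M 0 3 * M 1 1 * M 2 2 * M 3 0
  - M 0 3 * M 1 2 * M 2 0 * M 3 1 + M 0 3 * M 1 2 * M 2 1 * M 3 0 := by
  rw [Matrix.det_succ_row_zero]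
  simp [Matrix.det_fin_three, Fin.sum_univ_succ, Fin.succAbove]
  ring

/-- Kronecker symbol. -/
def kron (a b : Fin 4) : ℝ := if a = b then 1 else 0

theorem leviCivita_eq_det (i j k l : Fin 4) :
    leviCivita i j k l = (Matrix.of fun r c : Fin 4 => kron (![i, j, k, l] r) c).det := rfl

theorem sum_kron (T : Fin 4 → Fin 4 → Fin 4 → Fin 4 → ℝ) (a b c d : Fin 4) :
    ∑ i, ∑ j, ∑ k, ∑ l, kron i a * kron j b * kron k c * kron l d * T i j k l =
      T a b c d := by
  simp [kron]

theorem sum_leviCivita (T : Fin 4 → Fin 4 → Fin 4 → Fin 4 → ℝ) :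
    ∑ i, ∑ j, ∑ k, ∑ l, leviCivita i j k l * T i j k l =
    T 0 1 2 3 - T 0 1 3 2 - T 0 2 1 3 + T 0 2 3 1 + T 0 3 1 2 - T 0 3 2 1
  - T 1 0 2 3 + T 1 0 3 2 + T 1 2 0 3 - T 1 2 3 0 - T 1 3 0 2 + T 1 3 2 0
  + T 2 0 1 3 - T 2 0 3 1 - T 2 1 0 3 + T 2 1 3 0 + T 2 3 0 1 - T 2 3 1 0
  - T 3 0 1 2 + T 3 0 2 1 + T 3 1 0 2 - T 3 1 2 0 - T 3 2 0 1 + T 3 2 1 0 := by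
  simp only [leviCivita_eq_det, det_four, Matrix.of_apply, Matrix.cons_val_zero,
    Matrix.cons_val_one, Matrix.cons_val]
  simp only [sub_mul, add_mul, Finset.sum_add_distrib, Finset.sum_sub_distrib]
  simp only [sum_kron]

/-- The sum is the Leibniz expansion of the determinant of a product: the matrix of unit rows
numbered p, q, r, s times the transpose of h. -/
theorem sum_leviCivita_mul (h : Fin 4 → Fin 4 → ℝ) (p q r s : Fin 4) :
    ∑ i, ∑ j, ∑ k, ∑ l, leviCivita i j k l * (h i p * h j q * h k r * h l s) =
      (Matrix.of h).det * leviCivita p q r s := by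
  have e : ∀ a b, ((Matrix.of fun r' c : Fin 4 => kron (![p, q, r, s] r') c) *
      (Matrix.of h).transpose) a b = h b (![p, q, r, s] a) := by
    intro a b
    simp [Matrix.mul_apply, kron]
  rw [sum_leviCivita, leviCivita_eq_det, mul_comm (Matrix.det _),
    ← Matrix.det_transpose (Matrix.of h), ← Matrix.det_mul, det_four]
  simp only [e, Matrix.cons_val_zero, Matrix.cons_val_one, Matrix.cons_val]

theorem sum_quad (F : Fin 4 → Fin 4 → Fin 4 → Fin 4 → ℝ) : ∑ i, ∑ j, ∑ k, ∑ l, F i j k l =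
    ∑ p : Fin 4 × Fin 4 × Fin 4 × Fin 4, F p.1 p.2.1 p.2.2.1 p.2.2.2 := by
  simp only [Fintype.sum_prod_type]

theorem sum_leviCivita_raise (h : Fin 4 → Fin 4 → ℝ)
    (Z : Fin 4 → Fin 4 → Fin 4 → Fin 4 → ℝ) :
    ∑ i, ∑ j, ∑ k, ∑ l, leviCivita i j k l *
      (∑ p, ∑ q, ∑ r, ∑ s, h i p * h j q * h k r * h l s * Z p q r s) =
      (Matrix.of h).det * ∑ p, ∑ q, ∑ r, ∑ s, leviCivita p q r s * Z p q r s := by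
  simp only [sum_quad, Finset.mul_sum]
  rw [Finset.sum_comm]
  refine Finset.sum_congr rfl fun p _ => ?_
  rw [← mul_assoc, ← sum_leviCivita_mul, sum_quad, Finset.sum_mul]
  exact Finset.sum_congr rfl fun _ _ => by ring

/-- The contraction of a three-form and a one-form with the Levi-Civita symbol. -/
def vol (T : Fin 4 → Fin 4 → Fin 4 → ℝ) (ξ : Fin 4 → ℝ) : ℝ :=
  ∑ i, ∑ j, ∑ k, ∑ l, leviCivita i j k l * (T i j k * ξ l)

/-- Raising all four indices against the Levi-Civita symbol costs only a factor det g⁻¹. The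
remaining prefactor is common to all Hodge duals at the point and nonzero, so it drops out of every
quotient and every vanishing condition. -/
theorem ip_hodge3 (g : MetricField) (T : Field3) (ξ : Field1) (x : Pt) :
    ip g (hodge3 g T) ξ x =
      (1 / 6) * Real.sqrt |(g x).det| * (g x)⁻¹.det * vol (T x) (ξ x) := by
  have h := sum_leviCivita_raise (fun i j => (g x)⁻¹ i j) (fun p q r s => T x p q r * ξ x s)
  change _ = (g x)⁻¹.det * vol (T x) (ξ x) at h
  rw [mul_assoc, ← h]
  have h1 : ∀ i j k l : Fin 4, (∑ p, ∑ q, ∑ r, ∑ s, (g x)⁻¹ i p * (g x)⁻¹ j q * (g x)⁻¹ k r *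
      (g x)⁻¹ l s * (T x p q r * ξ x s)) = (∑ p, ∑ q, ∑ r, (g x)⁻¹ i p * (g x)⁻¹ j q *
      (g x)⁻¹ k r * T x p q r) * ∑ s, (g x)⁻¹ l s * ξ x s := by
    intro i j k l
    simp only [Finset.sum_mul]
    refine Finset.sum_congr rfl fun p _ => Finset.sum_congr rfl fun q _ =>
      Finset.sum_congr rfl fun r _ => ?_
    rw [Finset.mul_sum]
    exact Finset.sum_congr rfl fun s _ => by ring
  simp only [h1]
  generalize hS : (fun i j k => ∑ p, ∑ q, ∑ r, (g x)⁻¹ i p * (g x)⁻¹ j q *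
      (g x)⁻¹ k r * T x p q r) = S
  have hS' : ∀ i j k, (∑ p, ∑ q, ∑ r, (g x)⁻¹ i p * (g x)⁻¹ j q *
      (g x)⁻¹ k r * T x p q r) = S i j k := fun i j k => by rw [← hS]
  simp only [ip, hodge3, hS']
  have h2 : ∀ l, ∑ j, (g x)⁻¹ l j * (1 / 6 * Real.sqrt |(g x).det| *
      ∑ i, ∑ j, ∑ k, leviCivita i j k l * S i j k) * ξ x j =
      1 / 6 * Real.sqrt |(g x).det| * ((∑ i, ∑ j, ∑ k, leviCivita i j k l * S i j k) *
        ∑ s, (g x)⁻¹ l s * ξ x s) := by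
    intro l
    generalize (∑ i, ∑ j, ∑ k, leviCivita i j k l * S i j k) = c
    rw [Finset.mul_sum, Finset.mul_sum]
    exact Finset.sum_congr rfl fun s _ => by ring
  simp only [h2]
  rw [← Finset.mul_sum]
  congr 1
  simp only [Finset.sum_mul]
  rw [Finset.sum_comm]
  refine Finset.sum_congr rfl fun i _ => ?_
  rw [Finset.sum_comm]
  refine Finset.sum_congr rfl fun j _ => ?_
  rw [Finset.sum_comm]
  exact Finset.sum_congr rfl fun k _ => Finset.sum_congr rfl fun l _ => by ring

/-- Total antisymmetry of a covariant tensor of rank three. -/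
def IsAlternating3 (T : Fin 4 → Fin 4 → Fin 4 → ℝ) : Prop :=
  ∀ i j k, T i j k = -T j i k ∧ T i j k = -T i k j

theorem IsAlternating3.vol_eq {T : Fin 4 → Fin 4 → Fin 4 → ℝ} (hT : IsAlternating3 T)
    (ξ : Fin 4 → ℝ) :
    vol T ξ = 6 * (T 0 1 2 * ξ 3 - T 0 1 3 * ξ 2 + T 0 2 3 * ξ 1 - T 1 2 3 * ξ 0) := by
  rw [vol, sum_leviCivita]
  have h : ∀ i j k, T i k j = -T i j k ∧ T j i k = -T i j k ∧ T j k i = T i j k ∧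
      T k i j = T i j k ∧ T k j i = -T i j k := by
    intro i j k
    have h1 := (hT i j k).1
    have h2 := (hT i j k).2
    have h3 := (hT j i k).2
    have h4 := (hT i k j).1
    have h5 := (hT k j i).1
    refine ⟨by linarith, by linarith, by linarith, by linarith, by linarith⟩
  obtain ⟨a1, a2, a3, a4, a5⟩ := h 0 1 2
  obtain ⟨b1, b2, b3, b4, b5⟩ := h 0 1 3
  obtain ⟨c1, c2, c3, c4, c5⟩ := h 0 2 3
  obtain ⟨d1, d2, d3, d4, d5⟩ := h 1 2 3
  rw [a1, a2, a3, a4, a5, b1, b2, b3, b4, b5, c1, c2, c3, c4, c5, d1, d2, d3, d4, d5]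
  ring

/-- Contractions with the four unit covectors are, up to sign and the factor 6, the four independent
components. -/
theorem IsAlternating3.eq_zero {T : Fin 4 → Fin 4 → Fin 4 → ℝ} (hT : IsAlternating3 T)
    (h : ∀ ξ, vol T ξ = 0) (i j k : Fin 4) : T i j k = 0 := by
  have h0 := h (Pi.single 0 1)
  have h1 := h (Pi.single 1 1)
  have h2 := h (Pi.single 2 1)
  have h3 := h (Pi.single 3 1)
  rw [hT.vol_eq] at h0 h1 h2 h3
  simp at h0 h1 h2 h3
  have e1 := (hT i j k).1
  have e2 := (hT i j k).2
  have e3 := (hT j i k).2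
  have e4 := (hT i k j).1
  have e5 := (hT k j i).1
  fin_cases i <;> fin_cases j <;> fin_cases k <;>
    simp only [Fin.zero_eta, Fin.mk_one, Fin.reduceFinMk] at * <;> linarith

/-- A three-form and a one-form annihilated by the same nonzero vector have zero contraction. -/
theorem IsAlternating3.vol_eq_zero {T : Fin 4 → Fin 4 → Fin 4 → ℝ} (hT : IsAlternating3 T)
    {U ξ : Fin 4 → ℝ} (hU : U ≠ 0) (hTU : ∀ j k, ∑ i, U i * T i j k = 0)
    (hξ : ∑ i, ξ i * U i = 0) : vol T ξ = 0 := by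
  rw [hT.vol_eq]
  have hd : ∀ i k, T i i k = 0 := fun i k => by linarith [(hT i i k).1]
  have h01 := hTU 0 1
  have h02 := hTU 0 2
  have h03 := hTU 0 3
  have h12 := hTU 1 2
  have h13 := hTU 1 3
  have h23 := hTU 2 3
  have hd' : ∀ i k, T i k i = 0 := fun i k => by linarith [(hT i k i).2, hd i k]
  simp only [Fin.sum_univ_four, hd, hd'] at h01 h02 h03 h12 h13 h23 hξ
  have e1 : T 2 0 1 = T 0 1 2 := by linarith [(hT 2 0 1).1, (hT 0 2 1).2]
  have e2 : T 3 0 1 = T 0 1 3 := by linarith [(hT 3 0 1).1, (hT 0 3 1).2]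
  have e3 : T 3 0 2 = T 0 2 3 := by linarith [(hT 3 0 2).1, (hT 0 3 2).2]
  have e4 : T 3 1 2 = T 1 2 3 := by linarith [(hT 3 1 2).1, (hT 1 3 2).2]
  have e5 : T 1 0 2 = -T 0 1 2 := (hT 1 0 2).1
  have e6 : T 1 0 3 = -T 0 1 3 := (hT 1 0 3).1
  have e7 : T 2 0 3 = -T 0 2 3 := (hT 2 0 3).1
  have e8 : T 2 1 3 = -T 1 2 3 := (hT 2 1 3).1
  rw [e1, e2] at h01
  rw [e5, e3] at h02
  rw [e6, e7] at h03
  rw [e4] at h12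
  rw [e8] at h13
  set S := T 0 1 2 * ξ 3 - T 0 1 3 * ξ 2 + T 0 2 3 * ξ 1 - T 1 2 3 * ξ 0
  -- S is the component of the four-form T ∧ ξ. The interior product of U with T ∧ ξ vanishes, and
  -- its components are the products U m * S up to sign.
  have hS : ∀ m, U m * S = 0 := by
    intro m
    fin_cases m <;> simp only [Fin.zero_eta, Fin.mk_one, Fin.reduceFinMk, S]
    · linear_combination ξ 3 * h12 - ξ 2 * h13 + ξ 1 * h23 - T 1 2 3 * hξ
    · linear_combination (-ξ 3) * h02 + ξ 2 * h03 - ξ 0 * h23 + T 0 2 3 * hξ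
    · linear_combination ξ 3 * h01 - ξ 1 * h03 + ξ 0 * h13 - T 0 1 3 * hξ
    · linear_combination (-ξ 2) * h01 + ξ 1 * h02 - ξ 0 * h12 + T 0 1 2 * hξ
  obtain ⟨m, hm⟩ := Function.ne_iff.1 hU
  rw [(mul_eq_zero.1 (hS m)).resolve_left hm, mul_zero]

theorem isAlternating3_wedge12 {ξ : Field1} {F : Field2} {x : Pt}
    (hF : ∀ i j, F x i j = -F x j i) : IsAlternating3 (wedge12 ξ F x) := by
  intro i j k
  simp only [wedge12]
  rw [hF k j, hF j i, hF i k]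
  constructor <;> ring

theorem extD_antisymm (ξ : Field1) (x : Pt) (i j : Fin 4) : extD ξ x i j = -extD ξ x j i := by
  simp only [extD]
  ring

theorem isAlternating3_wedge12_extD (ξ η : Field1) (x : Pt) :
    IsAlternating3 (wedge12 ξ (extD η) x) := isAlternating3_wedge12 (extD_antisymm η x)

theorem vol_add (T T' : Fin 4 → Fin 4 → Fin 4 → ℝ) (ξ : Fin 4 → ℝ) (c c' : ℝ) :
    vol (fun i j k => c * T i j k + c' * T' i j k) ξ = c * vol T ξ + c' * vol T' ξ := by
  simp only [vol, sum_leviCivita]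
  ring

end Hodge

/-! ## The metric at a point -/

section MetricAlgebra

variable {U : Set Pt} {g : MetricField} {u : Field1} {x : Pt}

theorem IsLorentzMetric.det_ne_zero (hg : IsLorentzMetric U g) (hx : x ∈ U) :
    (g x).det ≠ 0 := by
  obtain ⟨P, -, h⟩ := hg.signature x hx
  intro h0
  have := congrArg Matrix.det h
  rw [Matrix.det_mul, Matrix.det_mul, h0, mul_zero, zero_mul, Matrix.det_diagonal] at this
  simp [Fin.prod_univ_four] at this

theorem IsLorentzMetric.inv_mul (hg : IsLorentzMetric U g) (hx : x ∈ U) :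
    (g x)⁻¹ * g x = 1 :=
  Matrix.nonsing_inv_mul _ (isUnit_iff_ne_zero.2 (hg.det_ne_zero hx))

theorem IsLorentzMetric.inv_symm (hg : IsLorentzMetric U g) (hx : x ∈ U) (i j : Fin 4) :
    (g x)⁻¹ i j = (g x)⁻¹ j i := by
  have h : ((g x)⁻¹).transpose = (g x)⁻¹ := by
    rw [Matrix.transpose_nonsing_inv, hg.symm x hx]
  exact (congrFun (congrFun h j) i)

theorem ip_comm (hg : IsLorentzMetric U g) (hx : x ∈ U) (ξ η : Field1) :
    ip g ξ η x = ip g η ξ x := by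
  simp only [ip]
  rw [Finset.sum_comm]
  exact Finset.sum_congr rfl fun i _ => Finset.sum_congr rfl fun j _ => by
    rw [hg.inv_symm hx j i]
    ring

theorem ip_lower (hg : IsLorentzMetric U g) (hx : x ∈ U) (ξ u : Field1) :
    ip g ξ (lower g u) x = ∑ i, ξ x i * u x i := by
  have h : (g x)⁻¹.mulVec ((g x).mulVec (u x)) = u x := by
    rw [Matrix.mulVec_mulVec, hg.inv_mul hx, Matrix.one_mulVec]
  simp only [ip]
  refine Finset.sum_congr rfl fun i _ => ?_
  rw [← congrFun h i, Matrix.mulVec, dotProduct, Finset.mul_sum]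
  refine Finset.sum_congr rfl fun j _ => ?_
  change (g x)⁻¹ i j * ξ x i * (g x).mulVec (u x) j = _
  ring

theorem sum_raise_mul (ξ η : Field1) (x : Pt) :
    ∑ i, raise g ξ x i * η x i = ip g η ξ x := by
  simp only [raise, ip, Finset.sum_mul]
  exact Finset.sum_congr rfl fun i _ => Finset.sum_congr rfl fun j _ => by ring

/-- With S the square of the spatial part of a, Cauchy–Schwarz for the spatial parts gives a₀²b₀² ≤
S(b₀² - 1), that is S ≤ b₀²(S - a₀²). This is positive unless S = 0, in which case a₀b₀ = 0 and b₀²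
≥ 1 force a = 0. -/
theorem lorentz_orthogonal_pos {a0 a1 a2 a3 b0 b1 b2 b3 : ℝ}
    (hb : -b0 ^ 2 + b1 ^ 2 + b2 ^ 2 + b3 ^ 2 = -1)
    (hab : -(a0 * b0) + a1 * b1 + a2 * b2 + a3 * b3 = 0)
    (hne : ¬(a0 = 0 ∧ a1 = 0 ∧ a2 = 0 ∧ a3 = 0)) :
    0 < -a0 ^ 2 + a1 ^ 2 + a2 ^ 2 + a3 ^ 2 := by
  have hCS : (a1 * b1 + a2 * b2 + a3 * b3) ^ 2 ≤
      (a1 ^ 2 + a2 ^ 2 + a3 ^ 2) * (b1 ^ 2 + b2 ^ 2 + b3 ^ 2) := by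
    nlinarith [sq_nonneg (a1 * b2 - a2 * b1), sq_nonneg (a1 * b3 - a3 * b1),
      sq_nonneg (a2 * b3 - a3 * b2)]
  have h1 : a1 * b1 + a2 * b2 + a3 * b3 = a0 * b0 := by linarith
  have h2 : b1 ^ 2 + b2 ^ 2 + b3 ^ 2 = b0 ^ 2 - 1 := by linarith
  rw [h1, h2] at hCS
  set S := a1 ^ 2 + a2 ^ 2 + a3 ^ 2 with hS
  have hb0 : 1 ≤ b0 ^ 2 := by nlinarith [sq_nonneg b1, sq_nonneg b2, sq_nonneg b3]
  have hkey : S ≤ b0 ^ 2 * (S - a0 ^ 2) := by nlinarith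
  have hS0 : 0 ≤ S := by positivity
  rcases hS0.eq_or_lt with h0 | hpos
  · exfalso
    have e1 : a1 = 0 := by nlinarith [sq_nonneg a1, sq_nonneg a2, sq_nonneg a3]
    have e2 : a2 = 0 := by nlinarith [sq_nonneg a1, sq_nonneg a2, sq_nonneg a3]
    have e3 : a3 = 0 := by nlinarith [sq_nonneg a1, sq_nonneg a2, sq_nonneg a3]
    have e0 : a0 = 0 := by
      rw [e1, e2, e3] at h1
      have h5 : a0 * b0 = 0 := by linarith
      rcases mul_eq_zero.1 h5 with h | h
      · exact h
      · rw [h] at hb0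
        norm_num at hb0
    exact hne ⟨e0, e1, e2, e3⟩
  · have h3 : 0 < b0 ^ 2 * (S - a0 ^ 2) := hpos.trans_le hkey
    have h4 : 0 < S - a0 ^ 2 := (mul_pos_iff_of_pos_left (by linarith)).1 h3
    linarith

/-- A nonzero covector orthogonal to a unit time-like vector is space-like. -/
theorem ip_pos (hg : IsLorentzMetric U g) (hu : IsUnitTimelike U g u) (hx : x ∈ U) {ξ : Field1}
    (hξ : ξ x ≠ 0) (hξu : ∑ i, ξ x i * u x i = 0) : 0 < ip g ξ ξ x := by
  obtain ⟨P, hP, h⟩ := hg.signature x hx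
  have hPt : IsUnit P.transpose.det := by rwa [Matrix.det_transpose]
  set D : Matrix (Fin 4) (Fin 4) ℝ := Matrix.diagonal ![-1, 1, 1, 1] with hD
  have hDD : D * D = 1 := by
    rw [hD, Matrix.diagonal_mul_diagonal, ← Matrix.diagonal_one]
    congr 1
    funext i
    fin_cases i <;> simp
  -- The columns of P form an orthonormal frame, so the metric product becomes the Minkowski product
  -- of the frame components.
  have hinv : (g x)⁻¹ = P * D * P.transpose := by
    refine Matrix.inv_eq_left_inv ?_
    have h1 : P * D * P.transpose * g x * P = P := by
      rw [Matrix.mul_assoc (P * D), Matrix.mul_assoc (P * D), h, Matrix.mul_assoc P, hDD,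
        Matrix.mul_one]
    calc P * D * P.transpose * g x = P * D * P.transpose * g x * P * P⁻¹ := by
          rw [Matrix.mul_assoc _ P, Matrix.mul_nonsing_inv _ hP, Matrix.mul_one]
      _ = 1 := by rw [h1, Matrix.mul_nonsing_inv _ hP]
  have hip : ∀ α β : Field1, ip g α β x =
      -((P.transpose.mulVec (α x)) 0 * (P.transpose.mulVec (β x)) 0) +
      (P.transpose.mulVec (α x)) 1 * (P.transpose.mulVec (β x)) 1 +
      (P.transpose.mulVec (α x)) 2 * (P.transpose.mulVec (β x)) 2 +
      (P.transpose.mulVec (α x)) 3 * (P.transpose.mulVec (β x)) 3 := by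
    intro α β
    have h1 : ip g α β x = dotProduct (α x) ((g x)⁻¹.mulVec (β x)) := by
      simp only [ip, dotProduct, Matrix.mulVec, Finset.mul_sum]
      exact Finset.sum_congr rfl fun i _ => Finset.sum_congr rfl fun j _ => by ring
    rw [h1, hinv, ← Matrix.mulVec_mulVec, ← Matrix.mulVec_mulVec, Matrix.dotProduct_mulVec,
      ← Matrix.mulVec_transpose, hD]
    simp only [dotProduct, Matrix.mulVec_diagonal, Fin.sum_univ_four]
    simp
  have huu := hu.unit x hx
  rw [← ip_lower hg hx (lower g u) u, hip] at huu
  rw [← ip_lower hg hx ξ u, hip] at hξu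
  rw [hip]
  have := lorentz_orthogonal_pos (by linear_combination huu) hξu (by
    rintro ⟨h0, h1, h2, h3⟩
    refine hξ ?_
    have hz : P.transpose.mulVec (ξ x) = 0 := by
      funext i
      fin_cases i
      exacts [h0, h1, h2, h3]
    have h5 := congrArg (P.transpose⁻¹.mulVec) hz
    rwa [Matrix.mulVec_mulVec, Matrix.nonsing_inv_mul _ hPt, Matrix.one_mulVec,
      Matrix.mulVec_zero] at h5)
  linarith

theorem ip_hodge3_factor_ne_zero (hg : IsLorentzMetric U g) (hx : x ∈ U) :
    (1 / 6) * Real.sqrt |(g x).det| * (g x)⁻¹.det ≠ 0 := by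
  have h := hg.det_ne_zero hx
  have h1 : (g x)⁻¹.det ≠ 0 := by
    rw [Matrix.det_nonsing_inv, Ring.inverse_eq_inv']
    exact inv_ne_zero h
  have h2 : Real.sqrt |(g x).det| ≠ 0 := (Real.sqrt_pos.2 (abs_pos.2 h)).ne'
  exact mul_ne_zero (mul_ne_zero (by norm_num) h2) h1

theorem eq_zero_of_hodge3_eq_zero (hg : IsLorentzMetric U g) (hx : x ∈ U) {T : Field3}
    (hT : IsAlternating3 (T x)) (h : hodge3 g T x = 0) (i j k : Fin 4) : T x i j k = 0 := by
  refine hT.eq_zero (fun ξ => ?_) i j k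
  have h1 := ip_hodge3 g T (fun _ => ξ) x
  have h2 : ip g (hodge3 g T) (fun _ => ξ) x = 0 := by
    simp [ip, h]
  rw [h2] at h1
  exact (mul_eq_zero.1 h1.symm).resolve_left (ip_hodge3_factor_ne_zero hg hx)

theorem hodge3_eq_zero {T : Field3} (h : ∀ i j k, T x i j k = 0) : hodge3 g T x = 0 := by
  funext l
  simp [hodge3, h]

theorem exists_ne_zero_of_hodge3 {T : Field3} (h : hodge3 g T x ≠ 0) :
    ∃ i j k, T x i j k ≠ 0 := by
  by_contra! hc
  exact h (hodge3_eq_zero hc)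

end MetricAlgebra

/-! ## Smoothness of the concomitants -/

section Smoothness

variable {U : Set Pt} {g : MetricField} {u : Field1}

theorem smooth_det {M : MetricField} (hM : ∀ i j, Smooth U fun x => M x i j) :
    Smooth U fun x => (M x).det := by
  simp only [Matrix.det_apply]
  refine ContDiffOn.sum fun σ _ => ContDiffOn.const_smul _ ?_
  exact contDiffOn_prod fun i _ => hM (σ i) i

theorem IsLorentzMetric.smooth_inv (hg : IsLorentzMetric U g) (i j : Fin 4) :
    Smooth U fun x => (g x)⁻¹ i j := by
  have h1 : Smooth U fun x => ((g x).updateRow j (Pi.single i 1)).det := by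
    refine smooth_det fun k l => ?_
    by_cases hk : k = j
    · subst hk
      simp only [Matrix.updateRow_self]
      exact smooth_const _
    · simp only [Matrix.updateRow_ne hk]
      exact hg.smooth k l
  have h2 := h1.div (smooth_det hg.smooth) fun x hx => hg.det_ne_zero hx
  refine ContDiffOn.congr h2 fun x hx => ?_
  rw [Matrix.inv_def, Matrix.smul_apply, Matrix.adjugate_apply, Ring.inverse_eq_inv', smul_eq_mul,
    div_eq_inv_mul]

theorem smooth_lower (hg : IsLorentzMetric U g) (hu : ∀ i, Smooth U fun x => u x i) (i : Fin 4) :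
    Smooth U fun x => lower g u x i :=
  Smooth.sum fun j => (hg.smooth i j).mul (hu j)

theorem smooth_raise (hg : IsLorentzMetric U g) {ξ : Field1} (hξ : ∀ i, Smooth U fun x => ξ x i)
    (i : Fin 4) : Smooth U fun x => raise g ξ x i :=
  Smooth.sum fun j => (hg.smooth_inv i j).mul (hξ j)

theorem smooth_ip (hg : IsLorentzMetric U g) {ξ η : Field1} (hξ : ∀ i, Smooth U fun x => ξ x i)
    (hη : ∀ i, Smooth U fun x => η x i) : Smooth U (ip g ξ η) :=
  Smooth.sum fun i => Smooth.sum fun j => ((hg.smooth_inv i j).mul (hξ i)).mul (hη j)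

theorem smooth_extD (hU : IsOpen U) {ξ : Field1} (hξ : ∀ i, Smooth U fun x => ξ x i)
    (i j : Fin 4) : Smooth U fun x => extD ξ x i j :=
  ((hξ j).pd hU i).sub ((hξ i).pd hU j)

theorem smooth_interior2 {X : Field1} {F : Field2} (hX : ∀ i, Smooth U fun x => X x i)
    (hF : ∀ i j, Smooth U fun x => F x i j) (j : Fin 4) :
    Smooth U fun x => interior2 X F x j :=
  Smooth.sum fun i => (hX i).mul (hF i j)

theorem smooth_theta (hU : IsOpen U) (hg : IsLorentzMetric U g)
    (hu : ∀ i, Smooth U fun x => u x i) : Smooth U (theta g u) := by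
  have hΓ : ∀ i j, Smooth U fun x => christoffel g x i i j := fun i j =>
    (smooth_const (1 / 2)).mul (Smooth.sum fun l => (hg.smooth_inv i l).mul
      ((((hg.smooth l j).pd hU i).add ((hg.smooth l i).pd hU j)).sub ((hg.smooth i j).pd hU l)))
  exact Smooth.sum fun i => ((hu i).pd hU i).add (Smooth.sum fun j => (hΓ i j).mul (hu j))

theorem smooth_acc (hU : IsOpen U) (hg : IsLorentzMetric U g)
    (hu : ∀ i, Smooth U fun x => u x i) (i : Fin 4) : Smooth U fun x => acc g u x i :=
  smooth_interior2 hu (smooth_extD hU (smooth_lower hg hu)) i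

theorem smooth_accSq (hU : IsOpen U) (hg : IsLorentzMetric U g)
    (hu : ∀ i, Smooth U fun x => u x i) : Smooth U (accSq g u) :=
  smooth_ip hg (smooth_acc hU hg hu) (smooth_acc hU hg hu)

theorem smooth_cu (hU : IsOpen U) (hg : IsLorentzMetric U g)
    (hu : ∀ i, Smooth U fun x => u x i) (h0 : ∀ x ∈ U, accSq g u x ≠ 0) : Smooth U (cu g u) := by
  refine smooth_ip hg (fun j => ?_) (smooth_lower hg hu)
  exact ((smooth_const 1).div (smooth_accSq hU hg hu) h0).mul
    (smooth_interior2 (smooth_raise hg (smooth_acc hU hg hu))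
      (smooth_extD hU (smooth_acc hU hg hu)) j)

theorem smooth_mu (hU : IsOpen U) (hg : IsLorentzMetric U g)
    (hu : ∀ i, Smooth U fun x => u x i) (h0 : ∀ x ∈ U, accSq g u x ≠ 0)
    (hθ : ∀ x ∈ U, theta g u x ≠ 0) : Smooth U (mu g u) :=
  (smooth_cu hU hg hu h0).div (smooth_theta hU hg hu) hθ

end Smoothness

/-! ## Kinematics at a point -/

section Kinematics

variable {U : Set Pt} {g : MetricField} {u : Field1} {x : Pt}

theorem IsUnitTimelike.ne_zero (hu : IsUnitTimelike U g u) (hx : x ∈ U) : u x ≠ 0 := by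
  intro h
  have := hu.unit x hx
  simp [h] at this

theorem sum_mul_acc (g : MetricField) (u : Field1) (x : Pt) : ∑ i, acc g u x i * u x i = 0 := by
  have h : ∑ j, ∑ i, u x i * extD (lower g u) x i j * u x j = 0 := by
    have h1 : ∑ j, ∑ i, u x i * extD (lower g u) x i j * u x j =
        -∑ j, ∑ i, u x i * extD (lower g u) x i j * u x j := by
      conv_lhs => rw [Finset.sum_comm]
      rw [← Finset.sum_neg_distrib]
      refine Finset.sum_congr rfl fun i _ => ?_
      rw [← Finset.sum_neg_distrib]
      refine Finset.sum_congr rfl fun j _ => ?_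
      rw [extD_antisymm]
      ring
    linarith
  rw [← h]
  refine Finset.sum_congr rfl fun j _ => ?_
  rw [acc, interior2, Finset.sum_mul]

theorem accSq_pos (hg : IsLorentzMetric U g) (hu : IsUnitTimelike U g u) (hx : x ∈ U)
    (ha : acc g u x ≠ 0) : 0 < accSq g u x :=
  ip_pos hg hu hx ha (sum_mul_acc g u x)

theorem wedge_acc_eq_zero (hg : IsLorentzMetric U g) (hx : x ∈ U) (hv : vVec g u x = 0)
    (i j k : Fin 4) : wedge12 (acc g u) (extD (acc g u)) x i j k = 0 :=
  eq_zero_of_hodge3_eq_zero hg hx (isAlternating3_wedge12_extD _ _ _) hv i j k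

/-- If `v = 0`, then `da = a ∧ c`. -/
theorem extD_acc_eq (hg : IsLorentzMetric U g) (hu : IsUnitTimelike U g u) (hx : x ∈ U)
    (ha : acc g u x ≠ 0) (hv : vVec g u x = 0) (j k : Fin 4) :
    extD (acc g u) x j k = acc g u x j * cVec g u x k - acc g u x k * cVec g u x j := by
  have hsq : accSq g u x ≠ 0 := (accSq_pos hg hu hx ha).ne'
  -- Contracting a ∧ da = 0 with the vector a gives a²da = a ∧ i(a)da, and a² ≠ 0 because a is
  -- space-like.
  have h1 : ∑ i, raise g (acc g u) x i * wedge12 (acc g u) (extD (acc g u)) x i j k = 0 :=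
    Finset.sum_eq_zero fun i _ => by rw [wedge_acc_eq_zero hg hx hv, mul_zero]
  have h2 : ∑ i, raise g (acc g u) x i * acc g u x i = accSq g u x := sum_raise_mul _ _ _
  have h3 : ∀ k, accSq g u x * cVec g u x k =
      ∑ i, raise g (acc g u) x i * extD (acc g u) x i k := by
    intro k
    rw [cVec, ← mul_assoc, mul_one_div_cancel hsq, one_mul]
    rfl
  have h4 : ∑ i, raise g (acc g u) x i * wedge12 (acc g u) (extD (acc g u)) x i j k =
      (∑ i, raise g (acc g u) x i * acc g u x i) * extD (acc g u) x j k
      - acc g u x j * (∑ i, raise g (acc g u) x i * extD (acc g u) x i k)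
      + acc g u x k * (∑ i, raise g (acc g u) x i * extD (acc g u) x i j) := by
    rw [Finset.sum_mul, Finset.mul_sum, Finset.mul_sum, ← Finset.sum_sub_distrib,
      ← Finset.sum_add_distrib]
    refine Finset.sum_congr rfl fun i _ => ?_
    simp only [wedge12]
    rw [extD_antisymm (acc g u) x k i]
    ring
  rw [h1, h2, ← h3, ← h3] at h4
  have h5 : accSq g u x * (extD (acc g u) x j k -
      (acc g u x j * cVec g u x k - acc g u x k * cVec g u x j)) = 0 := by
    linear_combination -h4
  have := (mul_eq_zero.1 h5).resolve_left hsq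
  linarith

theorem sum_cVec_mul (hg : IsLorentzMetric U g) (hx : x ∈ U) :
    ∑ i, cVec g u x i * u x i = cu g u x := (ip_lower hg hx _ u).symm

/-- If `v = 0`, then `i(u)da = -(c, u) a`. -/
theorem interior_extD_acc (hg : IsLorentzMetric U g) (hu : IsUnitTimelike U g u) (hx : x ∈ U)
    (ha : acc g u x ≠ 0) (hv : vVec g u x = 0) (k : Fin 4) :
    ∑ j, u x j * extD (acc g u) x j k = -(cu g u x * acc g u x k) := by
  have h1 : ∑ j, u x j * extD (acc g u) x j k =
      (∑ j, acc g u x j * u x j) * cVec g u x k -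
      acc g u x k * ∑ j, cVec g u x j * u x j := by
    rw [Finset.sum_mul, Finset.mul_sum, ← Finset.sum_sub_distrib]
    refine Finset.sum_congr rfl fun j _ => ?_
    rw [extD_acc_eq hg hu hx ha hv]
    ring
  rw [h1, sum_mul_acc, sum_cVec_mul hg hx]
  ring

end Kinematics

/-! ## Hydrodynamic pairs of a classical ideal gas -/

section Pairs

variable {U W : Set Pt} {g : MetricField} {u : Field1} {γ : ℝ} {ρ p f ψ : Pt → ℝ}

theorem IsLorentzMetric.mono (hg : IsLorentzMetric U g) (h : W ⊆ U) : IsLorentzMetric W g :=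
  ⟨fun i j => (hg.smooth i j).mono h, fun x hx => hg.symm x (h hx),
    fun x hx => hg.signature x (h hx)⟩

theorem IsUnitTimelike.mono (hu : IsUnitTimelike U g u) (h : W ⊆ U) : IsUnitTimelike W g u :=
  ⟨fun i => (hu.smooth i).mono h, fun x hx => hu.unit x (h hx)⟩

theorem IsCIGPair.one_lt (h : IsCIGPair U g u γ ρ p) : 1 < γ := by
  obtain ⟨k, cv, hk, hcv, hγ, -⟩ := h.thermodynamics
  rw [hγ]
  have := div_pos hk hcv
  linarith

/-- The hydrodynamic characterization of classical ideal gases: positivity of the pressure and of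
the matter density, conservation of the energy-momentum tensor, and the law `ṗ = -γ p θ`. -/
theorem isCIGPair_iff (hU : IsOpen U) (hγ : 1 < γ) :
    IsCIGPair U g u γ ρ p ↔ Smooth U ρ ∧ Smooth U p ∧ IsAdmissible U γ ρ p ∧
      (∀ x ∈ U, ∀ i, pd p i x + dot u p x * lower g u x i + (ρ x + p x) * acc g u x i = 0) ∧
      (∀ x ∈ U, dot u ρ x + (ρ x + p x) * theta g u x = 0) ∧
      ∀ x ∈ U, dot u p x = -(γ * p x * theta g u x) := by
  have hγ1 : γ - 1 ≠ 0 := by linarith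
  constructor
  · intro h
    obtain ⟨k, cv, hk, hcv, hγk, n, ε, s, Θ, hn, -, -, -, hrel⟩ := h.thermodynamics
    -- Here nε = c_v nΘ = p c_v/k = p/(γ-1), so n is determined by ρ and p. Subtracting its
    -- conservation law from the energy equation leaves the law for ṗ.
    have hnρ : ∀ x ∈ U, n x = ρ x - p x / (γ - 1) := by
      intro x hx
      obtain ⟨-, -, h1, -, -, h2, h3⟩ := hrel x hx
      have h4 : γ - 1 = k / cv := by rw [hγk]; ring
      rw [h1, h2, h3, h4]
      field_simp
      ring
    refine ⟨h.smooth_rho, h.smooth_p, ?_, h.momentum, h.energy, ?_⟩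
    · intro x hx
      obtain ⟨h0, h1, -, -, -, h2, -⟩ := hrel x hx
      refine ⟨?_, by rw [← hnρ x hx]; exact h0⟩
      rw [h2]
      positivity
    · intro x hx
      obtain ⟨-, -, -, h1, -, -, -⟩ := hrel x hx
      have hp := h.smooth_p.diffAt hU hx
      have hρ := h.smooth_rho.diffAt hU hx
      have h2 : dot u n x = dot u ρ x - dot u p x / (γ - 1) := by
        rw [dot_congr hU hx hnρ, dot_sub hρ
          ((h.smooth_p.div (smooth_const _) fun _ _ => hγ1).diffAt hU hx)]
        congr 1
        simp only [div_eq_inv_mul]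
        exact dot_const_mul _ hp
      rw [h2, hnρ x hx] at h1
      have h3 := h.energy x hx
      field_simp at h1
      linear_combination (γ - 1) * h3 - h1
  · rintro ⟨hρ, hp, hadm, hmom, hen, hpdot⟩
    -- Only k/c_v matters, so c_v = 1 and k = γ-1. Then n is forced by ρ = n + p/(γ-1), Θ by p =
    -- knΘ, and log(p/n^γ) is an entropy.
    refine ⟨hρ, hp, hmom, hen, γ - 1, 1, by linarith, one_pos, by ring, ?_⟩
    let n : Pt → ℝ := fun x => ρ x - p x / (γ - 1)
    have hn : Smooth U n := hρ.sub (hp.div (smooth_const _) fun _ _ => hγ1)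
    have hn0 : ∀ x ∈ U, n x ≠ 0 := fun x hx => (hadm x hx).2.ne'
    have hp0 : ∀ x ∈ U, p x ≠ 0 := fun x hx => (hadm x hx).1.ne'
    let Θ : Pt → ℝ := fun x => p x / ((γ - 1) * n x)
    have hn' : Smooth U fun x => (γ - 1) * n x := (smooth_const (γ - 1)).mul hn
    have hΘ : Smooth U Θ := hp.div hn' fun x hx => mul_ne_zero hγ1 (hn0 x hx)
    have hlogp : Smooth U fun x => Real.log (p x) := ContDiffOn.log hp hp0
    have hlogn : Smooth U fun x => Real.log (n x) := ContDiffOn.log hn hn0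
    refine ⟨n, Θ, fun x => Real.log (p x) - γ * Real.log (n x), Θ, hn, hΘ,
      hlogp.sub ((smooth_const γ).mul hlogn), hΘ, fun x hx => ?_⟩
    have hnp := hn0 x hx
    have hpp := hp0 x hx
    have hpd := hp.diffAt hU hx
    have hnd := hn.diffAt hU hx
    refine ⟨(hadm x hx).2, div_pos (hadm x hx).1 (mul_pos (by linarith) (hadm x hx).2), ?_, ?_,
      fun i => ?_, ?_, by ring⟩
    · have : ρ x = n x + p x / (γ - 1) := by simp only [n]; ring
      rw [this]
      simp only [Θ]
      field_simp
    · have h2 : dot u n x = dot u ρ x - dot u p x / (γ - 1) := by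
        simp only [n]
        rw [dot_sub (hρ.diffAt hU hx)
          ((hp.div (smooth_const _) fun _ _ => hγ1).diffAt hU hx)]
        congr 1
        simp only [div_eq_inv_mul]
        exact dot_const_mul _ hpd
      have h3 := hen x hx
      rw [h2, hpdot x hx]
      simp only [n]
      field_simp
      linear_combination (γ - 1) * h3
    · have h1 : pd (fun x => Real.log (p x) - γ * Real.log (n x)) i x =
          pd p i x / p x - γ * (pd n i x / n x) := by
        rw [pd_sub (hlogp.diffAt hU hx) ((hlogn.diffAt hU hx).const_mul γ),
          pd_const_mul γ (hlogn.diffAt hU hx),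
          pd_comp (Real.differentiableAt_log hpp) hpd, pd_comp (Real.differentiableAt_log hnp) hnd,
          Real.deriv_log, Real.deriv_log]
        ring
      have h2 : pd Θ i x = (pd p i x * ((γ - 1) * n x) - p x * ((γ - 1) * pd n i x)) /
          ((γ - 1) * n x) ^ 2 := by
        simp only [Θ]
        rw [pd_div hpd (hn'.diffAt hU hx) (mul_ne_zero hγ1 hnp), pd_const_mul _ hnd]
      have h3 : pd (fun y => 1 / n y) i x = (0 * n x - 1 * pd n i x) / n x ^ 2 := by
        rw [pd_div (differentiableAt_const 1) hnd hnp, pd_const]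
      rw [h1, h2, h3]
      simp only [Θ]
      field_simp
      ring
    · simp only [Θ]
      field_simp

/-- A smooth function `f` with `dψ = θ u - f a` and `ḟ = θ ((γ - 1) f - 1)`. -/
structure IsGasPotential (W : Set Pt) (g : MetricField) (u : Field1) (γ : ℝ)
    (f ψ : Pt → ℝ) : Prop where
  smooth_f : Smooth W f
  psi : IsPsi W g u f ψ
  evolution : ∀ x ∈ W, dot u f x = theta g u x * ((γ - 1) * f x - 1)

theorem IsPsi.dot_eq (hu : IsUnitTimelike W g u) (h : IsPsi W g u f ψ) {x : Pt} (hx : x ∈ W) :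
    dot u ψ x = -theta g u x := by
  have h1 := hu.unit x hx
  have h2 := sum_mul_acc g u x
  simp only [dot, h.potential x hx]
  simp only [Fin.sum_univ_four] at *
  linear_combination theta g u x * h1 - f x * h2

/-- Dividing the momentum equation by γp, with ṗ = -γpθ inserted, gives dψ. The energy equation
becomes the linear evolution equation for f. -/
theorem IsCIGPair.isGasPotential (hW : IsOpen W) (h : IsCIGPair W g u γ ρ p) :
    IsGasPotential W g u γ (fun x => (ρ x + p x) / (γ * p x)) (fun x => Real.log (p x) / γ) := by
  have hγ := h.one_lt
  have hγ0 : γ ≠ 0 := by linarith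
  obtain ⟨hρ, hp, hadm, hmom, hen, hpdot⟩ := (isCIGPair_iff hW hγ).1 h
  have hp0 : ∀ x ∈ W, p x ≠ 0 := fun x hx => (hadm x hx).1.ne'
  have hlogp : Smooth W fun x => Real.log (p x) := ContDiffOn.log hp hp0
  have hγp : Smooth W fun x => γ * p x := (smooth_const γ).mul hp
  have hγp0 : ∀ x ∈ W, γ * p x ≠ 0 := fun x hx => mul_ne_zero hγ0 (hp0 x hx)
  refine ⟨(hρ.add hp).div hγp hγp0, ⟨hlogp.div (smooth_const γ) fun _ _ => hγ0, ?_⟩, ?_⟩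
  · intro x hx i
    have hpp := hp0 x hx
    have hpd := hp.diffAt hW hx
    have h1 : pd (fun x => Real.log (p x) / γ) i x = pd p i x / p x / γ := by
      simp only [div_eq_inv_mul]
      rw [pd_const_mul _ (hlogp.diffAt hW hx), pd_comp (Real.differentiableAt_log hpp) hpd,
        Real.deriv_log]
    have h2 := hmom x hx i
    rw [hpdot x hx] at h2
    rw [h1]
    field_simp
    linear_combination h2
  · intro x hx
    have hpp := hp0 x hx
    have hpd := hp.diffAt hW hx
    have hρd := hρ.diffAt hW hx
    rw [dot_div ((hρ.add hp).diffAt hW hx) (hγp.diffAt hW hx) (hγp0 x hx), dot_add hρd hpd,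
      dot_const_mul _ hpd]
    have h1 := hen x hx
    have h2 := hpdot x hx
    have h3 : dot u ρ x = -((ρ x + p x) * theta g u x) := by linarith
    rw [h2, h3]
    field_simp
    ring

theorem IsCIGPair.rho_eq (hU : IsOpen U) (h : IsCIGPair U g u γ ρ p) {x : Pt} (hx : x ∈ U) :
    ρ x = p x * (γ * ((ρ x + p x) / (γ * p x)) - 1) := by
  have hγ := h.one_lt
  have hγ0 : γ ≠ 0 := by linarith
  have hp := (((isCIGPair_iff hU hγ).1 h).2.2.1 x hx).1.ne'
  field_simp
  ring

theorem IsCIGPair.p_eq (hU : IsOpen U) (h : IsCIGPair U g u γ ρ p) {x : Pt} (hx : x ∈ U) :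
    p x = Real.exp (γ * (Real.log (p x) / γ)) := by
  have hγ := h.one_lt
  have hγ0 : γ ≠ 0 := by linarith
  have hp := (((isCIGPair_iff hU hγ).1 h).2.2.1 x hx).1
  rw [mul_div_cancel₀ _ hγ0, Real.exp_log hp]

/-- This is positivity of the matter density in terms of f. It yields f ≠ 0, and it excludes the
degenerate case ν = 1, μ = 0 in the class C₆. -/
theorem IsCIGPair.one_lt_mul (hU : IsOpen U) (h : IsCIGPair U g u γ ρ p) {x : Pt} (hx : x ∈ U) :
    1 < (γ - 1) * ((ρ x + p x) / (γ * p x)) := by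
  have hγ := h.one_lt
  obtain ⟨hp, hn⟩ := ((isCIGPair_iff hU hγ).1 h).2.2.1 x hx
  have hγ1 : 0 < γ - 1 := by linarith
  rw [← mul_div_assoc, lt_div_iff₀ (by positivity)]
  rw [sub_pos, div_lt_iff₀ hγ1] at hn
  nlinarith

/-- Pairs are built from gas potentials. -/
theorem isCIGPair_of_isGasPotential (hU : IsOpen U) (hu : IsUnitTimelike U g u) (hγ : 1 < γ)
    (hadm : IsAdmissible U γ ρ p)
    (h : ∀ x ∈ U, ∃ W, IsOpen W ∧ x ∈ W ∧ W ⊆ U ∧ ∃ (C : ℝ) (f ψ : Pt → ℝ),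
      IsGasPotential W g u γ f ψ ∧ ∀ y ∈ W, p y = C * Real.exp (γ * ψ y) ∧
        ρ y = p y * (γ * f y - 1)) : IsCIGPair U g u γ ρ p := by
  have hmain : ∀ x ∈ U, ContDiffAt ℝ ∞ ρ x ∧ ContDiffAt ℝ ∞ p x ∧
      (∀ i, pd p i x + dot u p x * lower g u x i + (ρ x + p x) * acc g u x i = 0) ∧
      dot u ρ x + (ρ x + p x) * theta g u x = 0 ∧ dot u p x = -(γ * p x * theta g u x) := by
    intro x hx
    obtain ⟨W, hW, hxW, hWU, C, f, ψ, hf, hval⟩ := h x hx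
    have hexp : Smooth W fun y => Real.exp (γ * ψ y) :=
      ContDiffOn.exp ((smooth_const γ).mul hf.psi.smooth)
    have hpW : Smooth W p :=
      ContDiffOn.congr ((smooth_const C).mul hexp) fun y hy => (hval y hy).1
    have hff : Smooth W fun y => γ * f y - 1 :=
      ((smooth_const γ).mul hf.smooth_f).sub (smooth_const 1)
    have hρW : Smooth W ρ := ContDiffOn.congr (hpW.mul hff) fun y hy => (hval y hy).2
    have hψd := hf.psi.smooth.diffAt hW hxW
    have hfd := hf.smooth_f.diffAt hW hxW
    have hpd : ∀ i, pd p i x = γ * p x * pd ψ i x := by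
      intro i
      rw [pd_congr hW hxW fun y hy => (hval y hy).1, pd_const_mul _ (hexp.diffAt hW hxW),
        pd_comp Real.differentiableAt_exp (hψd.const_mul γ), Real.deriv_exp, pd_const_mul _ hψd,
        (hval x hxW).1]
      ring
    have hpdot : dot u p x = -(γ * p x * theta g u x) := by
      have h1 := hf.psi.dot_eq (hu.mono hWU) hxW
      rw [dot] at h1 ⊢
      simp only [hpd]
      rw [Fin.sum_univ_four] at h1 ⊢
      linear_combination γ * p x * h1
    have hρdot : dot u ρ x = dot u p x * (γ * f x - 1) + p x * (γ * dot u f x) := by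
      rw [dot_congr hW hxW fun y hy => (hval y hy).2,
        dot_mul (hpW.diffAt hW hxW) (hff.diffAt hW hxW),
        dot_sub (hfd.const_mul γ) (differentiableAt_const 1), dot_const_mul _ hfd, dot_const,
        sub_zero]
    refine ⟨hρW.contDiffAt hW hxW, hpW.contDiffAt hW hxW, fun i => ?_, ?_, hpdot⟩
    · rw [hpd, hpdot, hf.psi.potential x hxW, (hval x hxW).2]
      ring
    · rw [hρdot, hpdot, hf.evolution x hxW, (hval x hxW).2]
      ring
  exact (isCIGPair_iff hU hγ).2 ⟨smooth_of_locally fun x hx => (hmain x hx).1,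
    smooth_of_locally fun x hx => (hmain x hx).2.1, hadm, fun x hx => (hmain x hx).2.2.1,
    fun x hx => (hmain x hx).2.2.2.1, fun x hx => (hmain x hx).2.2.2.2⟩

/-- Where `a ≠ 0`, the function `f` in `dψ = θ u - f a` is smooth. -/
theorem IsPsi.smooth_f (hW : IsOpen W) (hg : IsLorentzMetric W g) (hu : IsUnitTimelike W g u)
    (h : IsPsi W g u f ψ) (ha : ∀ x ∈ W, acc g u x ≠ 0) : Smooth W f := by
  refine smooth_of_locally fun x hx => ?_
  obtain ⟨i, hi⟩ := Function.ne_iff.1 (ha x hx)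
  have hacc := smooth_acc hW hg hu.smooth i
  have h1 : ContDiffAt ℝ ∞ (fun y => (theta g u y * lower g u y i - pd ψ i y) / acc g u y i) x :=
    ContDiffAt.div ((((smooth_theta hW hg hu.smooth).mul (smooth_lower hg hu.smooth i)).sub
      (h.smooth.pd hW i)).contDiffAt hW hx) (hacc.contDiffAt hW hx) hi
  refine h1.congr_of_eventuallyEq ?_
  filter_upwards [hW.mem_nhds hx,
    (hacc.contDiffAt hW hx).continuousAt.eventually_ne hi] with y hy hyi
  rw [h.potential y hy, eq_div_iff hyi]
  ring

/-- With the convention 1/0 = 0, a zero of f would give γ̃[f] = 0 and hence γ = 1. -/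
theorem ne_zero_of_gammaTilde (hγ : 1 < γ) {x : Pt} (h : γ = gammaTilde g u f x + 1) :
    f x ≠ 0 := by
  intro h0
  rw [gammaTilde, h0] at h
  norm_num at h
  linarith

theorem gammaTilde_eq_iff {x : Pt} (hθ : theta g u x ≠ 0) (hf : f x ≠ 0) :
    γ = gammaTilde g u f x + 1 ↔ dot u f x = theta g u x * ((γ - 1) * f x - 1) := by
  rw [gammaTilde]
  constructor
  · intro h
    rw [h]
    field_simp
    ring
  · intro h
    rw [h]
    field_simp
    ring

end Pairs

/-! ## Integrability conditions -/

section Integrability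

variable {W : Set Pt} {g : MetricField} {u : Field1} {γ : ℝ} {f ψ h t k : Pt → ℝ}

/-- The identity `d(t u - k a) = 0` for `dh = t u - k a`. -/
theorem closed_of_grad (hW : IsOpen W) (hg : IsLorentzMetric W g) (hu : IsUnitTimelike W g u)
    (hh : Smooth W h) (ht : Smooth W t) (hk : Smooth W k)
    (hgrad : ∀ x ∈ W, ∀ j, pd h j x = t x * lower g u x j - k x * acc g u x j) {x : Pt}
    (hx : x ∈ W) (i j : Fin 4) :
    pd t i x * lower g u x j - pd t j x * lower g u x i + t x * extD (lower g u) x i j =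
      pd k i x * acc g u x j - pd k j x * acc g u x i + k x * extD (acc g u) x i j := by
  have hl := smooth_lower hg hu.smooth
  have ha := smooth_acc hW hg hu.smooth
  have key : ∀ i j, pd (pd h j) i x = pd t i x * lower g u x j +
      t x * pd (fun y => lower g u y j) i x -
      (pd k i x * acc g u x j + k x * pd (fun y => acc g u y j) i x) := by
    intro i j
    rw [pd_congr hW hx fun y hy => hgrad y hy j,
      pd_sub ((ht.mul (hl j)).diffAt hW hx) ((hk.mul (ha j)).diffAt hW hx),
      pd_mul (ht.diffAt hW hx) ((hl j).diffAt hW hx),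
      pd_mul (hk.diffAt hW hx) ((ha j).diffAt hW hx)]
  have h1 := pd_comm hh hW hx i j
  rw [key, key] at h1
  simp only [extD]
  linear_combination h1

/-- Contraction with u of the closedness of τu - κa, with q = dτ, p = dκ, F = du and G = da. Because
i(u)du = a and i(u)da = -ca, every term other than dτ is a multiple of u or of a. The same algebra
serves for θ, θ̇ and β. -/
theorem contract_closed {v q p U a : Fin 4 → ℝ} {F G : Fin 4 → Fin 4 → ℝ} {τ κ c : ℝ}
    (h : ∀ i j, q i * U j - q j * U i + τ * F i j = p i * a j - p j * a i + κ * G i j)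
    (hU : ∑ i, U i * v i = -1) (ha : ∑ i, a i * v i = 0) (hF : ∀ j, ∑ i, v i * F i j = a j)
    (hG : ∀ j, ∑ i, v i * G i j = -(c * a j)) (j : Fin 4) :
    q j = -(∑ i, v i * q i) * U j + (∑ i, v i * p i - κ * c - τ) * a j := by
  have hFj := hF j
  have hGj := hG j
  simp only [Fin.sum_univ_four] at *
  linear_combination v 0 * h 0 j + v 1 * h 1 j + v 2 * h 2 j + v 3 * h 3 j - τ * hFj + κ * hGj +
    q j * hU - p j * ha

/-- Multiplying the closedness identity by u kills q ∧ u, and also p ∧ a when p lies in the plane of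
u and a. -/
theorem wedge_closed {q p U a : Fin 4 → ℝ} {F G : Fin 4 → Fin 4 → ℝ} {τ κ A B : ℝ}
    (h : ∀ i j, q i * U j - q j * U i + τ * F i j = p i * a j - p j * a i + κ * G i j)
    (hp : ∀ j, p j = A * U j + B * a j) (i j k : Fin 4) :
    τ * (U i * F j k + U j * F k i + U k * F i j) =
      κ * (U i * G j k + U j * G k i + U k * G i j) := by
  have h1 := h j k
  have h2 := h k i
  have h3 := h i j
  rw [hp i, hp j] at h3
  rw [hp j, hp k] at h1
  rw [hp k, hp i] at h2
  linear_combination U i * h1 + U j * h2 + U k * h3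

theorem sum_extD_lower (g : MetricField) (u : Field1) (x : Pt) (j : Fin 4) :
    ∑ i, u x i * extD (lower g u) x i j = acc g u x j := rfl

theorem IsGasPotential.closed (hW : IsOpen W) (hg : IsLorentzMetric W g)
    (hu : IsUnitTimelike W g u) (h : IsGasPotential W g u γ f ψ) {x : Pt} (hx : x ∈ W)
    (i j : Fin 4) :
    pd (theta g u) i x * lower g u x j - pd (theta g u) j x * lower g u x i +
      theta g u x * extD (lower g u) x i j =
      pd f i x * acc g u x j - pd f j x * acc g u x i + f x * extD (acc g u) x i j :=
  closed_of_grad hW hg hu h.psi.smooth (smooth_theta hW hg hu.smooth) h.smooth_f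
    h.psi.potential hx i j

/-- If `(v, u) ≠ 0`, then `f = f₁`. -/
theorem IsGasPotential.eq_f1 (hW : IsOpen W) (hg : IsLorentzMetric W g)
    (hu : IsUnitTimelike W g u) (h : IsGasPotential W g u γ f ψ) {x : Pt} (hx : x ∈ W)
    (hvu : vu g u x ≠ 0) : f x = f1 g u x := by
  have e := h.closed hW hg hu hx
  -- This is the product of the closedness identity with u ∧ a, which removes the terms in dθ and
  -- df.
  have h1 : theta g u x * vol (wedge12 (lower g u) (extD (lower g u)) x) (acc g u x) =
      -(f x * vol (wedge12 (acc g u) (extD (acc g u)) x) (lower g u x)) := by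
    rw [(isAlternating3_wedge12_extD _ _ _).vol_eq, (isAlternating3_wedge12_extD _ _ _).vol_eq]
    simp only [wedge12]
    rw [extD_antisymm (acc g u) x 3 1, extD_antisymm (acc g u) x 2 0]
    have e20 := e 2 0
    have e31 := e 3 1
    rw [extD_antisymm (acc g u) x 2 0] at e20
    rw [extD_antisymm (acc g u) x 3 1] at e31
    linear_combination 6 * (acc g u x 3 * (lower g u x 0 * e 1 2 + lower g u x 1 * e20 +
      lower g u x 2 * e 0 1) - acc g u x 2 * (lower g u x 0 * e 1 3 + lower g u x 1 * e 3 0 +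
      lower g u x 3 * e 0 1) + acc g u x 1 * (lower g u x 0 * e 2 3 + lower g u x 2 * e 3 0 +
      lower g u x 3 * e 0 2) - acc g u x 0 * (lower g u x 1 * e 2 3 + lower g u x 2 * e31 +
      lower g u x 3 * e 1 2))
  have h2 : ip g (omega g u) (acc g u) x = _ := ip_hodge3 g _ (acc g u) x
  have h3 : vu g u x = _ := ip_hodge3 g _ (lower g u) x
  have h4 : theta g u x * ip g (omega g u) (acc g u) x = -(f x * vu g u x) := by
    rw [h2, h3]
    linear_combination (1 / 6) * Real.sqrt |(g x).det| * (g x)⁻¹.det * h1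
  rw [f1]
  field_simp
  linear_combination h4

/-- If `(v, u) = 0` and `v ≠ 0`, then `f = f₂`. -/
theorem IsGasPotential.eq_f2 (hW : IsOpen W) (hg : IsLorentzMetric W g)
    (hu : IsUnitTimelike W g u) (h : IsGasPotential W g u γ f ψ) {x : Pt} (hx : x ∈ W)
    (hvu : vu g u x = 0) (hv : vVec g u x ≠ 0) : f x = f2 g u x := by
  have e := h.closed hW hg hu hx
  have hvu' : ∑ i, vVec g u x i * u x i = 0 := by
    rw [← ip_lower hg hx]
    exact hvu
  have hv2 : ip g (vVec g u) (vVec g u) x ≠ 0 := (ip_pos hg hu hx hv hvu').ne'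
  -- The product with a removes df. The term with coefficient 0 only gives the left side the shape
  -- required by `vol_add`.
  have h1 : (fun i j k => f x * wedge12 (acc g u) (extD (acc g u)) x i j k + 0 *
      wedge12 (acc g u) (extD (acc g u)) x i j k) = fun i j k =>
      theta g u x * wedge12 (acc g u) (extD (lower g u)) x i j k +
      1 * wedge12 (grad (theta g u)) (wedge11 (lower g u) (acc g u)) x i j k := by
    funext i j k
    simp only [wedge12, wedge11, grad]
    linear_combination -(acc g u x i * e j k + acc g u x j * e k i + acc g u x k * e i j)
  have h2 := congrArg (fun T => vol T (vVec g u x)) h1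
  simp only [vol_add] at h2
  -- The form a ∧ du is annihilated by u since i(u)du = a and (a,u) = 0, and v is orthogonal to u in
  -- this class.
  have h3 : vol (wedge12 (acc g u) (extD (lower g u)) x) (vVec g u x) = 0 := by
    refine (isAlternating3_wedge12_extD _ _ _).vol_eq_zero (hu.ne_zero hx) (fun j k => ?_) hvu'
    have h4 : ∑ i, u x i * wedge12 (acc g u) (extD (lower g u)) x i j k =
        (∑ i, acc g u x i * u x i) * extD (lower g u) x j k -
        acc g u x j * (∑ i, u x i * extD (lower g u) x i k) +
        acc g u x k * (∑ i, u x i * extD (lower g u) x i j) := by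
      rw [Finset.sum_mul, Finset.mul_sum, Finset.mul_sum, ← Finset.sum_sub_distrib,
        ← Finset.sum_add_distrib]
      refine Finset.sum_congr rfl fun i _ => ?_
      simp only [wedge12]
      rw [extD_antisymm (lower g u) x k i]
      ring
    rw [h4, sum_mul_acc, sum_extD_lower, sum_extD_lower]
    ring
  rw [h3] at h2
  have h5 : ip g (xVec g u) (vVec g u) x = _ := ip_hodge3 g _ (vVec g u) x
  have h6 : ip g (vVec g u) (vVec g u) x = _ := ip_hodge3 g _ (vVec g u) x
  rw [f2, eq_div_iff hv2, h5, h6]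
  linear_combination (1 / 6) * Real.sqrt |(g x).det| * (g x)⁻¹.det * h2

/-- In the case `v = 0` the gradient of the expansion lies in the plane of `u` and `a`. -/
theorem IsGasPotential.grad_theta (hW : IsOpen W) (hg : IsLorentzMetric W g)
    (hu : IsUnitTimelike W g u) (h : IsGasPotential W g u γ f ψ) {x : Pt} (hx : x ∈ W)
    (ha : acc g u x ≠ 0) (hv : vVec g u x = 0) (j : Fin 4) :
    pd (theta g u) j x = -dot u (theta g u) x * lower g u x j +
      (dot u f x - f x * cu g u x - theta g u x) * acc g u x j :=
  contract_closed (h.closed hW hg hu hx) (hu.unit x hx) (sum_mul_acc g u x)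
    (sum_extD_lower g u x) (interior_extD_acc hg hu hx ha hv) j

/-- Since (a,u) = 0, only the a-component of dθ survives in i(a)dθ = B a². -/
theorem nu_eq_of_grad_theta (hg : IsLorentzMetric W g) (hu : IsUnitTimelike W g u) {x : Pt}
    (hx : x ∈ W) (hθ : theta g u x ≠ 0) (ha : acc g u x ≠ 0) {A B : ℝ}
    (h : ∀ j, pd (theta g u) j x = A * lower g u x j + B * acc g u x j) :
    nu g u x = 2 + B / theta g u x := by
  have hsq : accSq g u x ≠ 0 := (accSq_pos hg hu hx ha).ne'
  have h1 : ip g (acc g u) (grad (theta g u)) x = B * accSq g u x := by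
    rw [ip_comm hg hx, ← sum_raise_mul]
    have h2 : ∑ i, raise g (acc g u) x i * acc g u x i = accSq g u x := sum_raise_mul _ _ _
    have h3 : ∑ i, raise g (acc g u) x i * lower g u x i = 0 := by
      rw [sum_raise_mul, ip_comm hg hx, ip_lower hg hx, sum_mul_acc]
    have h4 : ∑ i, raise g (acc g u) x i * grad (theta g u) x i =
        A * ∑ i, raise g (acc g u) x i * lower g u x i +
        B * ∑ i, raise g (acc g u) x i * acc g u x i := by
      rw [Finset.mul_sum, Finset.mul_sum, ← Finset.sum_add_distrib]
      refine Finset.sum_congr rfl fun i _ => ?_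
      rw [grad, h i]
      ring
    rw [h4, h2, h3]
    ring
  rw [nu, h1]
  field_simp

/-- In the case `v = 0`, `ν = (γ - 1 - μ) f`. -/
theorem IsGasPotential.nu_eq (hW : IsOpen W) (hg : IsLorentzMetric W g)
    (hu : IsUnitTimelike W g u) (h : IsGasPotential W g u γ f ψ) {x : Pt} (hx : x ∈ W)
    (hθ : theta g u x ≠ 0) (ha : acc g u x ≠ 0) (hv : vVec g u x = 0) :
    nu g u x = (γ - 1 - mu g u x) * f x := by
  rw [nu_eq_of_grad_theta hg hu hx hθ ha (h.grad_theta hW hg hu hx ha hv), h.evolution x hx, mu]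
  field_simp
  ring

/-- Differentiate ν = (γ-1-μ)f along u, insert ḟ = θ((γ-1)f - 1), multiply by f, and replace (γ-1)f
by ν + μf. The index γ disappears, so f is tied to the velocity alone. -/
theorem IsGasPotential.quadratic (hW : IsOpen W) (hg : IsLorentzMetric W g)
    (hu : IsUnitTimelike W g u) (h : IsGasPotential W g u γ f ψ)
    (hθ : ∀ x ∈ W, theta g u x ≠ 0) (ha : ∀ x ∈ W, acc g u x ≠ 0)
    (hv : ∀ x ∈ W, vVec g u x = 0) {x : Pt} (hx : x ∈ W) :
    dot u (mu g u) x * f x ^ 2 + linCoeff g u x * f x +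
      theta g u x * nu g u x * (1 - nu g u x) = 0 := by
  have hμ := smooth_mu hW hg hu.smooth (fun y hy => (accSq_pos hg hu hy (ha y hy)).ne') hθ
  have hμd := hμ.diffAt hW hx
  have hfd := h.smooth_f.diffAt hW hx
  have hν : ∀ y ∈ W, nu g u y = (γ - 1 - mu g u y) * f y := fun y hy =>
    h.nu_eq hW hg hu hy (hθ y hy) (ha y hy) (hv y hy)
  have hc : Smooth W fun y => γ - 1 - mu g u y := (smooth_const (γ - 1)).sub hμ
  have h1 : dot u (nu g u) x = (0 - dot u (mu g u) x) * f x +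
      (γ - 1 - mu g u x) * dot u f x := by
    rw [dot_congr hW hx hν, dot_mul (hc.diffAt hW hx) hfd,
      dot_sub (differentiableAt_const (γ - 1)) hμd, dot_const]
  rw [linCoeff, h1, h.evolution x hx, hν x hx]
  ring

/-- At a root z the discriminant is the square of 2μ̇z + (ν̇ - θμν), and the sign of this number
selects the branch. -/
theorem eq_fPlus_or_fMinus {x : Pt} {z : ℝ} (hμ : dot u (mu g u) x ≠ 0)
    (h : dot u (mu g u) x * z ^ 2 + linCoeff g u x * z +
      theta g u x * nu g u x * (1 - nu g u x) = 0) :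
    0 ≤ discr g u x ∧ (z = fPlus g u x ∨ z = fMinus g u x) := by
  have h1 : discr g u x = (2 * dot u (mu g u) x * z + linCoeff g u x) ^ 2 := by
    rw [discr]
    linear_combination (-4 * dot u (mu g u) x) * h
  refine ⟨by rw [h1]; positivity, ?_⟩
  rw [fPlus, fMinus, h1, Real.sqrt_sq_eq_abs]
  rcases abs_choice (2 * dot u (mu g u) x * z + linCoeff g u x) with h2 | h2
  · left
    rw [h2]
    field_simp
    ring
  · right
    rw [h2]
    field_simp
    ring

theorem eq_f3 {x : Pt} {z : ℝ} (hμ : dot u (mu g u) x = 0) (hl : linCoeff g u x ≠ 0)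
    (h : dot u (mu g u) x * z ^ 2 + linCoeff g u x * z +
      theta g u x * nu g u x * (1 - nu g u x) = 0) : z = f3 g u x := by
  have hl' : theta g u x * mu g u x * nu g u x - dot u (nu g u) x ≠ 0 := by
    intro h0
    refine hl ?_
    rw [linCoeff]
    linarith
  rw [f3, eq_div_iff hl']
  rw [hμ, linCoeff] at h
  linear_combination -h

end Integrability

/-! ## The case `v = 0`, `ν = 0` -/

section VanishingNu

variable {U W : Set Pt} {g : MetricField} {u : Field1} {γ m : ℝ} {ρ p f ψ α β : Pt → ℝ}

/-- The conditions common to the classes `C₇` and `C₈`. -/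
structure HasVanishingNu (U : Set Pt) (g : MetricField) (u : Field1) : Prop where
  theta_ne : ∀ x ∈ U, theta g u x ≠ 0
  acc_ne : ∀ x ∈ U, acc g u x ≠ 0
  vVec_eq : ∀ x ∈ U, vVec g u x = 0
  nu_eq : ∀ x ∈ U, nu g u x = 0

theorem HasVanishingNu.mono (h : HasVanishingNu U g u) (hWU : W ⊆ U) : HasVanishingNu W g u :=
  ⟨fun x hx => h.theta_ne x (hWU hx), fun x hx => h.acc_ne x (hWU hx),
    fun x hx => h.vVec_eq x (hWU hx), fun x hx => h.nu_eq x (hWU hx)⟩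

/-- From 0 = (γ-1-μ)f and f ≠ 0. -/
theorem HasVanishingNu.mu_eq (hD : HasVanishingNu W g u) (hW : IsOpen W)
    (hg : IsLorentzMetric W g) (hu : IsUnitTimelike W g u) (h : IsCIGPair W g u γ ρ p) {x : Pt}
    (hx : x ∈ W) : mu g u x = γ - 1 := by
  have h1 := (h.isGasPotential hW).nu_eq hW hg hu hx (hD.theta_ne x hx) (hD.acc_ne x hx)
    (hD.vVec_eq x hx)
  have h2 := h.one_lt_mul hW hx
  rw [hD.nu_eq x hx] at h1
  have h3 : (ρ x + p x) / (γ * p x) ≠ 0 := by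
    intro h0
    rw [h0] at h2
    linarith
  have := (mul_eq_zero.1 h1.symm).resolve_right h3
  linarith

/-- `(c, u) = m θ` with `m` constant, and `dθ = -θ̇ u - 2 θ a`. -/
structure HasPlanarExpansion (W : Set Pt) (g : MetricField) (u : Field1) (m : ℝ) : Prop where
  cu_eq : ∀ x ∈ W, cu g u x = m * theta g u x
  grad_theta : ∀ x ∈ W, ∀ j, pd (theta g u) j x =
    -dot u (theta g u) x * lower g u x j - 2 * theta g u x * acc g u x j

/-- Once (c,u) = (γ-1)θ, the coefficient ḟ - f(c,u) - θ of a in dθ equals -2θ: the unknown f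
cancels. -/
theorem HasVanishingNu.hasPlanarExpansion (hD : HasVanishingNu W g u) (hW : IsOpen W)
    (hg : IsLorentzMetric W g) (hu : IsUnitTimelike W g u) (h : IsCIGPair W g u γ ρ p) :
    HasPlanarExpansion W g u (γ - 1) := by
  have hcu : ∀ x ∈ W, cu g u x = (γ - 1) * theta g u x := by
    intro x hx
    have h1 := hD.mu_eq hW hg hu h hx
    rwa [mu, div_eq_iff (hD.theta_ne x hx)] at h1
  refine ⟨hcu, fun x hx j => ?_⟩
  rw [(h.isGasPotential hW).grad_theta hW hg hu hx (hD.acc_ne x hx) (hD.vVec_eq x hx) j,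
    (h.isGasPotential hW).evolution x hx, hcu x hx]
  ring

theorem HasPlanarExpansion.closed (h : HasPlanarExpansion W g u m) (hW : IsOpen W)
    (hg : IsLorentzMetric W g) (hu : IsUnitTimelike W g u) {x : Pt} (hx : x ∈ W) (i j : Fin 4) :
    pd (fun y => -dot u (theta g u) y) i x * lower g u x j -
        pd (fun y => -dot u (theta g u) y) j x * lower g u x i +
        -dot u (theta g u) x * extD (lower g u) x i j =
      pd (fun y => 2 * theta g u y) i x * acc g u x j -
        pd (fun y => 2 * theta g u y) j x * acc g u x i +
        2 * theta g u x * extD (acc g u) x i j :=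
  closed_of_grad hW hg hu (smooth_theta hW hg hu.smooth)
    (((smooth_theta hW hg hu.smooth).dot hu.smooth hW).neg)
    ((smooth_const 2).mul (smooth_theta hW hg hu.smooth)) h.grad_theta hx i j

/-- Contract d(dθ) = 0 with u, taking τ = -θ̇ and κ = 2θ. -/
theorem HasPlanarExpansion.grad_dot_theta (h : HasPlanarExpansion W g u m)
    (hD : HasVanishingNu W g u) (hW : IsOpen W) (hg : IsLorentzMetric W g)
    (hu : IsUnitTimelike W g u) {x : Pt} (hx : x ∈ W) (j : Fin 4) :
    pd (dot u (theta g u)) j x = -dot u (dot u (theta g u)) x * lower g u x j -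
      (3 * dot u (theta g u) x - 2 * m * theta g u x ^ 2) * acc g u x j := by
  have h1 := contract_closed (h.closed hW hg hu hx) (hu.unit x hx) (sum_mul_acc g u x)
    (sum_extD_lower g u x) (interior_extD_acc hg hu hx (hD.acc_ne x hx) (hD.vVec_eq x hx)) j
  have hθ := (smooth_theta hW hg hu.smooth).diffAt hW hx
  have h2 : ∑ i, u x i * pd (fun y => 2 * theta g u y) i x = 2 * dot u (theta g u) x :=
    dot_const_mul 2 hθ
  have h3 : ∑ i, u x i * pd (fun y => -dot u (theta g u) y) i x =
      -dot u (dot u (theta g u)) x := by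
    rw [dot, ← Finset.sum_neg_distrib]
    exact Finset.sum_congr rfl fun i _ => by rw [pd_neg]; ring
  rw [h2, h3, h.cu_eq x hx, pd_neg] at h1
  linear_combination -h1

/-- The relation between `u ∧ du` and `u ∧ da`. -/
theorem HasPlanarExpansion.wedge_eq (h : HasPlanarExpansion W g u m) (hW : IsOpen W)
    (hg : IsLorentzMetric W g) (hu : IsUnitTimelike W g u) {x : Pt} (hx : x ∈ W)
    (i j k : Fin 4) :
    -dot u (theta g u) x * wedge12 (lower g u) (extD (lower g u)) x i j k =
      2 * theta g u x * wedge12 (lower g u) (extD (acc g u)) x i j k := by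
  refine wedge_closed (h.closed hW hg hu hx) (A := -(2 * dot u (theta g u) x))
    (B := -(4 * theta g u x)) (fun j => ?_) i j k
  rw [pd_const_mul 2 ((smooth_theta hW hg hu.smooth).diffAt hW hx), h.grad_theta x hx j]
  ring

/-- The equation d(dθ̇) = 0 gives a second proportionality between u ∧ du and u ∧ da, next to
`wedge_eq`. Eliminating u ∧ da leaves a multiple of u ∧ du, which can be cancelled at a point where
ω ≠ 0. -/
theorem HasPlanarExpansion.ddot_theta (h : HasPlanarExpansion W g u m)
    (hD : HasVanishingNu W g u) (hW : IsOpen W) (hg : IsLorentzMetric W g)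
    (hu : IsUnitTimelike W g u) {x : Pt} (hx : x ∈ W) (hω : omega g u x ≠ 0) :
    2 * theta g u x * dot u (dot u (theta g u)) x =
      (3 * dot u (theta g u) x - 2 * m * theta g u x ^ 2) * dot u (theta g u) x := by
  obtain ⟨i, j, k, hijk⟩ := exists_ne_zero_of_hodge3 hω
  have hθ := smooth_theta hW hg hu.smooth
  have hθ1 := hθ.dot hu.smooth hW
  have hθ2 := hθ1.dot hu.smooth hW
  have hθθ : Smooth W fun y => theta g u y * theta g u y := hθ.mul hθ
  have hk : Smooth W fun y => 3 * dot u (theta g u) y - 2 * m * (theta g u y * theta g u y) :=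
    ((smooth_const 3).mul hθ1).sub ((smooth_const (2 * m)).mul hθθ)
  have h1 := closed_of_grad hW hg hu hθ1 hθ2.neg hk
    (fun y hy j => by rw [h.grad_dot_theta hD hW hg hu hy j]; ring) hx
  have h2 := wedge_closed h1 (A := -(3 * dot u (dot u (theta g u)) x) +
      4 * m * theta g u x * dot u (theta g u) x)
    (B := -3 * (3 * dot u (theta g u) x - 2 * m * theta g u x ^ 2) +
      8 * m * theta g u x ^ 2) (fun j => by
    rw [pd_sub ((hθ1.diffAt hW hx).const_mul 3) ((hθθ.diffAt hW hx).const_mul (2 * m)),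
      pd_const_mul 3 (hθ1.diffAt hW hx), pd_const_mul (2 * m) (hθθ.diffAt hW hx),
      pd_mul (hθ.diffAt hW hx) (hθ.diffAt hW hx), h.grad_dot_theta hD hW hg hu hx j,
      h.grad_theta x hx j]
    ring) i j k
  have h3 := h.wedge_eq hW hg hu hx i j k
  simp only [wedge12] at h3 hijk
  refine mul_right_cancel₀ hijk ?_
  linear_combination -2 * theta g u x * h2 +
    (3 * dot u (theta g u) x - 2 * m * theta g u x ^ 2) * h3

/-- A function `f` with `d(θ u - f a) = 0` and `γ̃[f] = μ`. -/
structure IsBaseSolution (U : Set Pt) (g : MetricField) (u : Field1) (f : Pt → ℝ) : Prop where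
  smooth : Smooth U f
  ne_zero : ∀ x ∈ U, f x ≠ 0
  closed : ∀ x ∈ U, ∀ i j,
    extD (fun y k => theta g u y * lower g u y k - f y * acc g u y k) x i j = 0
  evolution : ∀ x ∈ U, dot u f x = theta g u x * (mu g u x * f x - 1)

theorem isBaseSolution_of_locally
    (h : ∀ x ∈ U, ∃ W, IsOpen W ∧ x ∈ W ∧ W ⊆ U ∧ IsBaseSolution W g u f) :
    IsBaseSolution U g u f := by
  refine ⟨smooth_of_locally fun x hx => ?_, fun x hx => ?_, fun x hx => ?_, fun x hx => ?_⟩ <;>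
    obtain ⟨W, hW, hxW, -, hf⟩ := h x hx
  exacts [hf.smooth.contDiffAt hW hxW, hf.ne_zero x hxW, hf.closed x hxW, hf.evolution x hxW]

theorem extD_congr {ξ η : Field1} (hW : IsOpen W) {x : Pt} (hx : x ∈ W)
    (h : ∀ y ∈ W, ∀ i, ξ y i = η y i) (i j : Fin 4) : extD ξ x i j = extD η x i j := by
  rw [extD, extD, pd_congr hW hx fun y hy => h y hy j, pd_congr hW hx fun y hy => h y hy i]

/-- `d(h dq) = dh ∧ dq`. -/
theorem extD_mul_grad {h q : Pt → ℝ} (hW : IsOpen W) (hh : Smooth W h) (hq : Smooth W q) {x : Pt}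
    (hx : x ∈ W) (i j : Fin 4) : extD (fun y k => h y * pd q k y) x i j =
      pd h i x * pd q j x - pd h j x * pd q i x := by
  rw [extD, pd_mul (hh.diffAt hW hx) ((hq.pd hW j).diffAt hW hx),
    pd_mul (hh.diffAt hW hx) ((hq.pd hW i).diffAt hW hx), pd_comm hq hW hx i j]
  ring

/-- Substituting dθ shows θu - f₄a = -(θ/θ̇)dθ. By `ddot_theta` also dθ̇ is a multiple of dθ, so the
form is closed. The same relation for θ̈ yields the evolution equation. -/
theorem HasPlanarExpansion.isBaseSolution_f4 (h : HasPlanarExpansion W g u m)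
    (hD : HasVanishingNu W g u) (hW : IsOpen W) (hg : IsLorentzMetric W g)
    (hu : IsUnitTimelike W g u) (hω : ∀ x ∈ W, omega g u x ≠ 0)
    (hθ' : ∀ x ∈ W, dot u (theta g u) x ≠ 0) : IsBaseSolution W g u (f4 g u) := by
  have hθ := smooth_theta hW hg hu.smooth
  have hθ1 := hθ.dot hu.smooth hW
  have hθθ : Smooth W fun y => theta g u y ^ 2 := ContDiffOn.pow hθ 2
  have hnum : Smooth W fun y => -(2 * theta g u y ^ 2) := ((smooth_const 2).mul hθθ).neg
  have hq : Smooth W fun y => -theta g u y / dot u (theta g u) y := hθ.neg.div hθ1 hθ'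
  refine ⟨hnum.div hθ1 hθ', fun x hx => ?_, fun x hx i j => ?_, fun x hx => ?_⟩
  · exact div_ne_zero (neg_ne_zero.2 (mul_ne_zero two_ne_zero
      (pow_ne_zero 2 (hD.theta_ne x hx)))) (hθ' x hx)
  · rw [extD_congr hW hx (η := fun y k => -theta g u y / dot u (theta g u) y *
        pd (theta g u) k y) fun y hy k => ?_, extD_mul_grad hW hq hθ hx]
    · have h1 : ∀ k, pd (fun y => -theta g u y / dot u (theta g u) y) k x =
          (-dot u (theta g u) x + theta g u x * ((3 * dot u (theta g u) x -
            2 * m * theta g u x ^ 2) / (2 * theta g u x))) / dot u (theta g u) x ^ 2 *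
            pd (theta g u) k x := by
        intro k
        have hθx := hD.theta_ne x hx
        have hθ'x := hθ' x hx
        have h2 := h.ddot_theta hD hW hg hu hx (hω x hx)
        have h3 : pd (dot u (theta g u)) k x = (3 * dot u (theta g u) x -
            2 * m * theta g u x ^ 2) / (2 * theta g u x) * pd (theta g u) k x := by
          rw [h.grad_dot_theta hD hW hg hu hx k, h.grad_theta x hx k]
          field_simp
          linear_combination -lower g u x k * h2
        rw [pd_div (hθ.neg.diffAt hW hx) (hθ1.diffAt hW hx) hθ'x, pd_neg, h3]
        field_simp
        ring
      rw [h1, h1]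
      ring
    · have hθ'y := hθ' y hy
      rw [f4, h.grad_theta y hy k]
      field_simp
      ring
  · have hθx := hD.theta_ne x hx
    have hθ'x := hθ' x hx
    have h2 := h.ddot_theta hD hW hg hu hx (hω x hx)
    have h3 : dot u (fun y => -(2 * theta g u y ^ 2)) x =
        -4 * theta g u x * dot u (theta g u) x := by
      rw [show (fun y => -(2 * theta g u y ^ 2)) = fun y => (-2) * (theta g u y * theta g u y) from
        funext fun y => by ring, dot_const_mul _ ((hθ.mul hθ).diffAt hW hx),
        dot_mul (hθ.diffAt hW hx) (hθ.diffAt hW hx)]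
      ring
    have h4 : dot u (f4 g u) x = _ :=
      dot_div (hnum.diffAt hW hx) (hθ1.diffAt hW hx) hθ'x
    rw [h4, h3, mu, h.cu_eq x hx, f4]
    field_simp
    linear_combination h2

/-- Here f₅ = 1/m is constant, which settles the evolution equation. Vanishing vorticity gives u ∧
du = 0, hence u ∧ da = 0, so du = a ∧ u and da = -mθ a ∧ u. In d(θu - a/m) the coefficients of a ∧ u
are -2θ, θ and θ. -/
theorem HasPlanarExpansion.isBaseSolution_f5 (h : HasPlanarExpansion W g u m) (hm : m ≠ 0)
    (hD : HasVanishingNu W g u) (hW : IsOpen W) (hg : IsLorentzMetric W g)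
    (hu : IsUnitTimelike W g u) (hω : ∀ x ∈ W, omega g u x = 0) :
    IsBaseSolution W g u (f5 g u) := by
  have hθ := smooth_theta hW hg hu.smooth
  have hl := smooth_lower hg hu.smooth
  have ha := smooth_acc hW hg hu.smooth
  have hf : ∀ x ∈ W, f5 g u x = 1 / m := by
    intro x hx
    have hθx := hD.theta_ne x hx
    rw [f5, h.cu_eq x hx]
    field_simp
  refine ⟨ContDiffOn.congr (smooth_const (1 / m)) hf, fun x hx => ?_, fun x hx i j => ?_,
    fun x hx => ?_⟩
  · rw [hf x hx]
    exact one_div_ne_zero hm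
  · have hθx := hD.theta_ne x hx
    have h1 : ∀ i j k, wedge12 (lower g u) (extD (lower g u)) x i j k = 0 :=
      eq_zero_of_hodge3_eq_zero hg hx (isAlternating3_wedge12_extD _ _ _) (hω x hx)
    have h2 : ∀ i j k, wedge12 (lower g u) (extD (acc g u)) x i j k = 0 := by
      intro i j k
      have h3 := h.wedge_eq hW hg hu hx i j k
      rw [h1, mul_zero] at h3
      exact (mul_eq_zero.1 h3.symm).resolve_left (mul_ne_zero two_ne_zero hθx)
    -- Contracting u ∧ F = 0 with u expresses F through i(u)F, because u² = -1.
    have hcontr : ∀ F : Field2, (∀ i j, F x i j = -F x j i) →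
        (∀ i j k, wedge12 (lower g u) F x i j k = 0) → ∀ j k, F x j k =
          lower g u x k * (∑ l, u x l * F x l j) - lower g u x j * (∑ l, u x l * F x l k) := by
      intro F hF hwF j k
      have h3 : ∑ l, u x l * wedge12 (lower g u) F x l j k = 0 :=
        Finset.sum_eq_zero fun l _ => by rw [hwF, mul_zero]
      have h4 : ∑ l, u x l * wedge12 (lower g u) F x l j k =
          (∑ l, lower g u x l * u x l) * F x j k
          - lower g u x j * (∑ l, u x l * F x l k)
          + lower g u x k * (∑ l, u x l * F x l j) := by
        rw [Finset.sum_mul, Finset.mul_sum, Finset.mul_sum, ← Finset.sum_sub_distrib,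
          ← Finset.sum_add_distrib]
        refine Finset.sum_congr rfl fun l _ => ?_
        simp only [wedge12]
        rw [hF k l]
        ring
      rw [h3, hu.unit x hx] at h4
      linear_combination h4
    have h5 := hcontr _ (extD_antisymm _ x) h1 i j
    have h6 := hcontr _ (extD_antisymm _ x) h2 i j
    simp only [sum_extD_lower] at h5
    simp only [interior_extD_acc hg hu hx (hD.acc_ne x hx) (hD.vVec_eq x hx), h.cu_eq x hx] at h6
    have h7 : extD (fun y k => theta g u y * lower g u y k - f5 g u y * acc g u y k) x i j =
        pd (theta g u) i x * lower g u x j - pd (theta g u) j x * lower g u x i +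
          theta g u x * extD (lower g u) x i j - 1 / m * extD (acc g u) x i j := by
      rw [extD_congr hW hx (η := fun y k => theta g u y * lower g u y k - 1 / m * acc g u y k)
        fun y hy k => by rw [hf y hy]]
      simp only [extD]
      rw [pd_sub ((hθ.mul (hl j)).diffAt hW hx) (((ha j).diffAt hW hx).const_mul _),
        pd_sub ((hθ.mul (hl i)).diffAt hW hx) (((ha i).diffAt hW hx).const_mul _),
        pd_mul (hθ.diffAt hW hx) ((hl j).diffAt hW hx),
        pd_mul (hθ.diffAt hW hx) ((hl i).diffAt hW hx),
        pd_const_mul _ ((ha j).diffAt hW hx), pd_const_mul _ ((ha i).diffAt hW hx)]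
      ring
    rw [h7, h5, h6, h.grad_theta x hx i, h.grad_theta x hx j]
    field_simp
    ring
  · have hθx := hD.theta_ne x hx
    rw [dot_congr hW hx hf, dot_const, hf x hx, mu, h.cu_eq x hx]
    field_simp
    ring

end VanishingNu

/-! ## Integrant factors of the acceleration -/

section AccPotential

variable {U W : Set Pt} {g : MetricField} {u : Field1} {γ m : ℝ} {ρ p f ψ α β : Pt → ℝ}

theorem locally_isAccPotential (hU : IsOpen U) (hg : IsLorentzMetric U g)
    (hu : IsUnitTimelike U g u) (ha : ∀ x ∈ U, acc g u x ≠ 0) (hv : ∀ x ∈ U, vVec g u x = 0) :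
    Locally U fun W => ∃ α β : Pt → ℝ, IsAccPotential W g u α β := by
  intro x hx
  obtain ⟨W, α, β, hW, hxW, hWU, hα, hβ, h⟩ := exists_integrating_factor_components hU
    (smooth_acc hU hg hu.smooth) (fun y hy => wedge_acc_eq_zero hg hy (hv y hy)) hx (ha x hx)
  exact ⟨W, hW, hxW, hWU, α, β, hα, hβ, fun y hy => (h y hy).1, fun y hy => (h y hy).2⟩

theorem IsAccPotential.dot_alpha (h : IsAccPotential W g u α β) {x : Pt} (hx : x ∈ W) :
    dot u α x = 0 := by
  have h1 := sum_mul_acc g u x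
  simp only [dot, h.potential x hx]
  rw [← mul_zero (β x), ← h1, Finset.mul_sum]
  exact Finset.sum_congr rfl fun i _ => by ring

/-- Contract d(βa) = 0 with u, using i(u)da = -(c,u)a; the coefficient of a is read off at a nonzero
component. -/
theorem IsAccPotential.dot_beta (h : IsAccPotential W g u α β) (hW : IsOpen W)
    (hg : IsLorentzMetric W g) (hu : IsUnitTimelike W g u) {x : Pt} (hx : x ∈ W)
    (ha : acc g u x ≠ 0) (hv : vVec g u x = 0) : dot u β x = β x * cu g u x := by
  obtain ⟨j, hj⟩ := Function.ne_iff.1 ha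
  have h1 := contract_closed (closed_of_grad hW hg hu h.smooth_alpha (smooth_const 0)
    h.smooth_beta.neg (fun y hy j => by rw [h.potential y hy j]; ring) hx) (hu.unit x hx)
    (sum_mul_acc g u x) (sum_extD_lower g u x) (interior_extD_acc hg hu hx ha hv) j
  have h2 : ∑ i, u x i * pd (fun y => -β y) i x = -dot u β x := by
    rw [dot, ← Finset.sum_neg_distrib]
    exact Finset.sum_congr rfl fun i _ => by rw [pd_neg]; ring
  simp only [pd_const, mul_zero, Finset.sum_const_zero, neg_zero, zero_mul, zero_add, sub_zero,
    h2] at h1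
  have := (mul_eq_zero.1 h1.symm).resolve_right hj
  linarith

theorem IsAccPotential.exists_pd_ne_zero (h : IsAccPotential W g u α β) {x : Pt} (hx : x ∈ W)
    (ha : acc g u x ≠ 0) : ∃ i, pd α i x ≠ 0 := by
  obtain ⟨i, hi⟩ := Function.ne_iff.1 ha
  exact ⟨i, by rw [h.potential x hx]; exact mul_ne_zero (h.ne_zero x hx) hi⟩

theorem contDiffAt_comp_scalar {φ : ℝ → ℝ} {x : Pt} (hφ : ContDiffAt ℝ ∞ φ (α x))
    (hα : ContDiffAt ℝ ∞ α x) : ContDiffAt ℝ ∞ (fun y => φ (α y)) x :=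
  ContDiffAt.comp x hφ hα

/-- Two functions with `dh ∧ dα = 0` and `dα ≠ 0` are functionally dependent. -/
theorem exists_eq_comp_of_wedge_eq_zero (hW : IsOpen W) {h : Pt → ℝ} (hα : Smooth W α)
    (hh : Smooth W h) (hne : ∀ x ∈ W, ∃ i, pd α i x ≠ 0)
    (hwedge : ∀ x ∈ W, ∀ i j, pd h i x * pd α j x = pd h j x * pd α i x) {x₀ : Pt}
    (hx₀ : x₀ ∈ W) :
    ∃ (W' : Set Pt) (H : ℝ → ℝ), IsOpen W' ∧ x₀ ∈ W' ∧ W' ⊆ W ∧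
      ∀ x ∈ W', ContDiffAt ℝ ∞ H (α x) ∧ h x = H (α x) := by
  have hk : ∀ x, ∃ k, x ∈ W → ∀ i, pd h i x = k * pd α i x := by
    intro x
    by_cases hx : x ∈ W
    · obtain ⟨j, hj⟩ := hne x hx
      refine ⟨pd h j x / pd α j x, fun _ i => ?_⟩
      rw [div_mul_eq_mul_div, eq_div_iff hj]
      exact hwedge x hx i j
    · exact ⟨0, fun h => absurd h hx⟩
  choose k hk using hk
  obtain ⟨i₀, hi₀⟩ := hne x₀ hx₀
  obtain ⟨W', r, H, hW', hxW', hsub, hH, hval⟩ := exists_eq_comp_scalar hW hα hh hk hx₀ hi₀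
  exact ⟨W', H, hW', hxW', hsub, fun x hx =>
    ⟨hH.contDiffAt (isOpen_ball.mem_nhds (hval x hx).1), (hval x hx).2⟩⟩

/-- The added term βφ(α)a = φ(α)dα is closed, so the Poincaré lemma applies to the sum. -/
theorem IsBaseSolution.exists_psi (hf : IsBaseSolution U g u f) (hU : IsOpen U)
    (hg : IsLorentzMetric U g) (hu : IsUnitTimelike U g u) (hαβ : IsAccPotential U g u α β)
    {φ : ℝ → ℝ} (hφ : ∀ x ∈ U, ContDiffAt ℝ ∞ φ (α x)) :
    Locally U fun W => ∃ ψ : Pt → ℝ, IsPsi W g u (fun y => f y + β y * φ (α y)) ψ := by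
  intro x hx
  have hφα : Smooth U fun y => φ (α y) := smooth_of_locally fun y hy =>
    contDiffAt_comp_scalar (hφ y hy) (hαβ.smooth_alpha.contDiffAt hU hy)
  have hξ : ∀ k, Smooth U fun y => theta g u y * lower g u y k - f y * acc g u y k := fun k =>
    ((smooth_theta hU hg hu.smooth).mul (smooth_lower hg hu.smooth k)).sub
      (hf.smooth.mul (smooth_acc hU hg hu.smooth k))
  have hη : ∀ k, Smooth U fun y => φ (α y) * pd α k y := fun k =>
    hφα.mul (hαβ.smooth_alpha.pd hU k)
  have hcl : ∀ y ∈ U, ∀ i j, extD (fun y k =>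
      (theta g u y * lower g u y k - f y * acc g u y k) - φ (α y) * pd α k y) y i j = 0 := by
    intro y hy i j
    have h1 := hf.closed y hy i j
    have h2 := extD_mul_grad hU hφα hαβ.smooth_alpha hy i j
    have hφd : DifferentiableAt ℝ φ (α y) := (hφ y hy).differentiableAt (by simp)
    have hαd := hαβ.smooth_alpha.diffAt hU hy
    rw [pd_comp hφd hαd, pd_comp hφd hαd] at h2
    simp only [extD] at h1 h2 ⊢
    rw [pd_sub ((hξ j).diffAt hU hy) ((hη j).diffAt hU hy),
      pd_sub ((hξ i).diffAt hU hy) ((hη i).diffAt hU hy)]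
    linear_combination h1 - h2
  obtain ⟨W, ψ, hW, hxW, hWU, hψ, hpot⟩ := exists_potential hU
    (fun k => (hξ k).sub (hη k)) hcl hx
  refine ⟨W, hW, hxW, hWU, ψ, hψ, fun y hy i => ?_⟩
  rw [hpot y hy i, hαβ.potential y (hWU hy) i]
  ring

/-- The inverse problem when a base solution is known. -/
theorem IsBaseSolution.isCIGPair_iff (hf : IsBaseSolution U g u f) (hU : IsOpen U)
    (hg : IsLorentzMetric U g) (hu : IsUnitTimelike U g u) (hD : HasVanishingNu U g u)
    (hαβ : IsAccPotential U g u α β) (hγ : 1 < γ) :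
    IsCIGPair U g u γ ρ p ↔
      IsAdmissible U γ ρ p ∧ Locally U fun W => H78 W g u γ ρ p α β f := by
  have hgt : ∀ x ∈ U, gammaTilde g u f x = mu g u x := by
    intro x hx
    have h1 := hf.ne_zero x hx
    have h2 := hD.theta_ne x hx
    rw [gammaTilde, hf.evolution x hx]
    field_simp
    ring
  constructor
  · intro h
    have hpair := (ClassicalIdealGas.isCIGPair_iff hU hγ).1 h
    refine ⟨hpair.2.2.1, fun x hx => ?_⟩
    have hpot := h.isGasPotential hU
    set F : Pt → ℝ := fun x => (ρ x + p x) / (γ * p x) with hF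
    have hq : Smooth U fun y => (F y - f y) / β y :=
      (hpot.smooth_f.sub hf.smooth).div hαβ.smooth_beta hαβ.ne_zero
    have hα := hαβ.smooth_alpha
    -- The forms θu - fa and θu - Fa are both closed, so their difference (F-f)a = ((F-f)/β)dα is
    -- closed too.
    have hwedge : ∀ y ∈ U, ∀ i j, pd (fun y => (F y - f y) / β y) i y * pd α j y =
        pd (fun y => (F y - f y) / β y) j y * pd α i y := by
      intro y hy i j
      have h1 := extD_mul_grad hU hq hα hy i j
      have hψ := hpot.psi.smooth
      have hξ : ∀ k, Smooth U fun y => theta g u y * lower g u y k - f y * acc g u y k :=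
        fun k => ((smooth_theta hU hg hu.smooth).mul (smooth_lower hg hu.smooth k)).sub
          (hf.smooth.mul (smooth_acc hU hg hu.smooth k))
      have h2 : ∀ z ∈ U, ∀ k, (F z - f z) / β z * pd α k z =
          (theta g u z * lower g u z k - f z * acc g u z k) -
            pd (fun x => Real.log (p x) / γ) k z := by
        intro z hz k
        have := hαβ.ne_zero z hz
        rw [hαβ.potential z hz, hpot.psi.potential z hz]
        field_simp
        ring
      rw [extD_congr hU hy h2] at h1
      have h3 := hf.closed y hy i j
      have h4 := pd_comm hψ hU hy i j
      simp only [extD] at h1 h3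
      rw [pd_sub ((hξ j).diffAt hU hy) ((hψ.pd hU j).diffAt hU hy),
        pd_sub ((hξ i).diffAt hU hy) ((hψ.pd hU i).diffAt hU hy)] at h1
      linear_combination -h1 + h3 - h4
    obtain ⟨W, H, hW, hxW, hWU, hH⟩ := exists_eq_comp_of_wedge_eq_zero hU hα hq
      (fun y hy => hαβ.exists_pd_ne_zero hy (hD.acc_ne y hy)) hwedge hx
    have hFH : ∀ y ∈ W, f y + β y * H (α y) = F y := by
      intro y hy
      have := hαβ.ne_zero y (hWU hy)
      rw [← (hH y hy).2]
      field_simp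
      ring
    refine ⟨W, hW, hxW, hWU, 1, H, _, ⟨hpot.psi.smooth.mono hWU, fun y hy i => ?_⟩,
      fun y hy => ⟨(hH y hy).1, ?_, ?_, ?_⟩⟩
    · rw [hpot.psi.potential y (hWU hy), hFH y hy]
    · rw [hgt y (hWU hy), hD.mu_eq hU hg hu h (hWU hy)]
      ring
    · rw [one_mul]
      exact h.p_eq hU (hWU hy)
    · rw [hFH y hy]
      exact h.rho_eq hU (hWU hy)
  · rintro ⟨hadm, hloc⟩
    refine isCIGPair_of_isGasPotential hU hu hγ hadm fun x hx => ?_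
    obtain ⟨W, hW, hxW, hWU, C, φ, ψ, hψ, hval⟩ := hloc x hx
    refine ⟨W, hW, hxW, hWU, C, fun y => f y + β y * φ (α y), ψ,
      ⟨hψ.smooth_f hW (hg.mono hWU) (hu.mono hWU) fun y hy => hD.acc_ne y (hWU hy), hψ,
        fun y hy => ?_⟩, fun y hy => ⟨(hval y hy).2.2.1, (hval y hy).2.2.2⟩⟩
    obtain ⟨hφ, hγf, -, -⟩ := hval y hy
    have hyU := hWU hy
    have hθ := hD.theta_ne y hyU
    have hfd := hf.smooth.diffAt hU hyU
    have hαd := hαβ.smooth_alpha.diffAt hU hyU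
    have hβd := hαβ.smooth_beta.diffAt hU hyU
    have hφd : DifferentiableAt ℝ φ (α y) := hφ.differentiableAt (by simp)
    have hφα : DifferentiableAt ℝ (fun z => φ (α z)) y :=
      (contDiffAt_comp_scalar hφ (hαβ.smooth_alpha.contDiffAt hU hyU)).differentiableAt (by simp)
    have hμ : mu g u y = γ - 1 := by
      rw [← hgt y hyU]
      linarith
    have hcu : cu g u y = theta g u y * (γ - 1) := by
      rw [← hμ, mu]
      field_simp
    have hβφ : DifferentiableAt ℝ (fun z => β z * φ (α z)) y := hβd.mul hφα
    -- Since α̇ = 0 and β̇ = (c,u)β = (γ-1)θβ, the term βφ(α) solves the homogeneous part of the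
    -- evolution equation.
    rw [dot_add hfd hβφ, dot_mul hβd hφα, dot_comp hφd hαd, hαβ.dot_alpha hyU,
      hαβ.dot_beta hU hg hu hyU (hD.acc_ne y hyU) (hD.vVec_eq y hyU), hf.evolution y hyU, hμ, hcu]
    ring

end AccPotential

/-! ### The classes C₇ and C₈ for the velocity of a gas -/

section Classes

variable {U : Set Pt} {g : MetricField} {u : Field1} {γ : ℝ} {ρ p f ψ α β : Pt → ℝ}

theorem IsC7.hasVanishingNu (h : IsC7 U g u) : HasVanishingNu U g u :=
  ⟨fun x hx => (h x hx).1, fun x hx => (h x hx).2.1, fun x hx => (h x hx).2.2.1,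
    fun x hx => (h x hx).2.2.2.1⟩

theorem IsC8.hasVanishingNu (h : IsC8 U g u) : HasVanishingNu U g u :=
  ⟨fun x hx => (h x hx).1, fun x hx => (h x hx).2.1, fun x hx => (h x hx).2.2.1,
    fun x hx => (h x hx).2.2.2.1⟩

/-- Here m = γ-1 for the gas supplied near the point. It could a priori change from one
neighbourhood to another, so the constant is only claimed locally. -/
theorem HasVanishingNu.locally_hasPlanarExpansion (hD : HasVanishingNu U g u)
    (hg : IsLorentzMetric U g) (hu : IsUnitTimelike U g u) (hCIG : IsCIGVelocity U g u) :
    Locally U fun W => ∃ m : ℝ, 0 < m ∧ HasPlanarExpansion W g u m := by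
  intro x hx
  obtain ⟨W, hW, hxW, hWU, γ, ρ, p, h⟩ := hCIG x hx
  exact ⟨W, hW, hxW, hWU, γ - 1, by linarith [h.one_lt],
    (hD.mono hWU).hasPlanarExpansion hW (hg.mono hWU) (hu.mono hWU) h⟩

/-- A set meeting every neighbourhood of every point of `U` is dense in `U`. -/
theorem subset_closure_of_locally {S : Set Pt}
    (h : ∀ W : Set Pt, IsOpen W → W ⊆ U → W.Nonempty → (W ∩ S).Nonempty) (hU : IsOpen U) :
    U ⊆ closure S := by
  intro x hx
  rw [_root_.mem_closure_iff]
  intro o ho hxo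
  obtain ⟨y, hy, hyS⟩ := h (o ∩ U) (ho.inter hU) inter_subset_right ⟨x, hxo, hx⟩
  exact ⟨y, hy.1, hyS⟩

/-- If θ̇ vanished on an open set, so would its gradient, and the a-component in `grad_dot_theta`
would read 2mθ²a = 0 with m > 0, θ ≠ 0 and a ≠ 0. -/
theorem IsC7.subset_closure (h : IsC7 U g u) (hU : IsOpen U) (hg : IsLorentzMetric U g)
    (hu : IsUnitTimelike U g u) (hCIG : IsCIGVelocity U g u) :
    U ⊆ closure {x ∈ U | dot u (theta g u) x ≠ 0} := by
  refine subset_closure_of_locally (fun W hW hWU ⟨x, hx⟩ => ?_) hU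
  by_contra hne
  rw [not_nonempty_iff_eq_empty] at hne
  have h0 : ∀ y ∈ W, dot u (theta g u) y = 0 := by
    intro y hy
    by_contra hy0
    have : y ∈ W ∩ {x ∈ U | dot u (theta g u) x ≠ 0} := ⟨hy, hWU hy, hy0⟩
    rw [hne] at this
    exact this
  obtain ⟨V, hV, hxV, hVU, m, hm, hP⟩ :=
    h.hasVanishingNu.locally_hasPlanarExpansion hg hu hCIG x (hWU hx)
  obtain ⟨j, hj⟩ := Function.ne_iff.1 (h x (hWU hx)).2.1
  have h1 := hP.grad_dot_theta (h.hasVanishingNu.mono hVU) hV (hg.mono hVU) (hu.mono hVU) hxV j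
  have h2 : ∀ i, pd (dot u (theta g u)) i x = 0 := by
    intro i
    rw [pd_congr hW hx h0, pd_const]
  have h3 : dot u (dot u (theta g u)) x = 0 := by
    rw [dot]
    exact Finset.sum_eq_zero fun i _ => by rw [h2, mul_zero]
  rw [h2, h3, h0 x hx] at h1
  have h4 : 2 * m * theta g u x ^ 2 * acc g u x j = 0 := by linarith
  exact mul_ne_zero (mul_ne_zero (by positivity) (pow_ne_zero 2 (h x (hWU hx)).1)) hj h4

theorem IsC7.isBaseSolution (h : IsC7 U g u) (hg : IsLorentzMetric U g)
    (hu : IsUnitTimelike U g u) (hCIG : IsCIGVelocity U g u)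
    (hθ : ∀ x ∈ U, dot u (theta g u) x ≠ 0) : IsBaseSolution U g u (f4 g u) := by
  refine isBaseSolution_of_locally fun x hx => ?_
  obtain ⟨V, hV, hxV, hVU, m, -, hP⟩ :=
    h.hasVanishingNu.locally_hasPlanarExpansion hg hu hCIG x hx
  exact ⟨V, hV, hxV, hVU, hP.isBaseSolution_f4 (h.hasVanishingNu.mono hVU) hV (hg.mono hVU)
    (hu.mono hVU) (fun y hy => (h y (hVU hy)).2.2.2.2) fun y hy => hθ y (hVU hy)⟩

theorem IsC8.isBaseSolution (h : IsC8 U g u) (hg : IsLorentzMetric U g)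
    (hu : IsUnitTimelike U g u) (hCIG : IsCIGVelocity U g u) :
    IsBaseSolution U g u (f5 g u) := by
  refine isBaseSolution_of_locally fun x hx => ?_
  obtain ⟨V, hV, hxV, hVU, m, hm, hP⟩ :=
    h.hasVanishingNu.locally_hasPlanarExpansion hg hu hCIG x hx
  exact ⟨V, hV, hxV, hVU, hP.isBaseSolution_f5 hm.ne' (h.hasVanishingNu.mono hVU) hV (hg.mono hVU)
    (hu.mono hVU) fun y hy => (h y (hVU hy)).2.2.2.2⟩

theorem IsC8.cu_ne_zero (h : IsC8 U g u) (hg : IsLorentzMetric U g)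
    (hu : IsUnitTimelike U g u) (hCIG : IsCIGVelocity U g u) : ∀ x ∈ U, cu g u x ≠ 0 := by
  intro x hx
  obtain ⟨V, -, hxV, -, m, hm, hP⟩ :=
    h.hasVanishingNu.locally_hasPlanarExpansion hg hu hCIG x hx
  rw [hP.cu_eq x hxV]
  exact mul_ne_zero hm.ne' (h x hx).1

end Classes

/-! ## The classes `C₃`, ..., `C₆` -/

section Generic

variable {U W : Set Pt} {g : MetricField} {u : Field1} {γ : ℝ} {ρ p f ψ : Pt → ℝ}

theorem IsCIGPair.isAdmissible (hU : IsOpen U) (h : IsCIGPair U g u γ ρ p) :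
    IsAdmissible U γ ρ p :=
  ((isCIGPair_iff hU h.one_lt).1 h).2.2.1

theorem IsCIGPair.H3456 (hU : IsOpen U) (hθ : ∀ x ∈ U, theta g u x ≠ 0)
    (h : IsCIGPair U g u γ ρ p) :
    H3456 U g u γ ρ p fun x => (ρ x + p x) / (γ * p x) := by
  have hpot := h.isGasPotential hU
  refine ⟨1, _, hpot.psi, fun x hx => ⟨?_, ?_, h.rho_eq hU hx⟩⟩
  · have h1 := h.one_lt_mul hU hx
    have h2 : (ρ x + p x) / (γ * p x) ≠ 0 := by
      intro h0
      rw [h0] at h1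
      linarith
    exact (gammaTilde_eq_iff (f := fun x => (ρ x + p x) / (γ * p x)) (hθ x hx) h2).2
      (hpot.evolution x hx)
  · rw [one_mul]
    exact h.p_eq hU hx

theorem H3456.congr {f' : Pt → ℝ} (hW : IsOpen W) (h : H3456 W g u γ ρ p f)
    (hf : ∀ x ∈ W, f x = f' x) : H3456 W g u γ ρ p f' := by
  obtain ⟨C, ψ, hψ, hval⟩ := h
  refine ⟨C, ψ, ⟨hψ.smooth, fun x hx i => by rw [hψ.potential x hx, hf x hx]⟩, fun x hx => ?_⟩
  have h1 : gammaTilde g u f x = gammaTilde g u f' x := by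
    rw [gammaTilde, gammaTilde, hf x hx, dot_congr hW hx hf]
  rw [← h1, ← hf x hx]
  exact hval x hx

theorem isCIGPair_of_locally_H3456 (hU : IsOpen U) (hg : IsLorentzMetric U g)
    (hu : IsUnitTimelike U g u) (hθ : ∀ x ∈ U, theta g u x ≠ 0) (ha : ∀ x ∈ U, acc g u x ≠ 0)
    (hγ : 1 < γ) (hadm : IsAdmissible U γ ρ p)
    (h : Locally U fun W => ∃ f, H3456 W g u γ ρ p f) : IsCIGPair U g u γ ρ p := by
  refine isCIGPair_of_isGasPotential hU hu hγ hadm fun x hx => ?_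
  obtain ⟨W, hW, hxW, hWU, f, C, ψ, hψ, hval⟩ := h x hx
  refine ⟨W, hW, hxW, hWU, C, f, ψ, ⟨hψ.smooth_f hW (hg.mono hWU) (hu.mono hWU)
    fun y hy => ha y (hWU hy), hψ, fun y hy => ?_⟩, fun y hy => (hval y hy).2⟩
  have h1 := (hval y hy).1
  exact (gammaTilde_eq_iff (hθ y (hWU hy)) (ne_zero_of_gammaTilde hγ h1)).1 h1

/-- The class enters only through `hf`, which says that f is forced. In the converse the relations
themselves already form a gas potential, whatever f is. -/
theorem isCIGPair_iff_H3456 (hU : IsOpen U) (hg : IsLorentzMetric U g)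
    (hu : IsUnitTimelike U g u) (hθ : ∀ x ∈ U, theta g u x ≠ 0) (ha : ∀ x ∈ U, acc g u x ≠ 0)
    (hγ : 1 < γ)
    (hf : ∀ F ψ, IsGasPotential U g u γ F ψ → ∀ x ∈ U, F x = f x) :
    IsCIGPair U g u γ ρ p ↔
      IsAdmissible U γ ρ p ∧ Locally U fun W => H3456 W g u γ ρ p f := by
  constructor
  · intro h
    exact ⟨h.isAdmissible hU, fun x hx => ⟨U, hU, hx, subset_rfl,
      (h.H3456 hU hθ).congr hU (hf _ _ (h.isGasPotential hU))⟩⟩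
  · rintro ⟨hadm, hloc⟩
    refine isCIGPair_of_locally_H3456 hU hg hu hθ ha hγ hadm fun x hx => ?_
    obtain ⟨W, hW, hxW, hWU, h⟩ := hloc x hx
    exact ⟨W, hW, hxW, hWU, f, h⟩

/-- The quadratic equation is needed only for necessity. For sufficiency the potential ψ and the
relation for γ are enough, so it does not matter which root f takes. -/
theorem isCIGPair_iff_H5 (hU : IsOpen U) (hg : IsLorentzMetric U g) (hu : IsUnitTimelike U g u)
    (h5 : IsC5 U g u) (hγ : 1 < γ) :
    IsCIGPair U g u γ ρ p ↔ IsAdmissible U γ ρ p ∧ Locally U fun W => H5 W g u γ ρ p := by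
  have hθ : ∀ x ∈ U, theta g u x ≠ 0 := fun x hx => (h5 x hx).1
  have ha : ∀ x ∈ U, acc g u x ≠ 0 := fun x hx => (h5 x hx).2.1
  constructor
  · intro h
    have hpot := h.isGasPotential hU
    refine ⟨h.isAdmissible hU, fun x hx => ⟨U, hU, hx, subset_rfl, _, hpot.smooth_f,
      fun y hy => ?_, h.H3456 hU hθ⟩⟩
    exact eq_fPlus_or_fMinus (h5 y hy).2.2.2.2
      (hpot.quadratic hU hg hu hθ ha (fun z hz => (h5 z hz).2.2.1) hy)
  · rintro ⟨hadm, hloc⟩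
    refine isCIGPair_of_locally_H3456 hU hg hu hθ ha hγ hadm fun x hx => ?_
    obtain ⟨W, hW, hxW, hWU, f, -, -, h⟩ := hloc x hx
    exact ⟨W, hW, hxW, hWU, f, h⟩

/-- If the linear coefficient vanished on an open set, the quadratic would reduce to θν(1-ν) = 0, so
ν = 1 and ν̇ = 0, and therefore μ = 0. Then ν = (γ-1-μ)f gives (γ-1)f = 1, against positivity of the
matter density. -/
theorem IsC6.subset_closure (h6 : IsC6 U g u) (hU : IsOpen U) (hg : IsLorentzMetric U g)
    (hu : IsUnitTimelike U g u) (hCIG : IsCIGVelocity U g u) :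
    U ⊆ closure {x ∈ U | linCoeff g u x ≠ 0} := by
  refine subset_closure_of_locally (fun W hW hWU ⟨x, hx⟩ => ?_) hU
  by_contra hne
  rw [not_nonempty_iff_eq_empty] at hne
  have h0 : ∀ y ∈ W, linCoeff g u y = 0 := by
    intro y hy
    by_contra hy0
    have : y ∈ W ∩ {x ∈ U | linCoeff g u x ≠ 0} := ⟨hy, hWU hy, hy0⟩
    rw [hne] at this
    exact this
  obtain ⟨V, hV, hxV, hVU, γ, ρ, p, h⟩ := hCIG x (hWU hx)
  have hpot := h.isGasPotential hV
  have hν : ∀ y ∈ V ∩ W, nu g u y = 1 := by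
    rintro y ⟨hyV, hyW⟩
    have h1 := hpot.quadratic hV (hg.mono hVU) (hu.mono hVU) (fun z hz => (h6 z (hVU hz)).1)
      (fun z hz => (h6 z (hVU hz)).2.1) (fun z hz => (h6 z (hVU hz)).2.2.1) hyV
    obtain ⟨hθ, -, -, hν, hμ⟩ := h6 y (hVU hyV)
    rw [hμ, h0 y hyW, zero_mul, zero_mul, zero_add, zero_add] at h1
    have := (mul_eq_zero.1 h1).resolve_left (mul_ne_zero hθ hν)
    linarith
  have hx' : x ∈ V ∩ W := ⟨hxV, hx⟩
  obtain ⟨hθ, ha, hv, -, -⟩ := h6 x (hWU hx)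
  have h2 := h0 x hx
  rw [linCoeff, dot_congr (hV.inter hW) hx' hν, dot_const, hν x hx'] at h2
  have h3 : mu g u x = 0 := by
    have : theta g u x * mu g u x = 0 := by linarith
    exact (mul_eq_zero.1 this).resolve_left hθ
  have h4 := hpot.nu_eq hV (hg.mono hVU) (hu.mono hVU) hxV hθ ha hv
  rw [hν x hx', h3, sub_zero] at h4
  have h5 := h.one_lt_mul hV hxV
  linarith

end Generic

/-! ## The classes `C₁` and `C₂` -/

section Expansion

variable {U W : Set Pt} {g : MetricField} {u : Field1} {γ : ℝ} {ρ p f ψ α β t : Pt → ℝ}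
  {φ : Pt → Fin 3 → ℝ} {I : ℝ → ℝ}

theorem isCIGPair_of_pointwise (hU : IsOpen U) (hγ : 1 < γ) (hadm : IsAdmissible U γ ρ p)
    (h : ∀ x ∈ U, ContDiffAt ℝ ∞ ρ x ∧ ContDiffAt ℝ ∞ p x ∧
      (∀ i, pd p i x + dot u p x * lower g u x i + (ρ x + p x) * acc g u x i = 0) ∧
      dot u ρ x + (ρ x + p x) * theta g u x = 0 ∧ dot u p x = -(γ * p x * theta g u x)) :
    IsCIGPair U g u γ ρ p :=
  (isCIGPair_iff hU hγ).2 ⟨smooth_of_locally fun x hx => (h x hx).1,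
    smooth_of_locally fun x hx => (h x hx).2.1, hadm, fun x hx => (h x hx).2.2.1,
    fun x hx => (h x hx).2.2.2.1, fun x hx => (h x hx).2.2.2.2⟩

theorem locally_isInvariants (hU : IsOpen U) (hu : IsUnitTimelike U g u) :
    Locally U fun W => ∃ φ : Pt → Fin 3 → ℝ, IsInvariants W u φ := by
  intro x hx
  obtain ⟨W, φ, hW, hxW, hWU, hφ⟩ := exists_isInvariants hU hu.smooth hx (hu.ne_zero hx)
  exact ⟨W, hW, hxW, hWU, φ, hφ⟩

theorem IsInvariants.contDiffAt (hφ : IsInvariants U u φ) (hU : IsOpen U) {x : Pt} (hx : x ∈ U) :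
    ContDiffAt ℝ ∞ φ x :=
  contDiffAt_pi.2 fun m => (hφ.smooth m).contDiffAt hU hx

theorem IsInvariants.dot_comp (hφ : IsInvariants U u φ) (hU : IsOpen U) {x : Pt} (hx : x ∈ U)
    {R : (Fin 3 → ℝ) → ℝ} (hR : ContDiffAt ℝ ∞ R (φ x)) : dot u (fun y => R (φ y)) x = 0 := by
  have h1 : HasFDerivAt φ (fderiv ℝ φ x) x :=
    ((hφ.contDiffAt hU hx).differentiableAt (by simp)).hasFDerivAt
  have h2 : fderiv ℝ φ x (u x) = 0 := by
    funext m
    have h3 := hφ.invariant x hx m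
    rw [dot_eq_fderiv, (hasFDerivAt_pi'.1 h1 m).fderiv] at h3
    exact h3
  have h4 := (hR.differentiableAt (by simp)).hasFDerivAt.comp x h1
  rw [dot_eq_fderiv]
  change fderiv ℝ (R ∘ φ) x (u x) = 0
  rw [h4.fderiv, ContinuousLinearMap.comp_apply, h2, map_zero]

/-- With θ = 0 and a = 0 the equations reduce to dp = 0 and ρ̇ = 0. -/
theorem isCIGPair_iff_H1Geodesic (hU : IsOpen U) (hu : IsUnitTimelike U g u)
    (hθ : ∀ x ∈ U, theta g u x = 0) (ha : ∀ x ∈ U, acc g u x = 0) (hφ : IsInvariants U u φ)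
    (hγ : 1 < γ) :
    IsCIGPair U g u γ ρ p ↔
      IsAdmissible U γ ρ p ∧ Locally U fun W => H1Geodesic W ρ p φ := by
  constructor
  · intro h
    obtain ⟨hρ, hp, hadm, hmom, hen, hpdot⟩ := (isCIGPair_iff hU hγ).1 h
    refine ⟨hadm, fun x hx => ?_⟩
    have hdp : ∀ y ∈ U, ∀ i, pd p i y = 0 := by
      intro y hy i
      have h1 := hmom y hy i
      rw [hpdot y hy, hθ y hy, ha y hy] at h1
      simpa using h1
    have hdρ : ∀ y ∈ U, dot u ρ y = 0 := by
      intro y hy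
      have h1 := hen y hy
      rw [hθ y hy] at h1
      linarith
    obtain ⟨V, hV, hxV, hVU, hVp⟩ := exists_eq_const hU hp hdp hx
    obtain ⟨W, R, hW, hxW, hWU, hR⟩ :=
      exists_eq_comp_invariants hU hφ (fun y hy => hu.ne_zero hy) hρ hdρ hx
    exact ⟨V ∩ W, hV.inter hW, ⟨hxV, hxW⟩, inter_subset_left.trans hVU, p x, R,
      fun y hy => ⟨(hR y hy.2).1, hVp y hy.1, (hR y hy.2).2⟩⟩
  · rintro ⟨hadm, hloc⟩
    refine isCIGPair_of_pointwise hU hγ hadm fun x hx => ?_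
    obtain ⟨W, hW, hxW, hWU, p₀, R, hval⟩ := hloc x hx
    have hρ : ρ =ᶠ[𝓝 x] fun y => R (φ y) := by
      filter_upwards [hW.mem_nhds hxW] with y hy using (hval y hy).2.2
    have hp : p =ᶠ[𝓝 x] fun _ => p₀ := by
      filter_upwards [hW.mem_nhds hxW] with y hy using (hval y hy).2.1
    have hdp : ∀ i, pd p i x = 0 := fun i => by
      rw [pd_congr hW hxW fun y hy => (hval y hy).2.1, pd_const]
    have hdotp : dot u p x = 0 := by
      rw [dot_congr hW hxW fun y hy => (hval y hy).2.1, dot_const]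
    refine ⟨ContDiffAt.congr_of_eventuallyEq
      (ContDiffAt.comp x (hval x hxW).1 (hφ.contDiffAt hU hx)) hρ,
      contDiffAt_const.congr_of_eventuallyEq hp, fun i => ?_, ?_, ?_⟩
    · rw [hdp, hdotp, ha x hx]
      simp
    · rw [dot_congr hW hxW fun y hy => (hval y hy).2.2, hφ.dot_comp hU hx (hval x hxW).1,
        hθ x hx]
      ring
    · rw [hdotp, hθ x hx]
      ring

/-- With θ = 0 the pressure is constant along u and momentum conservation reads d(-p) = (ρ+p)a,
where ρ+p > 0. -/
theorem IsCIGPair.isAccPotential (hU : IsOpen U) (hθ : ∀ x ∈ U, theta g u x = 0)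
    (h : IsCIGPair U g u γ ρ p) : IsAccPotential U g u (fun x => -p x) fun x => ρ x + p x := by
  obtain ⟨hρ, hp, hadm, hmom, hen, hpdot⟩ := (isCIGPair_iff hU h.one_lt).1 h
  refine ⟨hp.neg, hρ.add hp, fun x hx => ?_, fun x hx i => ?_⟩
  · obtain ⟨h1, h2⟩ := hadm x hx
    have h3 : 0 < p x / (γ - 1) := div_pos h1 (by linarith [h.one_lt])
    linarith
  · have h1 := hmom x hx i
    rw [hpdot x hx, hθ x hx] at h1
    rw [pd_neg]
    linarith

/-- An integrable acceleration satisfies `a ∧ da = 0`. -/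
theorem IsAccPotential.vVec_eq_zero (h : IsAccPotential U g u α β) (hU : IsOpen U)
    (hg : IsLorentzMetric U g) (hu : IsUnitTimelike U g u) {x : Pt} (hx : x ∈ U) :
    vVec g u x = 0 := by
  refine hodge3_eq_zero fun i j k => ?_
  have h1 := closed_of_grad hU hg hu h.smooth_alpha (smooth_const 0)
    h.smooth_beta.neg (fun y hy j => by rw [h.potential y hy j]; ring) hx
  simp only [pd_const, pd_neg, zero_mul, sub_zero, add_zero] at h1
  refine (mul_eq_zero.1 (?_ : β x * _ = 0)).resolve_left (h.ne_zero x hx)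
  simp only [wedge12]
  linear_combination acc g u x i * h1 j k + acc g u x j * h1 k i + acc g u x k * h1 i j

theorem locally_isAccPotential_of_theta_eq_zero (hθ : ∀ x ∈ U, theta g u x = 0)
    (hCIG : IsCIGVelocity U g u) :
    Locally U fun W => ∃ α β : Pt → ℝ, IsAccPotential W g u α β := by
  intro x hx
  obtain ⟨W, hW, hxW, hWU, γ, ρ, p, h⟩ := hCIG x hx
  exact ⟨W, hW, hxW, hWU, _, _, h.isAccPotential hW fun y hy => hθ y (hWU hy)⟩

/-- An existing gas provides the particular integrant factor ρ+p, which is constant along u; hence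
(c,u) = 0, and then every integrant factor is constant along u. -/
theorem IsAccPotential.dot_beta_eq_zero (h : IsAccPotential U g u α β) (hU : IsOpen U)
    (hg : IsLorentzMetric U g) (hu : IsUnitTimelike U g u) (hθ : ∀ x ∈ U, theta g u x = 0)
    (ha : ∀ x ∈ U, acc g u x ≠ 0) (hCIG : IsCIGVelocity U g u) {x : Pt} (hx : x ∈ U) :
    dot u β x = 0 := by
  obtain ⟨W, hW, hxW, hWU, γ, ρ, p, hpair⟩ := hCIG x hx
  have hv := h.vVec_eq_zero hU hg hu hx
  obtain ⟨hρ, hp, -, -, hen, hpdot⟩ := (isCIGPair_iff hW hpair.one_lt).1 hpair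
  have h' := hpair.isAccPotential hW fun y hy => hθ y (hWU hy)
  have h1 := h'.dot_beta hW (hg.mono hWU) (hu.mono hWU) hxW (ha x hx) hv
  have h2 := hen x hxW
  have h3 := hpdot x hxW
  rw [hθ x hx] at h2 h3
  rw [dot_add (hρ.diffAt hW hxW) (hp.diffAt hW hxW)] at h1
  have h4 : (ρ x + p x) * cu g u x = 0 := by linarith
  rw [h.dot_beta hU hg hu hx (ha x hx) hv, (mul_eq_zero.1 h4).resolve_left (h'.ne_zero x hxW),
    mul_zero]

theorem contDiffAt_deriv {P : ℝ → ℝ} {s : ℝ} (hP : ContDiffAt ℝ ∞ P s) :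
    ContDiffAt ℝ ∞ (deriv P) s := by
  have h1 : ContDiffAt ℝ ∞ (fderiv ℝ P) s := hP.fderiv_right (by simp)
  exact h1.clm_apply contDiffAt_const

/-- Momentum conservation makes dp proportional to dα, so p = P(α), and comparing coefficients of a
gives ρ. Conversely, energy conservation requires β̇ = 0, and this is where the hypothesis that u is
the velocity of some gas is used. -/
theorem isCIGPair_iff_H1NonGeodesic (hU : IsOpen U) (hg : IsLorentzMetric U g)
    (hu : IsUnitTimelike U g u) (hθ : ∀ x ∈ U, theta g u x = 0) (ha : ∀ x ∈ U, acc g u x ≠ 0)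
    (hCIG : IsCIGVelocity U g u) (hαβ : IsAccPotential U g u α β) (hγ : 1 < γ) :
    IsCIGPair U g u γ ρ p ↔
      IsAdmissible U γ ρ p ∧ Locally U fun W => H1NonGeodesic W ρ p α β := by
  have hα := hαβ.smooth_alpha
  have hβ := hαβ.smooth_beta
  constructor
  · intro h
    obtain ⟨hρ, hp, hadm, hmom, hen, hpdot⟩ := (isCIGPair_iff hU hγ).1 h
    refine ⟨hadm, fun x hx => ?_⟩
    have hdp : ∀ y ∈ U, ∀ i, pd p i y = -((ρ y + p y) * acc g u y i) := by
      intro y hy i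
      have h1 := hmom y hy i
      rw [hpdot y hy, hθ y hy] at h1
      linarith
    obtain ⟨W, P, hW, hxW, hWU, hP⟩ := exists_eq_comp_of_wedge_eq_zero hU hα hp
      (fun y hy => hαβ.exists_pd_ne_zero hy (ha y hy))
      (fun y hy i j => by rw [hdp y hy, hdp y hy, hαβ.potential y hy, hαβ.potential y hy]; ring) hx
    refine ⟨W, hW, hxW, hWU, P, fun y hy => ⟨(hP y hy).1, (hP y hy).2, ?_⟩⟩
    obtain ⟨i, hi⟩ := Function.ne_iff.1 (ha y (hWU hy))
    have h1 := hdp y (hWU hy) i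
    rw [pd_congr hW hy fun z hz => (hP z hz).2,
      pd_comp ((hP y hy).1.differentiableAt (by simp)) (hα.diffAt hU (hWU hy)),
      hαβ.potential y (hWU hy)] at h1
    have h2 : (ρ y + p y + β y * deriv P (α y)) * acc g u y i = 0 := by linear_combination h1
    have h3 := (mul_eq_zero.1 h2).resolve_right hi
    rw [← (hP y hy).2]
    linarith
  · rintro ⟨hadm, hloc⟩
    refine isCIGPair_of_pointwise hU hγ hadm fun x hx => ?_
    obtain ⟨W, hW, hxW, hWU, P, hval⟩ := hloc x hx
    have hP := (hval x hxW).1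
    have hαx := hα.contDiffAt hU hx
    have hαd := hα.diffAt hU hx
    have hβd := hβ.diffAt hU hx
    have hPα := contDiffAt_comp_scalar hP hαx
    have hP' := contDiffAt_deriv hP
    have hP'α := contDiffAt_comp_scalar hP' hαx
    have hp : ∀ y ∈ W, p y = P (α y) := fun y hy => (hval y hy).2.1
    have hρ : ∀ y ∈ W, ρ y = -P (α y) - β y * deriv P (α y) := fun y hy => (hval y hy).2.2
    have hPd := hP.differentiableAt (by simp)
    have hP'd := hP'.differentiableAt (by simp)
    have hdotp : dot u p x = 0 := by
      rw [dot_congr hW hxW hp, dot_comp hPd hαd, hαβ.dot_alpha hx, mul_zero]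
    have hnegd : DifferentiableAt ℝ (fun y => (-1) * P (α y)) x :=
      (hPα.differentiableAt (by simp)).const_mul _
    have hβP : DifferentiableAt ℝ (fun y => β y * deriv P (α y)) x :=
      hβd.mul (hP'α.differentiableAt (by simp))
    refine ⟨ContDiffAt.congr_of_eventuallyEq
      (hPα.neg.sub ((hβ.contDiffAt hU hx).mul hP'α))
        (Filter.eventuallyEq_of_mem (hW.mem_nhds hxW) hρ),
      hPα.congr_of_eventuallyEq (Filter.eventuallyEq_of_mem (hW.mem_nhds hxW) hp),
      fun i => ?_, ?_, ?_⟩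
    · rw [hdotp, pd_congr hW hxW hp, pd_comp hPd hαd, hαβ.potential x hx, hρ x hxW, hp x hxW]
      ring
    · rw [dot_congr hW hxW fun y hy => (by rw [hρ y hy]; ring :
        ρ y = (-1) * P (α y) - β y * deriv P (α y)), dot_sub hnegd hβP,
        dot_const_mul _ (hPα.differentiableAt (by simp)),
        dot_mul hβd (hP'α.differentiableAt (by simp)), dot_comp hPd hαd, dot_comp hP'd hαd,
        hαβ.dot_alpha hx, hαβ.dot_beta_eq_zero hU hg hu hθ ha hCIG hx, hθ x hx]
      ring
    · rw [hdotp, hθ x hx]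
      ring

end Expansion

/-! ### Geodesic velocities with nonzero expansion: the class C₂ -/

section GeodesicExpanding

variable {U W : Set Pt} {g : MetricField} {u : Field1} {γ : ℝ} {ρ p f ψ t : Pt → ℝ}
  {φ : Pt → Fin 3 → ℝ} {I : ℝ → ℝ}

theorem exists_smooth_primitive {F : ℝ → ℝ} {c r : ℝ} (hF : ContDiffOn ℝ ∞ F (ball c r)) :
    ∃ I : ℝ → ℝ, ContDiffOn ℝ ∞ I (ball c r) ∧ ∀ s ∈ ball c r, deriv I s = F s := by
  have hder : ∀ s ∈ ball c r, HasDerivAt (fun s => ∫ y in c..s, F y) (F s) s := by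
    intro s hs
    have hc : c ∈ ball c r := mem_ball_self (pos_of_mem_ball hs)
    have hsub : uIcc c s ⊆ ball c r := by
      rw [← segment_eq_uIcc]
      exact (convex_ball c r).segment_subset hc hs
    exact intervalIntegral.integral_hasDerivAt_right
      (hF.continuousOn.mono hsub).intervalIntegrable
      (hF.continuousOn.stronglyMeasurableAtFilter isOpen_ball s hs)
      (hF.continuousOn.continuousAt (isOpen_ball.mem_nhds hs))
  refine ⟨_, ?_, fun s hs => (hder s hs).deriv⟩
  rw [contDiffOn_infty_iff_deriv_of_isOpen isOpen_ball]
  exact ⟨fun s hs => (hder s hs).differentiableAt.differentiableWithinAt,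
    hF.congr fun s hs => (hder s hs).deriv⟩

theorem IsUnitTimelike.lower_ne_zero (hu : IsUnitTimelike U g u) {x : Pt} (hx : x ∈ U) :
    lower g u x ≠ 0 := by
  intro h
  have := hu.unit x hx
  simp [h] at this

/-- For geodesic velocities of expanding gases, `du = 0` and `dθ = -θ̇ u`. -/
theorem IsGasPotential.geodesic (hW : IsOpen W) (hg : IsLorentzMetric W g)
    (hu : IsUnitTimelike W g u) (h : IsGasPotential W g u γ f ψ)
    (hθ : ∀ x ∈ W, theta g u x ≠ 0) (ha : ∀ x ∈ W, acc g u x = 0) {x : Pt} (hx : x ∈ W) :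
    (∀ j, pd (theta g u) j x = -dot u (theta g u) x * lower g u x j) ∧
      ∀ i j, extD (lower g u) x i j = 0 := by
  have hda : ∀ i j, extD (acc g u) x i j = 0 := by
    intro i j
    have h1 : ∀ i j, pd (fun y => acc g u y j) i x = 0 := fun i j => by
      rw [pd_congr hW hx (h := fun _ => 0) fun y hy => by rw [ha y hy]; rfl, pd_const]
    rw [extD, h1, h1, sub_zero]
  have h1 := h.closed hW hg hu hx
  have h2 : ∀ j, pd (theta g u) j x = -dot u (theta g u) x * lower g u x j := by
    intro j
    -- Since a vanishes identically, so does da, and the contraction holds with c = 0.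
    rw [contract_closed h1 (hu.unit x hx) (sum_mul_acc g u x) (sum_extD_lower g u x)
      (c := 0) (fun j => by simp [hda, ha x hx]) j, ha x hx, Pi.zero_apply, mul_zero, add_zero]
    rfl
  refine ⟨h2, fun i j => ?_⟩
  have h3 := h1 i j
  rw [h2 i, h2 j, hda, ha x hx] at h3
  have h4 : theta g u x * extD (lower g u) x i j = 0 := by
    simp only [Pi.zero_apply, mul_zero] at h3
    linear_combination h3
  exact (mul_eq_zero.1 h4).resolve_left (hθ x hx)

/-- Since du = 0, the Poincaré lemma gives t with u = -dt. Then dθ = -θ̇u = θ̇dt makes θ a function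
of t, which is integrated to obtain I. -/
theorem locally_isTimePotential (hg : IsLorentzMetric U g)
    (hu : IsUnitTimelike U g u) (h2 : IsC2 U g u) (hCIG : IsCIGVelocity U g u) :
    Locally U fun W => ∃ (t : Pt → ℝ) (I : ℝ → ℝ) (φ : Pt → Fin 3 → ℝ),
      IsTimePotential W g u t I ∧ IsInvariants W u φ := by
  intro x hx
  obtain ⟨V, hV, hxV, hVU, γ, ρ, p, h⟩ := hCIG x hx
  have hgV := hg.mono hVU
  have huV := hu.mono hVU
  have hgeo : ∀ y ∈ V, _ := fun y hy => (h.isGasPotential hV).geodesic hV hgV huV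
    (fun z hz => (h2 z (hVU hz)).1) (fun z hz => (h2 z (hVU hz)).2) hy
  obtain ⟨W₁, T, hW₁, hxW₁, hW₁V, hT, hTu⟩ := exists_potential hV (smooth_lower hgV huV.smooth)
    (fun y hy => (hgeo y hy).2) hxV
  have hθ : Smooth W₁ (theta g u) := (smooth_theta hV hgV huV.smooth).mono hW₁V
  have htneg : ∀ y ∈ W₁, ∀ i, lower g u y i = -pd (fun y => -T y) i y := by
    intro y hy i
    rw [pd_neg, hTu y hy]
    ring
  obtain ⟨i₀, hi₀⟩ := Function.ne_iff.1 (hu.lower_ne_zero hx)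
  obtain ⟨W₂, r, F, hW₂, hxW₂, hW₂W₁, hF, hFval⟩ := exists_eq_comp_scalar hW₁ hT.neg hθ
    (k := dot u (theta g u)) (fun y hy i => by
      rw [(hgeo y (hW₁V hy)).1, htneg y hy]; ring) hxW₁ (i₀ := i₀) (by
      intro h0
      have h1 := htneg x hxW₁ i₀
      rw [h0, neg_zero] at h1
      exact hi₀ h1)
  obtain ⟨I, hI, hIF⟩ := exists_smooth_primitive hF
  obtain ⟨W, φ, hW, hxW, hWW₂, hφ⟩ := exists_isInvariants hW₂
    (fun i => (huV.smooth i).mono (hW₂W₁.trans hW₁V)) hxW₂ (hu.ne_zero hx)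
  refine ⟨W, hW, hxW, hWW₂.trans (hW₂W₁.trans (hW₁V.trans hVU)), fun y => -T y, I, φ,
    ⟨hT.neg.mono (hWW₂.trans hW₂W₁), fun y hy => htneg y (hW₂W₁ (hWW₂ hy)), fun y hy => ?_,
      fun y hy => ?_⟩, hφ⟩
  · exact hI.contDiffAt (isOpen_ball.mem_nhds (hFval y (hWW₂ hy)).1)
  · rw [hIF _ (hFval y (hWW₂ hy)).1, (hFval y (hWW₂ hy)).2]

theorem IsTimePotential.pd_comp (ht : IsTimePotential U g u t I) (hU : IsOpen U) {x : Pt}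
    (hx : x ∈ U) (i : Fin 4) :
    pd (fun y => I (t y)) i x = -(theta g u x * lower g u x i) := by
  rw [ClassicalIdealGas.pd_comp ((ht.smooth_I x hx).differentiableAt (by simp))
    (ht.smooth_t.diffAt hU hx), ht.primitive x hx, ht.potential x hx]
  ring

theorem IsTimePotential.smooth_comp (ht : IsTimePotential U g u t I) (hU : IsOpen U) :
    Smooth U fun y => I (t y) :=
  smooth_of_locally fun y hy =>
    contDiffAt_comp_scalar (ht.smooth_I y hy) (ht.smooth_t.contDiffAt hU hy)

/-- The gradient of log p + γI(t) is zero, which fixes p up to a constant. Both n = ρ - p/(γ-1) and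
p^{1/γ} decay along u at the rate θ, so their quotient is invariant and gives B. The converse is
direct differentiation. -/
theorem isCIGPair_iff_H2 (hU : IsOpen U) (hu : IsUnitTimelike U g u)
    (ha : ∀ x ∈ U, acc g u x = 0) (ht : IsTimePotential U g u t I) (hφ : IsInvariants U u φ)
    (hγ : 1 < γ) :
    IsCIGPair U g u γ ρ p ↔
      IsAdmissible U γ ρ p ∧ Locally U fun W => H2 W γ ρ p t I φ := by
  have hγ0 : γ ≠ 0 := by linarith
  have hγ1 : γ - 1 ≠ 0 := by linarith
  have hIt := ht.smooth_comp hU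
  have hroot : ∀ {s : ℝ}, 0 < s → s ^ (1 / γ) = Real.exp (Real.log s / γ) := by
    intro s hs
    rw [Real.rpow_def_of_pos hs, mul_one_div]
  constructor
  · intro h
    obtain ⟨hρ, hp, hadm, hmom, hen, hpdot⟩ := (isCIGPair_iff hU hγ).1 h
    refine ⟨hadm, fun x hx => ?_⟩
    have hp0 : ∀ y ∈ U, p y ≠ 0 := fun y hy => (hadm y hy).1.ne'
    have hlog : Smooth U fun y => Real.log (p y) := ContDiffOn.log hp hp0
    have hγI : Smooth U fun y => γ * I (t y) := (smooth_const γ).mul hIt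
    have hpdlog : ∀ y ∈ U, ∀ i, pd (fun y => Real.log (p y)) i y =
        γ * (theta g u y * lower g u y i) := by
      intro y hy i
      have hpy := hp0 y hy
      have h1 := hmom y hy i
      rw [hpdot y hy, ha y hy, Pi.zero_apply, mul_zero, add_zero] at h1
      rw [pd_comp (Real.differentiableAt_log hpy) (hp.diffAt hU hy), Real.deriv_log]
      field_simp
      linear_combination h1
    obtain ⟨V, hV, hxV, hVU, hconst⟩ := exists_eq_const hU (hlog.add hγI) (fun y hy i => by
      rw [pd_add (hlog.diffAt hU hy) (hγI.diffAt hU hy), hpdlog y hy,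
        pd_const_mul γ (hIt.diffAt hU hy), ht.pd_comp hU hy]
      ring) hx
    have hn : Smooth U fun y => ρ y - p y / (γ - 1) :=
      hρ.sub (hp.div (smooth_const _) fun _ _ => hγ1)
    have hlogγ : Smooth U fun y => Real.log (p y) / γ :=
      hlog.div (smooth_const γ) fun _ _ => hγ0
    have hexp : Smooth U fun y => Real.exp (Real.log (p y) / γ) := ContDiffOn.exp hlogγ
    have hdotexp : ∀ y ∈ U, dot u (fun y => Real.exp (Real.log (p y) / γ)) y =
        -theta g u y * Real.exp (Real.log (p y) / γ) := by
      intro y hy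
      have hpy := hp0 y hy
      rw [dot_comp Real.differentiableAt_exp (hlogγ.diffAt hU hy), Real.deriv_exp]
      have h1 : dot u (fun y => Real.log (p y) / γ) y = -theta g u y := by
        simp only [div_eq_inv_mul]
        rw [dot_const_mul _ (hlog.diffAt hU hy),
          dot_comp (Real.differentiableAt_log hpy) (hp.diffAt hU hy), Real.deriv_log, hpdot y hy]
        field_simp
      rw [h1]
      ring
    have hdotn : ∀ y ∈ U, dot u (fun y => ρ y - p y / (γ - 1)) y =
        -theta g u y * (ρ y - p y / (γ - 1)) := by
      intro y hy
      rw [dot_sub (hρ.diffAt hU hy)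
        ((hp.div (smooth_const (γ - 1)) fun _ _ => hγ1).diffAt hU hy)]
      simp only [div_eq_inv_mul]
      rw [dot_const_mul _ (hp.diffAt hU hy), hpdot y hy]
      have h1 := hen y hy
      field_simp
      linear_combination (γ - 1) * h1
    obtain ⟨W, B, hW, hxW, hWU, hB⟩ := exists_eq_comp_invariants hU hφ
      (fun y hy => hu.ne_zero hy) (hn.div hexp fun y _ => (Real.exp_pos _).ne') (fun y hy => by
        rw [dot_div (hn.diffAt hU hy) (hexp.diffAt hU hy) (Real.exp_pos _).ne', hdotn y hy,
          hdotexp y hy]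
        field_simp
        ring) hx
    refine ⟨V ∩ W, hV.inter hW, ⟨hxV, hxW⟩, inter_subset_left.trans hVU,
      Real.exp (Real.log (p x) + γ * I (t x)), B, fun y hy => ⟨(hB y hy.2).1, ?_, ?_⟩⟩
    · rw [← hconst y hy.1, ← Real.exp_add]
      have : Real.log (p y) + γ * I (t y) + -γ * I (t y) = Real.log (p y) := by ring
      rw [this, Real.exp_log (hadm y (hVU hy.1)).1]
    · rw [← (hB y hy.2).2, hroot (hadm y (hVU hy.1)).1, div_mul_cancel₀ _ (Real.exp_pos _).ne']
      ring
  · rintro ⟨hadm, hloc⟩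
    refine isCIGPair_of_pointwise hU hγ hadm fun x hx => ?_
    obtain ⟨W, hW, hxW, hWU, C, B, hval⟩ := hloc x hx
    have hItW := hIt.mono hWU
    have hexpI : Smooth W fun y => Real.exp (-γ * I (t y)) :=
      ContDiffOn.exp ((smooth_const (-γ)).mul hItW)
    have hpval : ∀ y ∈ W, p y = C * Real.exp (-γ * I (t y)) := fun y hy => (hval y hy).2.1
    have hp : Smooth W p := ContDiffOn.congr ((smooth_const C).mul hexpI) hpval
    have hp0 : ∀ y ∈ W, p y ≠ 0 := fun y hy => (hadm y (hWU hy)).1.ne'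
    have hpx := hp0 x hxW
    have hpd : ∀ i, pd p i x = γ * p x * (theta g u x * lower g u x i) := by
      intro i
      have hItd := hItW.diffAt hW hxW
      rw [pd_congr hW hxW hpval, pd_const_mul _ (hexpI.diffAt hW hxW),
        pd_comp Real.differentiableAt_exp (hItd.const_mul _), Real.deriv_exp,
        pd_const_mul _ hItd, ht.pd_comp hU hx, hpval x hxW]
      ring
    have hdotp : dot u p x = -(γ * p x * theta g u x) := by
      have h1 : dot u p x = γ * p x * theta g u x * ∑ i, lower g u x i * u x i := by
        rw [dot, Finset.mul_sum]
        exact Finset.sum_congr rfl fun i _ => by rw [hpd]; ring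
      rw [h1, hu.unit x hx]
      ring
    have hlog : Smooth W fun y => Real.log (p y) := ContDiffOn.log hp hp0
    have hlogγ : Smooth W fun y => Real.log (p y) / γ :=
      hlog.div (smooth_const γ) fun _ _ => hγ0
    have hexp : Smooth W fun y => Real.exp (Real.log (p y) / γ) := ContDiffOn.exp hlogγ
    have hBφ : Smooth W fun y => B (φ y) := smooth_of_locally fun y hy =>
      ContDiffAt.comp y (hval y hy).1 (hφ.contDiffAt hU (hWU hy))
    have hpγ : Smooth W fun y => p y / (γ - 1) := hp.div (smooth_const _) fun _ _ => hγ1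
    have hρval : ∀ y ∈ W, ρ y = p y / (γ - 1) + B (φ y) * Real.exp (Real.log (p y) / γ) := by
      intro y hy
      rw [← hroot (hadm y (hWU hy)).1]
      exact (hval y hy).2.2
    have hρ : Smooth W ρ := ContDiffOn.congr (hpγ.add (hBφ.mul hexp)) hρval
    have hdotlog : dot u (fun y => Real.log (p y) / γ) x = -theta g u x := by
      simp only [div_eq_inv_mul]
      rw [dot_const_mul _ (hlog.diffAt hW hxW),
        dot_comp (Real.differentiableAt_log hpx) (hp.diffAt hW hxW), Real.deriv_log, hdotp]
      field_simp
    have hdotpγ : dot u (fun y => p y / (γ - 1)) x = -(γ * p x * theta g u x) / (γ - 1) := by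
      simp only [div_eq_inv_mul]
      rw [dot_const_mul _ (hp.diffAt hW hxW), hdotp]
    have hdotρ : dot u ρ x = -(γ * p x * theta g u x) / (γ - 1) -
        B (φ x) * (Real.exp (Real.log (p x) / γ) * theta g u x) := by
      rw [dot_congr hW hxW hρval, dot_add (hpγ.diffAt hW hxW) ((hBφ.mul hexp).diffAt hW hxW),
        dot_mul (hBφ.diffAt hW hxW) (hexp.diffAt hW hxW),
        dot_comp Real.differentiableAt_exp (hlogγ.diffAt hW hxW), Real.deriv_exp, hdotlog, hdotpγ,
        hφ.dot_comp hU hx (hval x hxW).1]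
      ring
    refine ⟨hρ.contDiffAt hW hxW, hp.contDiffAt hW hxW, fun i => ?_, ?_, hdotp⟩
    · rw [hpd, hdotp, ha x hx, Pi.zero_apply]
      ring
    · rw [hdotρ, hρval x hxW]
      field_simp
      ring

end GeodesicExpanding

end ClassicalIdealGas

theorem theorem2 (U : Set Pt) (hU : IsOpen U)
    (g : MetricField) (hg : IsLorentzMetric U g)
    (u : Field1) (hu : IsUnitTimelike U g u)
    (hCIG : IsCIGVelocity U g u) :
    -- class C₁, geodesic
    (IsC1 U g u → (∀ x ∈ U, acc g u x = 0) →
      (Locally U fun W => ∃ φ : Pt → Fin 3 → ℝ, IsInvariants W u φ) ∧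
      ∀ φ : Pt → Fin 3 → ℝ, IsInvariants U u φ →
        ∀ γ : ℝ, 1 < γ → ∀ ρ p : Pt → ℝ,
          (IsCIGPair U g u γ ρ p ↔
            IsAdmissible U γ ρ p ∧ Locally U fun W => H1Geodesic W ρ p φ)) ∧
    -- class C₁, non-geodesic
    (IsC1 U g u → (∀ x ∈ U, acc g u x ≠ 0) →
      (Locally U fun W => ∃ α β : Pt → ℝ, IsAccPotential W g u α β) ∧
      ∀ α β : Pt → ℝ, IsAccPotential U g u α β →
        ∀ γ : ℝ, 1 < γ → ∀ ρ p : Pt → ℝ,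
          (IsCIGPair U g u γ ρ p ↔
            IsAdmissible U γ ρ p ∧ Locally U fun W => H1NonGeodesic W ρ p α β)) ∧
    -- class C₂
    (IsC2 U g u →
      (Locally U fun W => ∃ (t : Pt → ℝ) (I : ℝ → ℝ) (φ : Pt → Fin 3 → ℝ),
        IsTimePotential W g u t I ∧ IsInvariants W u φ) ∧
      ∀ (t : Pt → ℝ) (I : ℝ → ℝ) (φ : Pt → Fin 3 → ℝ),
        IsTimePotential U g u t I → IsInvariants U u φ →
        ∀ γ : ℝ, 1 < γ → ∀ ρ p : Pt → ℝ,
          (IsCIGPair U g u γ ρ p ↔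
            IsAdmissible U γ ρ p ∧ Locally U fun W => H2 W γ ρ p t I φ)) ∧
    -- class C₃
    (IsC3 U g u → ∀ γ : ℝ, 1 < γ → ∀ ρ p : Pt → ℝ,
      (IsCIGPair U g u γ ρ p ↔
        IsAdmissible U γ ρ p ∧ Locally U fun W => H3456 W g u γ ρ p (f1 g u))) ∧
    -- class C₄
    (IsC4 U g u → ∀ γ : ℝ, 1 < γ → ∀ ρ p : Pt → ℝ,
      (IsCIGPair U g u γ ρ p ↔
        IsAdmissible U γ ρ p ∧ Locally U fun W => H3456 W g u γ ρ p (f2 g u))) ∧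
    -- class C₅
    (IsC5 U g u → ∀ γ : ℝ, 1 < γ → ∀ ρ p : Pt → ℝ,
      (IsCIGPair U g u γ ρ p ↔
        IsAdmissible U γ ρ p ∧ Locally U fun W => H5 W g u γ ρ p)) ∧
    -- class C₆: the denominator of f₃ vanishes nowhere on a dense open set, where H₆ holds
    (IsC6 U g u →
      U ⊆ closure {x ∈ U | linCoeff g u x ≠ 0} ∧
      ((∀ x ∈ U, linCoeff g u x ≠ 0) → ∀ γ : ℝ, 1 < γ → ∀ ρ p : Pt → ℝ,
        (IsCIGPair U g u γ ρ p ↔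
          IsAdmissible U γ ρ p ∧ Locally U fun W => H3456 W g u γ ρ p (f3 g u)))) ∧
    -- class C₇: the denominator of f₄ vanishes nowhere on a dense open set, where H₇ holds
    (IsC7 U g u →
      U ⊆ closure {x ∈ U | dot u (theta g u) x ≠ 0} ∧
      (Locally U fun W => ∃ α β : Pt → ℝ, IsAccPotential W g u α β) ∧
      ((∀ x ∈ U, dot u (theta g u) x ≠ 0) →
        ∀ α β : Pt → ℝ, IsAccPotential U g u α β →
          (∀ φ : ℝ → ℝ, (∀ x ∈ U, ContDiffAt ℝ ∞ φ (α x)) →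
            Locally U fun W => ∃ ψ : Pt → ℝ,
              IsPsi W g u (fun y => f4 g u y + β y * φ (α y)) ψ) ∧
          ∀ γ : ℝ, 1 < γ → ∀ ρ p : Pt → ℝ,
            (IsCIGPair U g u γ ρ p ↔
              IsAdmissible U γ ρ p ∧ Locally U fun W => H78 W g u γ ρ p α β (f4 g u)))) ∧
    -- class C₈
    (IsC8 U g u →
      (∀ x ∈ U, cu g u x ≠ 0) ∧
      (Locally U fun W => ∃ α β : Pt → ℝ, IsAccPotential W g u α β) ∧
      ∀ α β : Pt → ℝ, IsAccPotential U g u α β →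
        (∀ φ : ℝ → ℝ, (∀ x ∈ U, ContDiffAt ℝ ∞ φ (α x)) →
          Locally U fun W => ∃ ψ : Pt → ℝ,
            IsPsi W g u (fun y => f5 g u y + β y * φ (α y)) ψ) ∧
        ∀ γ : ℝ, 1 < γ → ∀ ρ p : Pt → ℝ,
          (IsCIGPair U g u γ ρ p ↔
            IsAdmissible U γ ρ p ∧ Locally U fun W => H78 W g u γ ρ p α β (f5 g u))) := by
  refine ⟨fun h1 ha => ⟨locally_isInvariants hU hu, fun φ hφ γ hγ ρ p =>
      isCIGPair_iff_H1Geodesic hU hu h1 ha hφ hγ⟩,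
    fun h1 ha => ⟨locally_isAccPotential_of_theta_eq_zero h1 hCIG, fun α β hαβ γ hγ ρ p =>
      isCIGPair_iff_H1NonGeodesic hU hg hu h1 ha hCIG hαβ hγ⟩,
    fun h2 => ⟨locally_isTimePotential hg hu h2 hCIG, fun t I φ ht hφ γ hγ ρ p =>
      isCIGPair_iff_H2 hU hu (fun x hx => (h2 x hx).2) ht hφ hγ⟩,
    fun h3 γ hγ ρ p => isCIGPair_iff_H3456 hU hg hu (fun x hx => (h3 x hx).1)
      (fun x hx => (h3 x hx).2.1) hγ fun F ψ hF x hx => hF.eq_f1 hU hg hu hx (h3 x hx).2.2,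
    fun h4 γ hγ ρ p => isCIGPair_iff_H3456 hU hg hu (fun x hx => (h4 x hx).1)
      (fun x hx => (h4 x hx).2.1) hγ fun F ψ hF x hx =>
        hF.eq_f2 hU hg hu hx (h4 x hx).2.2.1 (h4 x hx).2.2.2,
    fun h5 γ hγ ρ p => isCIGPair_iff_H5 hU hg hu h5 hγ,
    fun h6 => ⟨h6.subset_closure hU hg hu hCIG, fun hl γ hγ ρ p =>
      isCIGPair_iff_H3456 hU hg hu (fun x hx => (h6 x hx).1) (fun x hx => (h6 x hx).2.1) hγ
        -- With μ̇ = 0 the quadratic is linear, and its nonvanishing coefficient leaves the single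
        -- root f₃.
        fun F ψ hF x hx => eq_f3 (h6 x hx).2.2.2.2 (hl x hx) (hF.quadratic hU hg hu
          (fun y hy => (h6 y hy).1) (fun y hy => (h6 y hy).2.1) (fun y hy => (h6 y hy).2.2.1) hx)⟩,
    fun h7 => ⟨h7.subset_closure hU hg hu hCIG, locally_isAccPotential hU hg hu
      (fun x hx => (h7 x hx).2.1) (fun x hx => (h7 x hx).2.2.1), fun hθ α β hαβ => ?_⟩,
    fun h8 => ⟨h8.cu_ne_zero hg hu hCIG, locally_isAccPotential hU hg hu
      (fun x hx => (h8 x hx).2.1) (fun x hx => (h8 x hx).2.2.1), fun α β hαβ => ?_⟩⟩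
  · have hf := h7.isBaseSolution hg hu hCIG hθ
    exact ⟨fun φ hφ => hf.exists_psi hU hg hu hαβ hφ, fun γ hγ ρ p =>
      hf.isCIGPair_iff hU hg hu h7.hasVanishingNu hαβ hγ⟩
  · have hf := h8.isBaseSolution hg hu hCIG
    exact ⟨fun φ hφ => hf.exists_psi hU hg hu hαβ hφ, fun γ hγ ρ p =>
      hf.isCIGPair_iff hU hg hu h8.hasVanishingNu hαβ hγ⟩
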